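/- Let $X_1,X_2,\ldots$ be i.i.d. copies of a random vector $X\in\mathbb{R}^d$ ($d\ge1$) with Lebesgue density $f_0$, and put $\theta_0=\mathbb{E}[f_0(X)]$. For an estimator $\hat\theta_n=\hat\theta_n(X_1,\ldots,X_n)$ of $\theta_0$ let $\hat\theta_n^*=\hat\theta_n(X_{1,n}^*,\ldots,X_{n,n}^*)$, where $X_{1,n}^*,\ldots,X_{n,n}^*$ is a random sample from the empirical distribution of $X_1,\ldots,X_n$, and let $\mathbb{P}_n^*$ denote probability conditional on the data. The bootstrap is called consistent for $\hat\theta_n$ if $$\sup_{t\in\mathbb{R}}\left|\mathbb{P}[\sqrt n(\hat\theta_n-\theta_0)\le t]-\mathbb{P}_n^*[\sqrt n(\hat\theta_n^*-\hat\theta_n)\le t]\right|\to0\quad\text{in probability as } n\to\infty.$$ Conditions. Let $s$ and $P$ be real numbers, let $h_n>0$ be a sequence of bandwidths, and put $S=\min(P/2,s)$. (D) $s>d/4$, $2s\notin\mathbb{N}$, and $f_0$ is bounded and belongs to the Besov space $B^s_{2\infty}(\mathbb{R}^d)$. Moreover $\sigma_0^2=\mathbb{V}[2\{f_0(X)-\theta_0\}]>0$.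 (K) $P>d/2$, and $K:\mathbb{R}^d\to\mathbb{R}$ is even and bounded with $\int|K(u)|(1+\|u\|_1^P)\,du<\infty$, $\int K(u)\,du=1$, and $\int u^lK(u)\,du=0$ for all $l\in\mathbb{Z}_+^d$ with $0<\|l\|_1<P$. (B) $nh_n^{4S}\to0$ and $nh_n^d\to\infty$. (B$^+$) $nh_n^{4S}\to0$ and $nh_n^{2d}\to\infty$. Estimators. With $K_n(x)=h_n^{-d}K(x/h_n)$ and $\hat f_n(x)=\frac1n\sum_{1\le j\le n}K_n(x-X_j)$, let $$\hat\theta_n^{\mathtt{ISD}}=\int_{\mathbb{R}^d}\hat f_n(x)^2dx,\qquad \hat\theta_n^{\mathtt{ISD-BC}}=\hat\theta_n^{\mathtt{ISD}}-\frac{\int K(u)^2du}{nh_n^d},$$ $$\hat\theta_n^{\mathtt{ISD-GJ}}=\frac1{1-c^d}\hat\theta_n^{\mathtt{ISD}}-\frac{c^d}{1-c^d}\hat\theta_n^{\mathtt{ISD}}(ch_n),$$ where $c>0$, $c\ne1$ is a constant and $\hat\theta_n^{\mathtt{ISD}}(ch_n)$ is $\hat\theta_n^{\mathtt{ISD}}$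 computed with the bandwidth $ch_n$. For integers $B_n\in\{2,\ldots,n\}$ (for $n\ge2$) let $$\hat\theta_n^{\mathtt{ISD-LO}}=\frac1n\sum_{1\le i\le n}\int_{\mathbb{R}^d}\hat f_{i,n}^{\mathtt{LO}}(x)^2dx,\qquad \hat f_{i,n}^{\mathtt{LO}}(x)=\sum_{1\le j\le n}w_{ij,n}K_n(x-X_j),$$ $$w_{ij,n}=\frac{\mathbf 1(\lceil iB_n/n\rceil\ne\lceil jB_n/n\rceil)}{\sum_{1\le k\le n}\mathbf 1(\lceil iB_n/n\rceil\ne\lceil kB_n/n\rceil)}.$$ Finally, let $$\hat\theta_n^{\mathtt{ISD-DCF}}=\int_{\mathbb{R}^d}\left[\frac1{n-\lfloor n/2\rfloor}\sum_{\lfloor n/2\rfloor<j\le n}K_n(x-X_j)\right]\left[\frac1{\lfloor n/2\rfloor}\sum_{1\le j\le\lfloor n/2\rfloor}K_n(x-X_j)\right]dx.$$ Theorem. Suppose (D), (K) and (B) hold. Then the bootstrap is consistent for $\hat\theta_n^{\mathtt{ISD}}$ and for $\hat\theta_n^{\mathtt{ISD-GJ}}$. If $B_n=n$, then it is also consistent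 for $\hat\theta_n^{\mathtt{ISD-LO}}$. If (B) is strengthened to (B$^+$), then the bootstrap is consistent for $\hat\theta_n^{\mathtt{ISD-BC}}$, for $\hat\theta_n^{\mathtt{ISD-LO}}$ (for every choice of $B_n\in\{2,\ldots,n\}$), and for $\hat\theta_n^{\mathtt{ISD-DCF}}$. -/

import Mathlib

open MeasureTheory ProbabilityTheory Filter Topology
open scoped ENNReal NNReal

noncomputable section

namespace AvgDensity

/-- `d`-dimensional Euclidean space, with its Lebesgue measure `volume`. -/
abbrev E (d : ℕ) : Type := EuclideanSpace ℝ (Fin d)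

/-! ### The estimand -/

/-- The distribution on `ℝ^d` with Lebesgue density `f₀`. -/
def densityLaw {d : ℕ} (f₀ : E d → ℝ) : Measure (E d) :=
  volume.withDensity fun x => ENNReal.ofReal (f₀ x)

/-- The average density `θ₀ = 𝔼[f₀(X)]`, where `X` has density `f₀`. -/
def theta0 {d : ℕ} (f₀ : E d → ℝ) : ℝ :=
  ∫ x, f₀ x ∂(densityLaw f₀)

/-- The efficient influence function `L₀(x) = 2 (f₀(x) - θ₀)`. -/
def influence {d : ℕ} (f₀ : E d → ℝ) (x : E d) : ℝ :=
  2 * (f₀ x - theta0 f₀)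

/-- The semiparametric variance bound `σ₀² = 𝕍[L₀(X)]`. -/
def sigma0Sq {d : ℕ} (f₀ : E d → ℝ) : ℝ :=
  variance (influence f₀) (densityLaw f₀)

/-! ### The conditions on the density, the kernel and the bandwidth -/

/-- Membership in the Besov space `B^s_{2,∞}(ℝ^d)`, for `s > 0`: `f` is square integrable and
its differences of order `⌊s⌋ + 1` satisfy `‖Δ_u^{⌊s⌋+1} f‖_{L²} ≤ C |u|^s` for all `u`. -/
def MemBesovTwoInfty {d : ℕ} (s : ℝ) (f : E d → ℝ) : Prop :=
  MemLp f 2 volume ∧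
    ∃ C : ℝ≥0, ∀ u : E d,
      eLpNorm ((fwdDiff u)^[⌊s⌋₊ + 1] f) 2 volume ≤ C * ENNReal.ofReal (‖u‖ ^ s)

/-- Condition D on the density `f₀`, with smoothness index `s`. -/
structure CondD (d : ℕ) (s : ℝ) (f₀ : E d → ℝ) : Prop where
  s_gt : (d : ℝ) / 4 < s
  two_s_not_nat : ∀ m : ℕ, 2 * s ≠ m
  bounded : ∃ M : ℝ, ∀ x, f₀ x ≤ M
  besov : MemBesovTwoInfty s f₀

/-- The `ℓ₁`-norm on `ℝ^d`. -/
def l1norm {d : ℕ} (u : E d) : ℝ := ∑ i, |u i|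

/-- The monomial `u^l = u₁^{l₁} ⋯ u_d^{l_d}`. -/
def monom {d : ℕ} (u : E d) (l : Fin d → ℕ) : ℝ := ∏ i, u i ^ l i

/-- Condition K on the kernel `K`, with order `P`. -/
structure CondK (d : ℕ) (P : ℝ) (K : E d → ℝ) : Prop where
  P_gt : (d : ℝ) / 2 < P
  measurable : Measurable K
  even : ∀ u, K (-u) = K u
  bounded : ∃ M : ℝ, ∀ u, |K u| ≤ M
  integrable : Integrable (fun u => |K u| * (1 + l1norm u ^ P)) volume
  integral_one : ∫ u, K u = 1
  moment_zero : ∀ l : Fin d → ℕ, 0 < ∑ i, l i → ((∑ i, l i : ℕ) : ℝ) < P →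
    ∫ u, monom u l * K u = 0

/-- Condition B: `n hₙ^{4S} → 0` and `n hₙ^d → ∞`. -/
structure CondB (d : ℕ) (S : ℝ) (h : ℕ → ℝ) : Prop where
  upper : Tendsto (fun n : ℕ => (n : ℝ) * h n ^ (4 * S)) atTop (𝓝 0)
  lower : Tendsto (fun n : ℕ => (n : ℝ) * h n ^ d) atTop atTop

/-- Condition B⁺: `n hₙ^{4S} → 0` and `n hₙ^{2d} → ∞`. -/
structure CondBPlus (d : ℕ) (S : ℝ) (h : ℕ → ℝ) : Prop where
  upper : Tendsto (fun n : ℕ => (n : ℝ) * h n ^ (4 * S)) atTop (𝓝 0)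
  lower : Tendsto (fun n : ℕ => (n : ℝ) * h n ^ (2 * d)) atTop atTop

/-! ### The estimators

A sample of size `n` is `x : Fin n → ℝ^d`; the observation with number `i ∈ {1, …, n}` is the
value of `x` at the element `i - 1` of `Fin n`. -/

/-- The rescaled kernel `K_h(u) = h^{-d} K(u / h)`. -/
def scaledKernel {d : ℕ} (K : E d → ℝ) (h : ℝ) (u : E d) : ℝ :=
  1 / h ^ d * K (h⁻¹ • u)

/-- The kernel density estimator `n⁻¹ ∑ⱼ K_h(y - xⱼ)`. -/
def kde {d n : ℕ} (K : E d → ℝ) (h : ℝ) (x : Fin n → E d) (y : E d) : ℝ :=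
  1 / (n : ℝ) * ∑ j, scaledKernel K h (y - x j)

/-- The plug-in integrated squared density estimator. -/
def isd {d n : ℕ} (K : E d → ℝ) (h : ℝ) (x : Fin n → E d) : ℝ :=
  ∫ y, kde K h x y ^ 2

/-- The bias-corrected integrated squared density estimator. -/
def isdBC {d n : ℕ} (K : E d → ℝ) (h : ℝ) (x : Fin n → E d) : ℝ :=
  isd K h x - (∫ u, K u ^ 2) / ((n : ℝ) * h ^ d)

/-- The generalized jackknife integrated squared density estimator with constant `c`. -/
def isdGJ {d n : ℕ} (K : E d → ℝ) (c h : ℝ) (x : Fin n → E d) : ℝ :=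
  1 / (1 - c ^ d) * isd K h x - c ^ d / (1 - c ^ d) * isd K (c * h) x

/-- The number `⌈i B / n⌉` of the block of observation `i ∈ {1, …, n}`, when `{1, …, n}` is
partitioned into `B` blocks. -/
def block (n B i : ℕ) : ℕ := ⌈((i : ℚ) * B) / n⌉₊

/-- The indicator that the observations at `i` and `j` lie in different blocks. -/
def diffBlock {n : ℕ} (B : ℕ) (i j : Fin n) : ℝ :=
  if block n B (i + 1) ≠ block n B (j + 1) then 1 else 0

/-- The leave-out weights `w_{ij,n}`. -/
def weight {n : ℕ} (B : ℕ) (i j : Fin n) : ℝ :=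
  diffBlock B i j / ∑ k, diffBlock B i k

/-- The leave-out density estimator that omits the block of observation `i`. -/
def kdeLO {d n : ℕ} (B : ℕ) (K : E d → ℝ) (h : ℝ) (x : Fin n → E d) (i : Fin n) (y : E d) : ℝ :=
  ∑ j, weight B i j * scaledKernel K h (y - x j)

/-- The leave-out integrated squared density estimator with `B` blocks. -/
def isdLO {d n : ℕ} (B : ℕ) (K : E d → ℝ) (h : ℝ) (x : Fin n → E d) : ℝ :=
  1 / (n : ℝ) * ∑ i, ∫ y, kdeLO B K h x i y ^ 2

/-- The two-fold cross-fit density estimator for observation number `i ∈ {1, …, n}`: it averages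
over the half of the sample that does not contain `i`, where the halves are
`{1, …, ⌊n/2⌋}` and `{⌊n/2⌋ + 1, …, n}`. -/
def kdeCF {d n : ℕ} (K : E d → ℝ) (h : ℝ) (x : Fin n → E d) (i : ℕ) (y : E d) : ℝ :=
  if i ≤ n / 2 then
    1 / ((n - n / 2 : ℕ) : ℝ) *
      ∑ j : Fin n, if n / 2 < (j : ℕ) + 1 then scaledKernel K h (y - x j) else 0
  else
    1 / ((n / 2 : ℕ) : ℝ) *
      ∑ j : Fin n, if (j : ℕ) + 1 ≤ n / 2 then scaledKernel K h (y - x j) else 0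

/-- The doubly cross-fit integrated squared density estimator. -/
def isdDCF {d n : ℕ} (K : E d → ℝ) (h : ℝ) (x : Fin n → E d) : ℝ :=
  ∫ y, kdeCF K h x 1 y * kdeCF K h x n y

/-! ### Bootstrap consistency -/

/-- The empirical distribution `n⁻¹ ∑ᵢ δ_{xᵢ}` of the sample `x`. -/
def empirical {d n : ℕ} (x : Fin n → E d) : Measure (E d) :=
  (n : ℝ≥0∞)⁻¹ • ∑ i, Measure.dirac (x i)

/-- The bootstrap distribution given the data `x`: the law of a random sample of size `n` from
the empirical distribution of `x`. -/
def bootLaw {d n : ℕ} (x : Fin n → E d) : Measure (Fin n → E d) :=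
  Measure.pi fun _ => empirical x

/-- The Kolmogorov distance between the distribution of `√n (θ̂ₙ - θ₀)` and the bootstrap
distribution of `√n (θ̂ₙ* - θ̂ₙ)` given the data `x`, for the estimator `θ̂ₙ = T(X₁, …, Xₙ)`. -/
def bootDist {d : ℕ} {Ω : Type*} [MeasurableSpace Ω] (μ : Measure Ω) (X : ℕ → Ω → E d)
    (θ₀ : ℝ) (n : ℕ) (T : (Fin n → E d) → ℝ) (x : Fin n → E d) : ℝ :=
  ⨆ t : ℝ, |μ.real {ω | √(n : ℝ) * (T (fun i => X i ω) - θ₀) ≤ t} -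
    (bootLaw x).real {y | √(n : ℝ) * (T y - T x) ≤ t}|

/-- Bootstrap consistency of the estimators `θ̂ₙ = T n (X₁, …, Xₙ)` of `θ₀`: the above distance,
at the observed data, converges to zero in probability. -/
def BootstrapConsistent {d : ℕ} {Ω : Type*} [MeasurableSpace Ω] (μ : Measure Ω)
    (X : ℕ → Ω → E d) (θ₀ : ℝ) (T : (n : ℕ) → (Fin n → E d) → ℝ) : Prop :=
  TendstoInMeasure μ (fun n ω => bootDist μ X θ₀ n (T n) fun i => X i ω) atTop fun _ => 0

end AvgDensity

end

noncomputable section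

namespace AvgDensity

/-! ### Plancherel's identity for integrable and square-integrable functions -/

section Plancherel

open FourierTransform SchwartzMap

variable {V : Type*} [NormedAddCommGroup V] [InnerProductSpace ℝ V] [FiniteDimensional ℝ V]
  [MeasurableSpace V] [BorelSpace V]

/-! Each estimator integrates products of two kernel averages, and `∫ K_h(y-a) K_h(y-b) dy =
κ_h(a-b)` with `κ` the autocorrelation of `K`. So each is a quadratic statistic `∑ A j k * H (X j)
(X k) + c` with `H x z = κ_h(x-z)`. Only the weights `A`, the constant `c` and, for the jackknife,
the kernel `κ` vary between estimators.

`H` is constant on the diagonal, so the diagonal adds the deterministic shift `√n tr(A) κ(0)/h^d`.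
Under (B) this shift need not vanish, but it is the same for the statistic and its bootstrap
version, so it cancels in the Kolmogorov distance: both distribution functions are compared with one
shifted normal one. The off-diagonal part has a Hoeffding decomposition. Row plus column sums of `A`
are `2/n + O(n⁻²)`, so the linear term is `(2/n) ∑ (f₀(X j) - θ₀)` up to a smoothing error that
tends to zero in `L²`. The degenerate term has variance of order at most `n⁻² h^{-d}`, negligible
since `n h^d → ∞` (`integral_sq_quadratic_sub_linear_le`).

These bounds are explicit in the sampling law, and the central limit theorem is uniform over laws
with nearly the right variance (`exists_forall_abs_linStat_sub_normalCdf_le`). Hence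
`abs_quadratic_cdf_sub_normalCdf_le` also applies conditionally, with the empirical distribution as
the sampling law. Its error terms are then random, but have small expectation, and Markov's
inequality finishes (`bootstrapConsistent_of_quadratic`). The delicate term is the bootstrap
centering (`integral_sq_bootstrap_center_le`). The mean of `H` under two independent draws from the
empirical distribution has its own diagonal, which leaves the deterministic mismatch `((1 - tr A)/n
- tr A) κ(0)/h^d`. The first factor is `O(n⁻²)` for uniform and leave-one-out weights, so (B)
suffices; in general it is `O(n⁻¹)`, and (B⁺) is needed. (B⁺) also makes the explicit bias
correction negligible at scale `√n`.

The bias is `-½ ∫ κ(v) ‖f₀(·+hv) - f₀‖² dv`, quadratic in differences of `f₀`. By Plancherel the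
squared norm is an integral of `2 - 2cos` against `|f̂₀|²`. The vanishing moments of `κ` allow the
cosine to be replaced by its Taylor remainder, and the Besov condition bounds the integrated
remainder. This gives `O(h^{min(P,2s)})`, hence `o(n^{-1/2})` (`EvenKernel.exists_bias_bound`). -/

theorem fourier_toLp_ae_eq {f : V → ℂ} (h1 : Integrable f) (h2 : MemLp f 2) :
    ((𝓕 (h2.toLp f) : Lp (α := V) ℂ 2 volume) : V → ℂ) =ᵐ[volume] 𝓕 f := by
  -- Both sides are locally integrable, so it suffices to test against smooth compactly supported
  -- functions. There each transform can be moved onto the test function, the left one as a tempered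
  -- distribution and the right one by Fubini.
  apply ae_eq_of_integral_contDiff_smul_eq
  · exact (Lp.memLp (𝓕 (h2.toLp f))).locallyIntegrable (by norm_num)
  · refine Continuous.locallyIntegrable ?_
    exact VectorFourier.fourierIntegral_continuous Real.continuous_fourierChar
      continuous_inner h1
  intro g hg hc
  have hgc : ContDiff ℝ ((⊤ : ℕ∞) : WithTop ℕ∞) (fun x => (g x : ℂ)) :=
    Complex.ofRealCLM.contDiff.comp hg
  have hcc : HasCompactSupport (fun x => (g x : ℂ)) := hc.comp_left (g := Complex.ofReal) (by simp)
  let φ : 𝓢(V, ℂ) := hcc.toSchwartzMap hgc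
  have hφ : ∀ x, φ x = (g x : ℂ) := fun x => rfl
  have e1 : ((𝓕 (h2.toLp f) : Lp (α := V) ℂ 2 volume) : 𝓢'(V, ℂ)) φ =
      ((h2.toLp f : Lp (α := V) ℂ 2 volume) : 𝓢'(V, ℂ)) (𝓕 φ) := by
    rw [← Lp.fourier_toTemperedDistribution_eq, TemperedDistribution.fourier_apply]
  rw [Lp.toTemperedDistribution_apply, Lp.toTemperedDistribution_apply] at e1
  have e2 : ∫ x, (𝓕 φ) x • (h2.toLp f) x = ∫ x, (𝓕 (φ : V → ℂ)) x • f x := by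
    apply integral_congr_ae
    filter_upwards [h2.coeFn_toLp] with x hx
    rw [hx, SchwartzMap.fourier_coe]
  have e3 : ∫ x, (𝓕 (φ : V → ℂ)) x • f x = ∫ x, φ x • (𝓕 f) x := by
    have := VectorFourier.integral_fourierIntegral_smul_eq_flip (μ := (volume : Measure V))
      (ν := (volume : Measure V)) (L := innerₗ V) (f := φ) (g := f)
      Real.continuous_fourierChar continuous_inner φ.integrable h1
    rw [flip_innerₗ] at this
    exact this
  rw [e2, e3] at e1
  simpa [hφ] using e1

theorem lintegral_enorm_sq_fourier {f : V → ℂ} (h1 : Integrable f) (h2 : MemLp f 2) :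
    ∫⁻ ξ, ‖𝓕 f ξ‖ₑ ^ 2 = ∫⁻ x, ‖f x‖ₑ ^ 2 := by
  have h := Lp.norm_fourier_eq (h2.toLp f)
  have h' : eLpNorm (𝓕 (h2.toLp f) : Lp (α := V) ℂ 2 volume) 2 volume = eLpNorm f 2 volume := by
    rw [← eLpNorm_congr_ae h2.coeFn_toLp]
    rw [Lp.norm_def, Lp.norm_def] at h
    exact (ENNReal.toReal_eq_toReal_iff' (Lp.eLpNorm_ne_top _) (Lp.eLpNorm_ne_top _)).1 h
  rw [eLpNorm_congr_ae (fourier_toLp_ae_eq h1 h2)] at h'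
  have key : ∀ g : V → ℂ, ∫⁻ x, ‖g x‖ₑ ^ 2 = eLpNorm g 2 volume ^ 2 := by
    intro g
    have := eLpNorm_nnreal_pow_eq_lintegral (f := g) (μ := (volume : Measure V)) (p := 2)
      (by norm_num)
    simp only [NNReal.coe_ofNat, ENNReal.coe_ofNat, ENNReal.rpow_ofNat] at this
    exact this.symm
  rw [key, key, h']

/-- The energy density `|f̂|²` of `f`. -/
def energy (f : V → ℝ) (ξ : V) : ℝ≥0∞ := ‖𝓕 (fun x => (f x : ℂ)) ξ‖ₑ ^ 2

theorem measurable_energy {f : V → ℝ} (hf : Integrable f) : Measurable (energy f) := by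
  have : Continuous (𝓕 (fun x => (f x : ℂ))) :=
    VectorFourier.fourierIntegral_continuous Real.continuous_fourierChar
      continuous_inner hf.ofReal
  unfold energy
  fun_prop

theorem integrable_fwdDiff_iterate {f : V → ℝ} (hf : Integrable f) (u : V) (r : ℕ) :
    Integrable ((fwdDiff u)^[r] f) := by
  induction r generalizing f with
  | zero => exact hf
  | succ r ih =>
    rw [Function.iterate_succ_apply]
    exact ih ((hf.comp_add_right u).sub hf)

theorem memLp_fwdDiff_iterate {f : V → ℝ} {p : ℝ≥0∞} (hf : MemLp f p) (u : V) (r : ℕ) :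
    MemLp ((fwdDiff u)^[r] f) p := by
  induction r generalizing f with
  | zero => exact hf
  | succ r ih =>
    rw [Function.iterate_succ_apply]
    exact ih ((hf.comp_measurePreserving (measurePreserving_add_right volume u)).sub hf)

/-- Translation by `u` multiplies the transform by a phase `e^{iφ}`, and `|e^{iφ} - 1|² = 2 - 2 cos
φ`. -/
theorem energy_fwdDiff {f : V → ℝ} (hf : Integrable f) (u ξ : V) :
    energy (fwdDiff u f) ξ =
      ENNReal.ofReal (2 - 2 * Real.cos (2 * Real.pi * inner ℝ u ξ)) * energy f ξ := by
  have e1 : 𝓕 (fun x => ((fwdDiff u f x : ℝ) : ℂ)) ξ =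
      (Complex.exp ((2 * Real.pi * inner ℝ u ξ : ℝ) * Complex.I) - 1) *
        𝓕 (fun x => (f x : ℂ)) ξ := by
    have h1 : (fun x => ((fwdDiff u f x : ℝ) : ℂ)) =
        (fun x => (f (x + u) : ℂ)) - fun x => (f x : ℂ) := by
      ext x; simp [fwdDiff]
    have hi : Integrable (fun x => (f (x + u) : ℂ)) := (hf.comp_add_right u).ofReal
    have h2 : 𝓕 (fun x => (f (x + u) : ℂ)) ξ =
        Complex.exp ((2 * Real.pi * inner ℝ u ξ : ℝ) * Complex.I) * 𝓕 (fun x => (f x : ℂ)) ξ := by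
      have := congrFun (VectorFourier.fourierIntegral_comp_add_right Real.fourierChar
        (volume : Measure V) (innerₗ V) (fun x => (f x : ℂ)) u) ξ
      simp only [Function.comp_def] at this
      refine (show 𝓕 (fun x => (f (x + u) : ℂ)) ξ = _ from this).trans ?_
      rw [Circle.smul_def, Real.fourierChar_apply, smul_eq_mul]
      rfl
    have h3 : 𝓕 ((fun x => (f (x + u) : ℂ)) - fun x => (f x : ℂ)) ξ =
        𝓕 (fun x => (f (x + u) : ℂ)) ξ - 𝓕 (fun x => (f x : ℂ)) ξ := by
      simp only [Real.fourier_eq, Pi.sub_apply, smul_sub]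
      rw [integral_sub]
      · exact (Real.fourierIntegral_convergent_iff ξ).2 hi
      · exact (Real.fourierIntegral_convergent_iff ξ).2 hf.ofReal
    rw [h1, h3, h2]; ring
  have e2 : ∀ t : ℝ, ‖Complex.exp (t * Complex.I) - 1‖ ^ 2 = 2 - 2 * Real.cos t := by
    intro t
    rw [← Complex.normSq_eq_norm_sq, Complex.normSq_apply]
    simp only [Complex.sub_re, Complex.exp_ofReal_mul_I_re, Complex.one_re, Complex.sub_im,
      Complex.exp_ofReal_mul_I_im, Complex.one_im, sub_zero]
    nlinarith [Real.sin_sq_add_cos_sq t]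
  unfold energy
  rw [e1, enorm_mul, mul_pow, ← ofReal_norm, ← ENNReal.ofReal_pow (norm_nonneg _), e2]

theorem energy_fwdDiff_iterate {f : V → ℝ} (hf : Integrable f) (u ξ : V) (r : ℕ) :
    energy ((fwdDiff u)^[r] f) ξ =
      ENNReal.ofReal ((2 - 2 * Real.cos (2 * Real.pi * inner ℝ u ξ)) ^ r) * energy f ξ := by
  have h0 : 0 ≤ 2 - 2 * Real.cos (2 * Real.pi * inner ℝ u ξ) := by
    linarith [Real.cos_le_one (2 * Real.pi * inner ℝ u ξ)]
  induction r with
  | zero => simp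
  | succ r ih =>
    rw [Function.iterate_succ_apply', energy_fwdDiff (integrable_fwdDiff_iterate hf u r), ih,
      ← mul_assoc, ← ENNReal.ofReal_mul h0, pow_succ']

theorem lintegral_energy {f : V → ℝ} (h1 : Integrable f) (h2 : MemLp f 2) :
    ∫⁻ ξ, energy f ξ = ∫⁻ x, ‖f x‖ₑ ^ 2 := by
  unfold energy
  rw [lintegral_enorm_sq_fourier (f := fun x => (f x : ℂ)) h1.ofReal h2.ofReal]
  simp [← ofReal_norm]

theorem lintegral_fwdDiff_iterate_sq {f : V → ℝ} (h1 : Integrable f) (h2 : MemLp f 2) (u : V)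
    (r : ℕ) :
    ∫⁻ x, ‖((fwdDiff u)^[r] f) x‖ₑ ^ 2 =
      ∫⁻ ξ, ENNReal.ofReal ((2 - 2 * Real.cos (2 * Real.pi * inner ℝ u ξ)) ^ r) * energy f ξ := by
  rw [← lintegral_energy (integrable_fwdDiff_iterate h1 u r) (memLp_fwdDiff_iterate h2 u r)]
  simp_rw [energy_fwdDiff_iterate h1]

end Plancherel

end AvgDensity

end

noncomputable section

namespace AvgDensity

/-! ### The spectral measure and its directional moments -/

section Spectral

variable {V : Type*} [NormedAddCommGroup V] [InnerProductSpace ℝ V] [FiniteDimensional ℝ V]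
  [MeasurableSpace V] [BorelSpace V]

/-- The measure with density `|f̂|²`. -/
def spec (f : V → ℝ) : Measure V := volume.withDensity (energy f)

theorem lintegral_enorm_sq_lt_top {α : Type*} [MeasurableSpace α] {μ : Measure α} {f : α → ℝ}
    (h2 : MemLp f 2 μ) : ∫⁻ x, ‖f x‖ₑ ^ 2 ∂μ < ∞ := by
  have := eLpNorm_nnreal_pow_eq_lintegral (f := f) (μ := μ) (p := 2) (by norm_num)
  simp only [NNReal.coe_ofNat, ENNReal.coe_ofNat, ENNReal.rpow_ofNat] at this
  rw [← this]
  exact ENNReal.pow_lt_top h2.eLpNorm_lt_top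

theorem isFiniteMeasure_spec {f : V → ℝ} (h1 : Integrable f) (h2 : MemLp f 2) :
    IsFiniteMeasure (spec f) := by
  refine isFiniteMeasure_withDensity ?_
  rw [lintegral_energy h1 h2]
  exact (lintegral_enorm_sq_lt_top h2).ne

/-- The form in which the Besov condition is used: the `L²` size of an `r`-th difference becomes an
oscillation moment of the finite measure `spec f`. -/
theorem lintegral_spec {f : V → ℝ} (h1 : Integrable f) (h2 : MemLp f 2) (u : V) (r : ℕ) :
    ∫⁻ ξ, ENNReal.ofReal ((2 - 2 * Real.cos (2 * Real.pi * inner ℝ u ξ)) ^ r) ∂(spec f) =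
      ∫⁻ x, ‖((fwdDiff u)^[r] f) x‖ₑ ^ 2 := by
  rw [lintegral_fwdDiff_iterate_sq h1 h2, spec,
    lintegral_withDensity_eq_lintegral_mul _ (measurable_energy h1) (by fun_prop)]
  refine lintegral_congr fun ξ => ?_
  rw [Pi.mul_apply, mul_comm]

theorem integral_sq_translate_sub {f : V → ℝ} (h1 : Integrable f) (h2 : MemLp f 2) (u : V) :
    ∫ x, (f (x + u) - f x) ^ 2 =
      ∫ ξ, (2 - 2 * Real.cos (2 * Real.pi * inner ℝ u ξ)) ∂(spec f) := by
  have h := lintegral_spec h1 h2 u 1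
  have hm : AEStronglyMeasurable (fun x => f (x + u)) volume :=
    (h1.comp_add_right u).aestronglyMeasurable
  rw [integral_eq_lintegral_of_nonneg_ae, integral_eq_lintegral_of_nonneg_ae]
  · congr 1
    simp only [pow_one, Function.iterate_one] at h
    rw [h]
    refine lintegral_congr fun x => ?_
    rw [← ofReal_norm, ← ENNReal.ofReal_pow (norm_nonneg _), Real.norm_eq_abs, sq_abs]
    rfl
  · exact ae_of_all _ fun ξ => by
      have := Real.cos_le_one (2 * Real.pi * inner ℝ u ξ)
      simp only [Pi.zero_apply]; linarith
  · fun_prop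
  · exact ae_of_all _ fun ξ => by positivity
  · exact (hm.sub h1.aestronglyMeasurable).pow 2

/-- A monotone function of `|τ|` is dominated by a dyadic sum of oscillation moments of `τ`. -/
theorem lintegral_le_tsum_oscillation {Ξ : Type*} [MeasurableSpace Ξ] (m : Measure Ξ) (τ : Ξ → ℝ)
    (hτ : Measurable τ) (r : ℕ) (ω : ℝ → ℝ) (h0 : ω 0 = 0) (hω : MonotoneOn ω (Set.Ici 0)) :
    ∫⁻ ξ, ENNReal.ofReal (ω |τ ξ|) ∂m ≤ ENNReal.ofReal (((2 - 2 * Real.cos 1) ^ r)⁻¹) *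
      ∑' j : ℤ, ENNReal.ofReal (ω (2 ^ (1 - j))) *
        ∫⁻ ξ, ENNReal.ofReal ((2 - 2 * Real.cos (2 ^ j * τ ξ)) ^ r) ∂m := by
  have hc1 : 0 < 2 - 2 * Real.cos 1 := by linarith [Real.cos_one_le]
  have hc : 0 < (2 - 2 * Real.cos 1) ^ r := pow_pos hc1 r
  have hω0 : ∀ t, 0 ≤ t → 0 ≤ ω t := fun t ht => by
    rw [← h0]; exact hω (Set.mem_Ici.2 le_rfl) (Set.mem_Ici.2 ht) ht
  have hmeas : ∀ j : ℤ, Measurable fun ξ =>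
      ENNReal.ofReal ((2 - 2 * Real.cos (2 ^ j * τ ξ)) ^ r) := fun j => by fun_prop
  simp_rw [← fun j => lintegral_const_mul (μ := m) (ENNReal.ofReal (ω (2 ^ (1 - j)))) (hmeas j)]
  rw [← lintegral_tsum fun j => ((hmeas j).const_mul _).aemeasurable,
    ← lintegral_const_mul _ (Measurable.tsum fun j => (hmeas j).const_mul _)]
  refine lintegral_mono fun ξ => ?_
  rcases eq_or_ne (τ ξ) 0 with h | h
  · simp [h, h0]
  -- One term of the sum is enough. With `j = -i` the rescaled value `2^j |τ|` lies in `[1, 2] ⊆ [0,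
  -- π]`, where the cosine is at most `cos 1`.
  obtain ⟨i, hi1, hi2⟩ := exists_mem_Ico_zpow (x := |τ ξ|) (y := (2 : ℝ)) (abs_pos.2 h)
    one_lt_two
  have hterm : ENNReal.ofReal (ω |τ ξ|) ≤ ENNReal.ofReal (((2 - 2 * Real.cos 1) ^ r)⁻¹) *
      (ENNReal.ofReal (ω (2 ^ (1 - (-i)))) *
        ENNReal.ofReal ((2 - 2 * Real.cos (2 ^ (-i) * τ ξ)) ^ r)) := by
    rw [← ENNReal.ofReal_mul (hω0 _ (by positivity)), ← ENNReal.ofReal_mul (by positivity)]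
    refine ENNReal.ofReal_le_ofReal ?_
    have h1 : ω |τ ξ| ≤ ω (2 ^ (1 - (-i))) := by
      refine hω (Set.mem_Ici.2 (abs_nonneg _)) (Set.mem_Ici.2 (by positivity)) ?_
      rw [sub_neg_eq_add, add_comm]; exact hi2.le
    have h2 : (2 - 2 * Real.cos 1) ^ r ≤ (2 - 2 * Real.cos (2 ^ (-i) * τ ξ)) ^ r := by
      refine pow_le_pow_left₀ hc1.le ?_ r
      have e : Real.cos (2 ^ (-i) * τ ξ) = Real.cos (2 ^ (-i) * |τ ξ|) := by
        rcases abs_choice (τ ξ) with e | e <;> rw [e]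
        rw [mul_neg, Real.cos_neg]
      rw [e]
      have hp : (0 : ℝ) < 2 ^ i := by positivity
      have l1 : 1 ≤ (2 : ℝ) ^ (-i) * |τ ξ| := by
        rw [zpow_neg, inv_mul_eq_div, le_div_iff₀ hp, one_mul]; exact hi1
      have l2 : (2 : ℝ) ^ (-i) * |τ ξ| ≤ 2 := by
        rw [zpow_neg, inv_mul_eq_div, div_le_iff₀ hp]
        rw [zpow_add_one₀ two_ne_zero] at hi2
        linarith
      have := Real.cos_le_cos_of_nonneg_of_le_pi zero_le_one
        (l2.trans Real.two_le_pi) l1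
      linarith
    calc ω |τ ξ| = ((2 - 2 * Real.cos 1) ^ r)⁻¹ * (ω |τ ξ| * (2 - 2 * Real.cos 1) ^ r) := by
          rw [mul_comm (ω _), ← mul_assoc, inv_mul_cancel₀ hc.ne', one_mul]
      _ ≤ _ := by
          refine mul_le_mul_of_nonneg_left ?_ (by positivity)
          exact mul_le_mul h1 h2 hc.le (hω0 _ (by positivity))
  refine hterm.trans ?_
  gcongr
  exact ENNReal.le_tsum (f := fun j : ℤ => ENNReal.ofReal (ω (2 ^ (1 - j))) *
    ENNReal.ofReal ((2 - 2 * Real.cos (2 ^ j * τ ξ)) ^ r)) (-i)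

end Spectral

/-! ### Taylor expansion of the cosine -/

/-- The Taylor polynomial of degree `2 m` of the cosine. -/
def cosTaylor (m : ℕ) (t : ℝ) : ℝ :=
  ∑ k ∈ Finset.range (m + 1), (-1) ^ k * t ^ (2 * k) / (2 * k).factorial

/-- The partial sum has `2 m + 2` terms although the polynomial has degree `2 m`: the last term is
imaginary. The exponential remainder thus gives an error of order `2 m + 2`. -/
theorem cosTaylor_eq_re (m : ℕ) (t : ℝ) :
    cosTaylor m t = (∑ k ∈ Finset.range (2 * m + 2), (t * Complex.I) ^ k / k.factorial).re := by
  induction m with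
  | zero => simp [cosTaylor, Finset.sum_range_succ]
  | succ m ih =>
    rw [cosTaylor, Finset.sum_range_succ, ← cosTaylor, ih, show 2 * (m + 1) + 2 =
      (2 * m + 2) + 1 + 1 by ring, Finset.sum_range_succ _ (2 * m + 2 + 1),
      Finset.sum_range_succ _ (2 * m + 2), Complex.add_re, Complex.add_re]
    have e1 : (((t : ℂ) * Complex.I) ^ (2 * m + 2) / ((2 * m + 2).factorial : ℂ)).re =
        (-1) ^ (m + 1) * t ^ (2 * (m + 1)) / (2 * (m + 1)).factorial := by
      rw [show 2 * m + 2 = 2 * (m + 1) by ring, mul_pow, pow_mul Complex.I, Complex.I_sq]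
      rw [show (t : ℂ) ^ (2 * (m + 1)) * (-1) ^ (m + 1) / ((2 * (m + 1)).factorial : ℂ) =
        ((t ^ (2 * (m + 1)) * (-1) ^ (m + 1) / ((2 * (m + 1)).factorial : ℝ) : ℝ) : ℂ) by
          push_cast; rfl, Complex.ofReal_re]
      ring
    have e2 : (((t : ℂ) * Complex.I) ^ (2 * m + 2 + 1) / ((2 * m + 2 + 1).factorial : ℂ)).re =
        0 := by
      rw [pow_succ, show 2 * m + 2 = 2 * (m + 1) by ring, mul_pow, pow_mul Complex.I, Complex.I_sq]
      rw [show (t : ℂ) ^ (2 * (m + 1)) * (-1) ^ (m + 1) * (t * Complex.I) /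
        ((2 * (m + 1) + 1).factorial : ℂ) = ((t ^ (2 * (m + 1)) * (-1) ^ (m + 1) * t /
          ((2 * (m + 1) + 1).factorial : ℝ) : ℝ) : ℂ) * Complex.I by
          push_cast; ring, Complex.re_ofReal_mul, Complex.I_re, mul_zero]
    rw [e1, e2, add_zero]

/-- For `|t| ≤ 1` this is the exponential remainder; for `|t| ≥ 1` each of the `m + 1` terms of the
polynomial is at most `|t|^(2m)`. The minimum is what makes the dyadic sums below converge at both
ends. -/
theorem abs_cos_sub_cosTaylor_le (m : ℕ) (t : ℝ) :
    |Real.cos t - cosTaylor m t| ≤ (m + 5) * min (|t| ^ (2 * m)) (|t| ^ (2 * m + 2)) := by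
  rcases le_total |t| 1 with h | h
  · rw [min_eq_right (pow_le_pow_of_le_one (abs_nonneg _) h (by omega))]
    have hb := Complex.exp_bound (x := t * Complex.I) (by simpa using h) (n := 2 * m + 2)
      (by omega)
    have e : Real.cos t - cosTaylor m t = (Complex.exp (t * Complex.I) -
        ∑ k ∈ Finset.range (2 * m + 2), (t * Complex.I) ^ k / k.factorial).re := by
      rw [Complex.sub_re, ← cosTaylor_eq_re, Complex.exp_ofReal_mul_I_re]
    rw [e]
    refine (Complex.abs_re_le_norm _).trans (hb.trans ?_)
    rw [norm_mul, Complex.norm_I, mul_one, Complex.norm_real, Real.norm_eq_abs, mul_comm]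
    refine mul_le_mul_of_nonneg_right ?_ (by positivity)
    have h1 : (1 : ℝ) ≤ (2 * m + 2).factorial := by exact_mod_cast Nat.factorial_pos _
    have h2 : (0 : ℝ) ≤ m := Nat.cast_nonneg m
    rw [← div_eq_mul_inv, div_le_iff₀ (by positivity)]
    push_cast
    have h3 : (2 * (m : ℝ) + 2) ≤ (2 * m + 2).factorial * (2 * m + 2) := by nlinarith
    nlinarith
  · rw [min_eq_left (pow_le_pow_right₀ h (by omega))]
    have h1 : |cosTaylor m t| ≤ (m + 1) * |t| ^ (2 * m) := by
      refine (Finset.abs_sum_le_sum_abs _ _).trans ?_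
      refine (Finset.sum_le_card_nsmul _ _ (|t| ^ (2 * m)) fun k hk => ?_).trans_eq ?_
      · rw [abs_div, abs_mul, abs_pow, abs_neg, abs_one, one_pow, one_mul, abs_pow, Nat.abs_cast]
        have h1 : (1 : ℝ) ≤ (2 * k).factorial := by exact_mod_cast Nat.factorial_pos _
        refine (div_le_self (by positivity) h1).trans (pow_le_pow_right₀ h ?_)
        have := Finset.mem_range.1 hk
        omega
      · simp
    have h2 : (1 : ℝ) ≤ |t| ^ (2 * m) := one_le_pow₀ h
    have h3 := Real.abs_cos_le_one t
    have h4 := abs_sub (Real.cos t) (cosTaylor m t)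
    nlinarith

end AvgDensity

end

noncomputable section

namespace AvgDensity

/-! ### Directional moments of the spectral measure under a Besov bound -/

section Moments

theorem tsum_ofReal_lt_top {a : ℤ → ℝ} (h0 : ∀ j, 0 ≤ a j) (ha : Summable a) :
    ∑' j, ENNReal.ofReal (a j) < ∞ := by
  rw [← ENNReal.ofReal_tsum_of_nonneg h0 ha]
  exact ENNReal.ofReal_lt_top

theorem summable_int_of_geometric {a : ℤ → ℝ} (h0 : ∀ j, 0 ≤ a j) {A B p q : ℝ} (hp : p < 0)
    (hq : 0 < q) (h1 : ∀ j, a j ≤ A * 2 ^ (p * j)) (h2 : ∀ j, a j ≤ B * 2 ^ (q * j)) :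
    Summable a := by
  have key : ∀ e : ℝ, e < 0 → Summable fun n : ℕ => (2 : ℝ) ^ (e * n) := by
    intro e he
    have : ∀ n : ℕ, (2 : ℝ) ^ (e * n) = ((2 : ℝ) ^ e) ^ n := fun n => by
      rw [Real.rpow_mul two_pos.le, Real.rpow_natCast]
    simp_rw [this]
    exact summable_geometric_of_lt_one (by positivity) (Real.rpow_lt_one_of_one_lt_of_neg
      one_lt_two he)
  refine Summable.of_nat_of_neg ?_ ?_
  · refine Summable.of_nonneg_of_le (fun n => h0 _) (fun n => h1 _) ?_
    simpa using (key p hp).mul_left A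
  · refine Summable.of_nonneg_of_le (fun n => h0 _) (fun n => h2 _) ?_
    have := (key (-q) (by linarith)).mul_left B
    simpa using this

theorem two_zpow_eq_rpow (j : ℤ) : (2 : ℝ) ^ j = (2 : ℝ) ^ (j : ℝ) := (Real.rpow_intCast 2 j).symm

theorem two_zpow_rpow (j : ℤ) (p : ℝ) : ((2 : ℝ) ^ j) ^ p = (2 : ℝ) ^ (p * j) := by
  rw [two_zpow_eq_rpow, ← Real.rpow_mul two_pos.le, mul_comm]

theorem two_zpow_one_sub_rpow (j : ℤ) (p : ℝ) :
    ((2 : ℝ) ^ (1 - j)) ^ p = 2 ^ p * (2 : ℝ) ^ (-p * j) := by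
  rw [two_zpow_rpow, ← Real.rpow_add two_pos]
  congr 1; push_cast; ring

theorem oscillation_smul_eq {V : Type*} [NormedAddCommGroup V] [InnerProductSpace ℝ V] (a : ℝ)
    (u ξ : V) :
    2 * Real.pi * inner ℝ (a • u) ξ = a * (2 * Real.pi * inner ℝ u ξ) := by
  rw [real_inner_smul_left]; ring

variable {V : Type*} [NormedAddCommGroup V] [InnerProductSpace ℝ V] [FiniteDimensional ℝ V]
  [MeasurableSpace V] [BorelSpace V]

/-- The dyadic terms are `ω(2^(1-j)) 2^(2sj)`, up to constants. The two branches of the minimum give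
the exponents `2s - (2k+2) < 0` and `2s - 2k > 0`, hence geometric decay as `j → ∞` and as `j → -∞`.
-/
theorem lintegral_min_pow_le (m : Measure V) (r : ℕ) {s : ℝ} {C : ℝ≥0}
    (hC : ∀ u : V, ∫⁻ ξ, ENNReal.ofReal ((2 - 2 * Real.cos (2 * Real.pi * inner ℝ u ξ)) ^ r) ∂m ≤
      C * ENNReal.ofReal (‖u‖ ^ (2 * s))) (k : ℕ) (hk1 : (2 * k : ℝ) < 2 * s)
    (hk2 : 2 * s < 2 * k + 2) :
    ∃ C' : ℝ≥0, ∀ u : V, ∫⁻ ξ, ENNReal.ofReal (min (|2 * Real.pi * inner ℝ u ξ| ^ (2 * k))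
      (|2 * Real.pi * inner ℝ u ξ| ^ (2 * k + 2))) ∂m ≤ C' * ENNReal.ofReal (‖u‖ ^ (2 * s)) := by
  set ω : ℝ → ℝ := fun t => min (t ^ (2 * k)) (t ^ (2 * k + 2)) with hω
  set a : ℤ → ℝ := fun j => ω (2 ^ (1 - j)) * (2 ^ j) ^ (2 * s) with ha
  have ha0 : ∀ j, 0 ≤ a j := fun j => by
    simp only [ha, hω]; positivity
  have hsum : Summable a := by
    refine summable_int_of_geometric ha0 (A := 2 ^ (2 * k + 2 : ℝ)) (B := 2 ^ (2 * k : ℝ))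
      (p := 2 * s - (2 * k + 2)) (q := 2 * s - 2 * k) (by linarith) (by linarith) ?_ ?_
    · intro j
      calc a j ≤ (2 ^ (1 - j)) ^ (2 * k + 2) * (2 ^ j) ^ (2 * s) :=
            mul_le_mul_of_nonneg_right (min_le_right _ _) (by positivity)
        _ = _ := by
            have := two_zpow_one_sub_rpow j (2 * k + 2)
            rw [show (2 * (k : ℝ) + 2) = ((2 * k + 2 : ℕ) : ℝ) by push_cast; ring,
              Real.rpow_natCast] at this
            rw [this, two_zpow_rpow, mul_assoc, ← Real.rpow_add two_pos]
            push_cast; ring_nf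
    · intro j
      calc a j ≤ (2 ^ (1 - j)) ^ (2 * k) * (2 ^ j) ^ (2 * s) :=
            mul_le_mul_of_nonneg_right (min_le_left _ _) (by positivity)
        _ = _ := by
            have := two_zpow_one_sub_rpow j (2 * k)
            rw [show (2 * (k : ℝ)) = ((2 * k : ℕ) : ℝ) by push_cast; ring,
              Real.rpow_natCast] at this
            rw [this, two_zpow_rpow, mul_assoc, ← Real.rpow_add two_pos]
            push_cast; ring_nf
  set A := ENNReal.ofReal (((2 - 2 * Real.cos 1) ^ r)⁻¹) * (C * ∑' j, ENNReal.ofReal (a j)) with hA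
  have hAtop : A ≠ ∞ := ENNReal.mul_ne_top ENNReal.ofReal_ne_top
    (ENNReal.mul_ne_top ENNReal.coe_ne_top (tsum_ofReal_lt_top ha0 hsum).ne)
  refine ⟨A.toNNReal, fun u => ?_⟩
  rw [ENNReal.coe_toNNReal hAtop]
  refine (lintegral_le_tsum_oscillation m (fun ξ => 2 * Real.pi * inner ℝ u ξ) (by fun_prop) r ω
    ?_ ?_).trans ?_
  · simp [hω]
  · intro x hx y hy hxy
    have hx' : (0 : ℝ) ≤ x := hx
    exact min_le_min (pow_le_pow_left₀ hx' hxy _) (pow_le_pow_left₀ hx' hxy _)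
  · rw [hA, mul_assoc]
    gcongr
    rw [mul_assoc, ← ENNReal.tsum_mul_right, ← ENNReal.tsum_mul_left]
    refine ENNReal.tsum_le_tsum fun j => ?_
    have h1 := hC ((2 : ℝ) ^ j • u)
    simp_rw [oscillation_smul_eq] at h1
    have hj : (0 : ℝ) < 2 ^ j := by positivity
    rw [norm_smul, Real.norm_eq_abs, abs_of_pos hj, Real.mul_rpow hj.le (norm_nonneg _)] at h1
    calc ENNReal.ofReal (ω (2 ^ (1 - j))) *
          ∫⁻ ξ, ENNReal.ofReal ((2 - 2 * Real.cos (2 ^ j * (2 * Real.pi * inner ℝ u ξ))) ^ r) ∂m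
        ≤ ENNReal.ofReal (ω (2 ^ (1 - j))) *
          (C * ENNReal.ofReal ((2 ^ j) ^ (2 * s) * ‖u‖ ^ (2 * s))) := by gcongr
      _ = _ := by
        rw [ENNReal.ofReal_mul (by positivity), ha, ENNReal.ofReal_mul (by simp only [hω]; positivity)]
        ring

/-- Below the exponent `2s` a genuine moment exists. By homogeneity `u` may be taken of norm one.
For large `j` the oscillation moment is bounded by the total mass times `4 ^ r`, against `2^(-Pj)`;
for `j → -∞` the hypothesis leaves `2^((2s-P)j)`. -/
theorem lintegral_rpow_le (m : Measure V) [IsFiniteMeasure m] (r : ℕ) {s P : ℝ} {C : ℝ≥0}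
    (hC : ∀ u : V, ∫⁻ ξ, ENNReal.ofReal ((2 - 2 * Real.cos (2 * Real.pi * inner ℝ u ξ)) ^ r) ∂m ≤
      C * ENNReal.ofReal (‖u‖ ^ (2 * s))) (hP0 : 0 < P) (hP : P < 2 * s) :
    ∃ C' : ℝ≥0, ∀ u : V, ∫⁻ ξ, ENNReal.ofReal (|2 * Real.pi * inner ℝ u ξ| ^ P) ∂m ≤
      C' * ENNReal.ofReal (‖u‖ ^ P) := by
  set M : ℝ := 4 ^ r * m.real Set.univ with hM
  have hM0 : 0 ≤ M := by positivity
  set a : ℤ → ℝ := fun j => (2 ^ (1 - j)) ^ P * min M (C * (2 ^ j) ^ (2 * s)) with ha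
  have ha0 : ∀ j, 0 ≤ a j := fun j => by
    simp only [ha]; positivity
  have hsum : Summable a := by
    refine summable_int_of_geometric ha0 (A := 2 ^ P * M) (B := 2 ^ P * C)
      (p := -P) (q := 2 * s - P) (by linarith) (by linarith) ?_ ?_
    · intro j
      calc a j ≤ (2 ^ (1 - j)) ^ P * M :=
            mul_le_mul_of_nonneg_left (min_le_left _ _) (by positivity)
        _ = _ := by rw [two_zpow_one_sub_rpow]; ring
    · intro j
      calc a j ≤ (2 ^ (1 - j)) ^ P * (C * (2 ^ j) ^ (2 * s)) :=
            mul_le_mul_of_nonneg_left (min_le_right _ _) (by positivity)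
        _ = 2 ^ P * C * (2 ^ (-P * j) * 2 ^ (2 * s * j)) := by
            rw [two_zpow_one_sub_rpow, two_zpow_rpow]; ring
        _ = _ := by
            rw [← Real.rpow_add two_pos]
            ring_nf
  set A := ENNReal.ofReal (((2 - 2 * Real.cos 1) ^ r)⁻¹) * (∑' j, ENNReal.ofReal (a j)) with hA
  have hAtop : A ≠ ∞ := ENNReal.mul_ne_top ENNReal.ofReal_ne_top
    (tsum_ofReal_lt_top ha0 hsum).ne
  have hunit : ∀ e : V, ‖e‖ = 1 →
      ∫⁻ ξ, ENNReal.ofReal (|2 * Real.pi * inner ℝ e ξ| ^ P) ∂m ≤ A := by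
    intro e he
    refine (lintegral_le_tsum_oscillation m (fun ξ => 2 * Real.pi * inner ℝ e ξ) (by fun_prop) r
      (fun t => t ^ P) (Real.zero_rpow hP0.ne') ?_).trans ?_
    · intro x hx y hy hxy
      exact Real.rpow_le_rpow hx hxy hP0.le
    · rw [hA]
      gcongr with j
      have h1 := hC ((2 : ℝ) ^ j • e)
      simp_rw [oscillation_smul_eq] at h1
      have hj : (0 : ℝ) < 2 ^ j := by positivity
      rw [norm_smul, Real.norm_eq_abs, abs_of_pos hj, he, mul_one] at h1
      have h2 : ∫⁻ ξ, ENNReal.ofReal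
          ((2 - 2 * Real.cos (2 ^ j * (2 * Real.pi * inner ℝ e ξ))) ^ r) ∂m ≤ ENNReal.ofReal M := by
        calc _ ≤ ∫⁻ ξ, ENNReal.ofReal (4 ^ r) ∂m := by
              refine lintegral_mono fun ξ => ENNReal.ofReal_le_ofReal ?_
              refine pow_le_pow_left₀ ?_ ?_ r
              · linarith [Real.cos_le_one (2 ^ j * (2 * Real.pi * inner ℝ e ξ))]
              · linarith [Real.neg_one_le_cos (2 ^ j * (2 * Real.pi * inner ℝ e ξ))]
          _ = _ := by
              rw [lintegral_const, hM, ENNReal.ofReal_mul (by positivity), Measure.real,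
                ENNReal.ofReal_toReal (measure_ne_top _ _)]
      have h3 : ∫⁻ ξ, ENNReal.ofReal
          ((2 - 2 * Real.cos (2 ^ j * (2 * Real.pi * inner ℝ e ξ))) ^ r) ∂m ≤
          ENNReal.ofReal (min M (C * (2 ^ j) ^ (2 * s))) := by
        rw [ENNReal.ofReal_min]
        refine le_min h2 (h1.trans_eq ?_)
        rw [ENNReal.ofReal_mul (NNReal.coe_nonneg C), ENNReal.ofReal_coe_nnreal]
      rw [ha, ENNReal.ofReal_mul (by positivity)]
      gcongr
  refine ⟨A.toNNReal, fun u => ?_⟩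
  rw [ENNReal.coe_toNNReal hAtop]
  rcases eq_or_ne u 0 with rfl | hu
  · simp [Real.zero_rpow hP0.ne']
  have hu' : 0 < ‖u‖ := norm_pos_iff.2 hu
  have hue : u = ‖u‖ • (‖u‖⁻¹ • u) := by rw [smul_smul, mul_inv_cancel₀ hu'.ne', one_smul]
  have h1 := hunit (‖u‖⁻¹ • u) (by rw [norm_smul, norm_inv, norm_norm, inv_mul_cancel₀ hu'.ne'])
  calc _ = ∫⁻ ξ, ENNReal.ofReal (‖u‖ ^ P) *
        ENNReal.ofReal (|2 * Real.pi * inner ℝ (‖u‖⁻¹ • u) ξ| ^ P) ∂m := by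
        refine lintegral_congr fun ξ => ?_
        rw [← ENNReal.ofReal_mul (by positivity)]
        congr 1
        conv_lhs => rw [hue, oscillation_smul_eq, abs_mul, abs_of_pos hu',
          Real.mul_rpow hu'.le (abs_nonneg _)]
    _ = ENNReal.ofReal (‖u‖ ^ P) *
        ∫⁻ ξ, ENNReal.ofReal (|2 * Real.pi * inner ℝ (‖u‖⁻¹ • u) ξ| ^ P) ∂m := by
        rw [lintegral_const_mul]
        fun_prop
    _ ≤ _ := by rw [mul_comm]; gcongr

theorem min_pow_le_rpow {t P : ℝ} (ht : 0 ≤ t) {k : ℕ} (h1 : (2 * k : ℝ) < P)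
    (h2 : P ≤ 2 * k + 2) : min (t ^ (2 * k)) (t ^ (2 * k + 2)) ≤ t ^ P := by
  have hP : 0 < P := lt_of_le_of_lt (by positivity) h1
  rcases le_total t 1 with h | h
  · refine (min_le_right _ _).trans ?_
    rw [← Real.rpow_natCast]
    exact Real.rpow_le_rpow_of_exponent_ge' ht h hP.le (by push_cast; exact h2)
  · refine (min_le_left _ _).trans ?_
    rw [← Real.rpow_natCast]
    exact Real.rpow_le_rpow_of_exponent_le h (by push_cast; exact h1.le)

/-- The degree `2k` must stay below `P`, so that the kernel annihilates the polynomial, and the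
remainder must be integrable at rate `min P (2s)`. If `P < 2s`, the choice `k = ⌈P/2⌉ - 1` lets the
remainder be dominated by `|t|^P`. Otherwise `k = ⌊s⌋`, where `2s` not being an integer gives `2k <
2s` strictly. -/
theorem exists_taylor_order (m : Measure V) [IsFiniteMeasure m] (r : ℕ) {s P : ℝ} {C : ℝ≥0}
    (hC : ∀ u : V, ∫⁻ ξ, ENNReal.ofReal ((2 - 2 * Real.cos (2 * Real.pi * inner ℝ u ξ)) ^ r) ∂m ≤
      C * ENNReal.ofReal (‖u‖ ^ (2 * s))) (hs : 0 < s) (hs2 : ∀ k : ℕ, 2 * s ≠ k) (hP0 : 0 < P) :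
    ∃ k : ℕ, (2 * k : ℝ) < P ∧ ∃ C' : ℝ≥0, ∀ u : V,
      ∫⁻ ξ, ENNReal.ofReal (min (|2 * Real.pi * inner ℝ u ξ| ^ (2 * k))
        (|2 * Real.pi * inner ℝ u ξ| ^ (2 * k + 2))) ∂m ≤
          C' * ENNReal.ofReal (‖u‖ ^ (min P (2 * s))) := by
  rcases lt_or_ge P (2 * s) with h | h
  · obtain ⟨C', hC'⟩ := lintegral_rpow_le m r hC hP0 h
    have h1 : 0 < ⌈P / 2⌉₊ := Nat.ceil_pos.2 (by linarith)
    have h2 := Nat.le_ceil (P / 2)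
    have h3 := Nat.ceil_lt_add_one (a := P / 2) (by linarith)
    have h4 : ((⌈P / 2⌉₊ - 1 : ℕ) : ℝ) = (⌈P / 2⌉₊ : ℝ) - 1 := by
      rw [Nat.cast_sub h1, Nat.cast_one]
    refine ⟨⌈P / 2⌉₊ - 1, by rw [h4]; linarith, C', fun u => ?_⟩
    rw [min_eq_left h.le]
    refine le_trans (lintegral_mono fun ξ => ENNReal.ofReal_le_ofReal ?_) (hC' u)
    exact min_pow_le_rpow (abs_nonneg _) (by rw [h4]; linarith) (by rw [h4]; linarith)
  · have h1 : (2 * ⌊s⌋₊ : ℝ) < 2 * s := by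
      refine lt_of_le_of_ne ?_ fun e => hs2 (2 * ⌊s⌋₊) (by push_cast; exact e.symm)
      have := Nat.floor_le hs.le
      linarith
    have h2 : 2 * s < 2 * ⌊s⌋₊ + 2 := by
      have := Nat.lt_floor_add_one s
      linarith
    refine ⟨⌊s⌋₊, by linarith, ?_⟩
    rw [min_eq_right h]
    exact lintegral_min_pow_le m r hC _ h1 h2

theorem lintegral_spec_le_of_besov {d : ℕ} {s : ℝ} {f : E d → ℝ} (h1 : Integrable f)
    (hf : MemBesovTwoInfty s f) :
    ∃ C : ℝ≥0, ∀ u : E d, ∫⁻ ξ, ENNReal.ofReal ((2 - 2 * Real.cos (2 * Real.pi * inner ℝ u ξ)) ^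
      (⌊s⌋₊ + 1)) ∂(spec f) ≤ C * ENNReal.ofReal (‖u‖ ^ (2 * s)) := by
  obtain ⟨h2, C, hC⟩ := hf
  refine ⟨C ^ 2, fun u => ?_⟩
  rw [lintegral_spec h1 h2]
  have := eLpNorm_nnreal_pow_eq_lintegral (f := (fwdDiff u)^[⌊s⌋₊ + 1] f)
    (μ := (volume : Measure (E d))) (p := 2) (by norm_num)
  simp only [NNReal.coe_ofNat, ENNReal.coe_ofNat, ENNReal.rpow_ofNat] at this
  rw [← this, show 2 * s = s * (2 : ℕ) by push_cast; ring, Real.rpow_mul (norm_nonneg _),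
    Real.rpow_natCast, ENNReal.ofReal_pow (by positivity), ENNReal.coe_pow, ← mul_pow]
  gcongr
  exact hC u

end Moments

end AvgDensity

end

noncomputable section

namespace AvgDensity

/-! ### Smoothing bias -/

/-- A bounded even kernel of order `P`. -/
structure EvenKernel {d : ℕ} (P : ℝ) (κ : E d → ℝ) : Prop where
  measurable : Measurable κ
  bounded : ∃ M : ℝ, ∀ u, |κ u| ≤ M
  even : ∀ u, κ (-u) = κ u
  integrable : Integrable κ
  integrable_rpow : Integrable fun v => |κ v| * ‖v‖ ^ P
  integral_one : ∫ v, κ v = 1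
  moment_zero : ∀ k : ℕ, 0 < k → (2 * k : ℝ) < P → ∀ ξ, ∫ v, κ v * inner ℝ v ξ ^ (2 * k) = 0

/-- The squared `L²` distance between `f` and its translate by `u`. -/
def transSq {d : ℕ} (f : E d → ℝ) (u : E d) : ℝ := ∫ x, (f (x + u) - f x) ^ 2

variable {d : ℕ}

theorem transSq_nonneg (f : E d → ℝ) (u : E d) : 0 ≤ transSq f u :=
  integral_nonneg fun _ => sq_nonneg _

theorem rpow_le_one_add_rpow {t p q : ℝ} (ht : 0 ≤ t) (hp : 0 ≤ p) (hpq : p ≤ q) :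
    t ^ p ≤ 1 + t ^ q := by
  rcases le_total t 1 with h | h
  · have := Real.rpow_le_one ht h hp
    have := Real.rpow_nonneg ht q
    linarith
  · have := Real.rpow_le_rpow_of_exponent_le h hpq
    linarith

theorem EvenKernel.integrable_mul_rpow {P : ℝ} {κ : E d → ℝ} (hκ : EvenKernel P κ) {p : ℝ}
    (hp : 0 ≤ p) (hpP : p ≤ P) : Integrable fun v => |κ v| * ‖v‖ ^ p := by
  refine (hκ.integrable.abs.add hκ.integrable_rpow).mono' ?_ (ae_of_all _ fun v => ?_)
  · have := hκ.measurable
    fun_prop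
  · have h1 := rpow_le_one_add_rpow (norm_nonneg v) hp hpP
    have h2 := Real.rpow_nonneg (norm_nonneg v) p
    rw [Real.norm_eq_abs, abs_of_nonneg (by positivity)]
    simp only [Pi.add_apply]
    nlinarith [abs_nonneg (κ v)]

theorem EvenKernel.integrable_mul_inner_pow {P : ℝ} {κ : E d → ℝ} (hκ : EvenKernel P κ) {k : ℕ}
    (hk : (k : ℝ) ≤ P) (ξ : E d) : Integrable fun v => κ v * inner ℝ v ξ ^ k := by
  refine ((hκ.integrable_mul_rpow (Nat.cast_nonneg k) hk).mul_const (‖ξ‖ ^ k)).mono' ?_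
    (ae_of_all _ fun v => ?_)
  · have := hκ.measurable
    fun_prop
  · rw [norm_mul, norm_pow, Real.norm_eq_abs, Real.norm_eq_abs, Real.rpow_natCast, mul_assoc,
      ← mul_pow]
    gcongr
    exact abs_real_inner_le_norm v ξ

/-- Only the constant term of the Taylor polynomial survives integration against `κ`. -/
theorem EvenKernel.integral_mul_cosTaylor {P : ℝ} {κ : E d → ℝ} (hκ : EvenKernel P κ) {k : ℕ}
    (hk : (2 * k : ℝ) < P) (c : ℝ) (ξ : E d) :
    Integrable (fun v => κ v * cosTaylor k (c * inner ℝ v ξ)) ∧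
      ∫ v, κ v * cosTaylor k (c * inner ℝ v ξ) = 1 := by
  have hint : ∀ j ∈ Finset.range (k + 1), Integrable fun v =>
      (-1) ^ j * c ^ (2 * j) / (2 * j).factorial * (κ v * inner ℝ v ξ ^ (2 * j)) := by
    intro j hj
    refine (hκ.integrable_mul_inner_pow ?_ ξ).const_mul _
    have : (j : ℝ) ≤ k := by exact_mod_cast Nat.lt_succ_iff.1 (Finset.mem_range.1 hj)
    push_cast; linarith
  have e : (fun v => κ v * cosTaylor k (c * inner ℝ v ξ)) = fun v =>
      ∑ j ∈ Finset.range (k + 1),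
        (-1) ^ j * c ^ (2 * j) / (2 * j).factorial * (κ v * inner ℝ v ξ ^ (2 * j)) := by
    ext v
    rw [cosTaylor, Finset.mul_sum]
    refine Finset.sum_congr rfl fun j _ => ?_
    rw [mul_pow]; ring
  rw [e]
  refine ⟨integrable_finsetSum _ hint, ?_⟩
  rw [integral_finsetSum _ hint, Finset.sum_range_succ', Finset.sum_eq_zero]
  · simp [hκ.integral_one]
  · intro j hj
    rw [integral_const_mul, hκ.moment_zero (j + 1) (by omega), mul_zero]
    have : (j : ℝ) + 1 ≤ k := by exact_mod_cast Finset.mem_range.1 hj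
    push_cast; linarith

/-- After Fubini the integrand against the spectral measure is `∫ κ(v)(2 - 2 cos)`. The constant `2`
may be replaced by twice the Taylor polynomial, since both have the same integral against `κ`. -/
theorem EvenKernel.integral_mul_transSq_eq {P : ℝ} {κ : E d → ℝ} (hκ : EvenKernel P κ) {f : E d → ℝ}
    (h1 : Integrable f) (h2 : MemLp f 2) {k : ℕ} (hk : (2 * k : ℝ) < P) (h : ℝ) :
    ∫ v, κ v * transSq f (h • v) = ∫ ξ, (∫ v, κ v * (2 * (cosTaylor k
      (2 * Real.pi * inner ℝ (h • v) ξ) - Real.cos (2 * Real.pi * inner ℝ (h • v) ξ))))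
        ∂(spec f) := by
  have := isFiniteMeasure_spec h1 h2
  have hκm := hκ.measurable
  have e1 : ∀ v, κ v * transSq f (h • v) =
      ∫ ξ, κ v * (2 - 2 * Real.cos (2 * Real.pi * inner ℝ (h • v) ξ)) ∂(spec f) := fun v => by
    rw [transSq, integral_sq_translate_sub h1 h2, integral_const_mul]
  simp_rw [e1]
  rw [integral_integral_swap]
  · refine integral_congr_ae (ae_of_all _ fun ξ => ?_)
    simp only
    have hT := hκ.integral_mul_cosTaylor hk (2 * Real.pi * h) ξ
    have hcos : Integrable fun v => κ v * Real.cos (2 * Real.pi * inner ℝ (h • v) ξ) := by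
      refine hκ.integrable.mul_bdd (c := 1) (by fun_prop) (ae_of_all _ fun v => ?_)
      exact Real.abs_cos_le_one _
    have es : ∀ v, 2 * Real.pi * inner ℝ (h • v) ξ = 2 * Real.pi * h * inner ℝ v ξ := fun v => by
      rw [real_inner_smul_left]; ring
    have l1 : (fun v => κ v * (2 - 2 * Real.cos (2 * Real.pi * inner ℝ (h • v) ξ))) =
        fun v => 2 * κ v - 2 * (κ v * Real.cos (2 * Real.pi * inner ℝ (h • v) ξ)) := by
      ext v; ring
    have l2 : (fun v => κ v * (2 * (cosTaylor k (2 * Real.pi * inner ℝ (h • v) ξ) -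
          Real.cos (2 * Real.pi * inner ℝ (h • v) ξ)))) =
        fun v => 2 * (κ v * cosTaylor k (2 * Real.pi * h * inner ℝ v ξ)) -
          2 * (κ v * Real.cos (2 * Real.pi * inner ℝ (h • v) ξ)) := by
      ext v; rw [es]; ring
    rw [l1, l2, integral_sub (hκ.integrable.const_mul 2) (hcos.const_mul 2),
      integral_sub (hT.1.const_mul 2) (hcos.const_mul 2), integral_const_mul, integral_const_mul,
      integral_const_mul, hT.2, hκ.integral_one]
  · refine Integrable.mul_bdd (c := 4) (hκ.integrable.comp_fst (spec f)) (by fun_prop)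
      (ae_of_all _ fun p => ?_)
    rw [Real.norm_eq_abs, abs_le]
    constructor
    · linarith [Real.cos_le_one (2 * Real.pi * inner ℝ (h • p.1) p.2)]
    · linarith [Real.neg_one_le_cos (2 * Real.pi * inner ℝ (h • p.1) p.2)]

/-- The Taylor remainder is integrated first over frequencies, which gives `‖h v‖ ^ β`, then against
`|κ|`, whose moment of order `β ≤ P` is finite. The exponent is `2s` rather than `s` because the
bias is quadratic in differences of `f`. -/
theorem EvenKernel.exists_bias_bound {P s : ℝ} {κ : E d → ℝ} (hκ : EvenKernel P κ) {f : E d → ℝ}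
    (h1 : Integrable f) (hf : MemBesovTwoInfty s f) (hs : 0 < s) (hs2 : ∀ k : ℕ, 2 * s ≠ k)
    (hP : 0 < P) :
    ∃ C : ℝ, ∀ h : ℝ, 0 < h → |∫ v, κ v * transSq f (h • v)| ≤ C * h ^ (min P (2 * s)) := by
  have h2 := hf.1
  have := isFiniteMeasure_spec h1 h2
  have hκm := hκ.measurable
  obtain ⟨C, hC⟩ := lintegral_spec_le_of_besov h1 hf
  obtain ⟨k, hk, C', hC'⟩ := exists_taylor_order (spec f) _ hC hs hs2 hP
  set β := min P (2 * s) with hβ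
  have hβ0 : 0 ≤ β := le_min hP.le (by linarith)
  have hint := hκ.integrable_mul_rpow hβ0 (min_le_left _ _)
  refine ⟨2 * (k + 5) * (C' * ∫ v, |κ v| * ‖v‖ ^ β), fun h hh => ?_⟩
  rw [hκ.integral_mul_transSq_eq h1 h2 hk]
  have hI0 : 0 ≤ ∫ v, |κ v| * ‖v‖ ^ β := integral_nonneg fun v => by positivity
  rw [← ENNReal.ofReal_le_ofReal_iff (by positivity), ← Real.norm_eq_abs, ofReal_norm]
  refine (enorm_integral_le_lintegral_enorm _).trans ?_
  have hbd : ∀ v ξ : E d, ‖κ v * (2 * (cosTaylor k (2 * Real.pi * inner ℝ (h • v) ξ) -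
      Real.cos (2 * Real.pi * inner ℝ (h • v) ξ)))‖ₑ ≤
      ENNReal.ofReal (2 * (k + 5) * |κ v|) *
        ENNReal.ofReal (min (|2 * Real.pi * inner ℝ (h • v) ξ| ^ (2 * k))
          (|2 * Real.pi * inner ℝ (h • v) ξ| ^ (2 * k + 2))) := by
    intro v ξ
    rw [← ofReal_norm, ← ENNReal.ofReal_mul (by positivity)]
    refine ENNReal.ofReal_le_ofReal ?_
    have := abs_cos_sub_cosTaylor_le k (2 * Real.pi * inner ℝ (h • v) ξ)
    rw [norm_mul, norm_mul, Real.norm_eq_abs, Real.norm_eq_abs, Real.norm_eq_abs, abs_two,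
      abs_sub_comm]
    calc |κ v| * (2 * |Real.cos (2 * Real.pi * inner ℝ (h • v) ξ) -
          cosTaylor k (2 * Real.pi * inner ℝ (h • v) ξ)|) ≤
        |κ v| * (2 * ((k + 5) * min (|2 * Real.pi * inner ℝ (h • v) ξ| ^ (2 * k))
          (|2 * Real.pi * inner ℝ (h • v) ξ| ^ (2 * k + 2)))) := by gcongr
      _ = _ := by ring
  calc ∫⁻ ξ, ‖∫ v, κ v * (2 * (cosTaylor k (2 * Real.pi * inner ℝ (h • v) ξ) -
          Real.cos (2 * Real.pi * inner ℝ (h • v) ξ)))‖ₑ ∂(spec f)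
      ≤ ∫⁻ ξ, (∫⁻ v, ENNReal.ofReal (2 * (k + 5) * |κ v|) *
        ENNReal.ofReal (min (|2 * Real.pi * inner ℝ (h • v) ξ| ^ (2 * k))
          (|2 * Real.pi * inner ℝ (h • v) ξ| ^ (2 * k + 2)))) ∂(spec f) := by
        refine lintegral_mono fun ξ => (enorm_integral_le_lintegral_enorm _).trans ?_
        exact lintegral_mono fun v => hbd v ξ
    _ = ∫⁻ v, ∫⁻ ξ, ENNReal.ofReal (2 * (k + 5) * |κ v|) *
        ENNReal.ofReal (min (|2 * Real.pi * inner ℝ (h • v) ξ| ^ (2 * k))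
          (|2 * Real.pi * inner ℝ (h • v) ξ| ^ (2 * k + 2))) ∂(spec f) := by
        rw [lintegral_lintegral_swap]
        fun_prop
    _ ≤ ∫⁻ v, ENNReal.ofReal (2 * (k + 5) * |κ v|) * (C' * ENNReal.ofReal (‖h • v‖ ^ β)) := by
        refine lintegral_mono fun v => ?_
        rw [lintegral_const_mul _ (by fun_prop)]
        gcongr
        exact hC' _
    _ = ∫⁻ v, ENNReal.ofReal (2 * (k + 5) * C' * h ^ β * (|κ v| * ‖v‖ ^ β)) := by
        refine lintegral_congr fun v => ?_
        rw [← ENNReal.ofReal_coe_nnreal, ← ENNReal.ofReal_mul (NNReal.coe_nonneg _),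
          ← ENNReal.ofReal_mul (by positivity), norm_smul, Real.norm_eq_abs, abs_of_pos hh,
          Real.mul_rpow hh.le (norm_nonneg _)]
        congr 1; ring
    _ = ENNReal.ofReal (2 * (k + 5) * (C' * ∫ v, |κ v| * ‖v‖ ^ β) * h ^ β) := by
        rw [← ofReal_integral_eq_lintegral_ofReal (hint.const_mul _)
          (ae_of_all _ fun v => by positivity), integral_const_mul]
        congr 1; ring

/-! ### Cauchy–Schwarz -/

/-- The quadratic polynomial `t ↦ ∫ w (g - t)²` is nonnegative, so its discriminant is not positive.
-/
theorem sq_integral_mul_le {α : Type*} [MeasurableSpace α] {μ : Measure α} {w g : α → ℝ}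
    (hw0 : ∀ x, 0 ≤ w x) (hw : Integrable w μ) (h1 : Integrable (fun x => w x * g x) μ)
    (h2 : Integrable (fun x => w x * g x ^ 2) μ) :
    (∫ x, w x * g x ∂μ) ^ 2 ≤ (∫ x, w x ∂μ) * ∫ x, w x * g x ^ 2 ∂μ := by
  have key : ∀ t : ℝ, 0 ≤ (∫ x, w x ∂μ) * (t * t) + (-2 * ∫ x, w x * g x ∂μ) * t +
      ∫ x, w x * g x ^ 2 ∂μ := by
    intro t
    have : 0 ≤ ∫ x, w x * (g x - t) ^ 2 ∂μ :=
      integral_nonneg fun x => mul_nonneg (hw0 x) (sq_nonneg _)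
    have e : (fun x => w x * (g x - t) ^ 2) =
        fun x => w x * g x ^ 2 - 2 * t * (w x * g x) + t * t * w x := by ext x; ring
    have i1 : Integrable (fun x => w x * g x ^ 2 - 2 * t * (w x * g x)) μ :=
      h2.sub (h1.const_mul _)
    rw [e, integral_add i1 (hw.const_mul _),
      integral_sub h2 (h1.const_mul _), integral_const_mul, integral_const_mul] at this
    linarith
  have := discrim_le_zero key
  rw [discrim] at this
  linarith

theorem sq_integral_le {α : Type*} [MeasurableSpace α] {μ : Measure α} [IsProbabilityMeasure μ]
    {g : α → ℝ} (h1 : Integrable g μ) (h2 : Integrable (fun x => g x ^ 2) μ) :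
    (∫ x, g x ∂μ) ^ 2 ≤ ∫ x, g x ^ 2 ∂μ := by
  have := sq_integral_mul_le (μ := μ) (w := fun _ => 1) (g := g) (fun _ => zero_le_one)
    (integrable_const 1) (by simpa using h1) (by simpa using h2)
  simpa using this

/-! ### Approximation by smoothing -/

/-- Immediate on the spectral side: the integrand is continuous in `u`, bounded by `4`, and the
measure is finite. -/
theorem continuous_transSq {f : E d → ℝ} (h1 : Integrable f) (h2 : MemLp f 2) :
    Continuous (transSq f) := by
  have := isFiniteMeasure_spec h1 h2
  have e : transSq f = fun u => ∫ ξ, (2 - 2 * Real.cos (2 * Real.pi * inner ℝ u ξ)) ∂(spec f) :=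
    funext fun u => integral_sq_translate_sub h1 h2 u
  rw [e]
  refine continuous_of_dominated (bound := fun _ => 4) (fun u => by fun_prop) (fun u => ?_)
    (integrable_const _) (ae_of_all _ fun ξ => by fun_prop)
  refine ae_of_all _ fun ξ => ?_
  rw [Real.norm_eq_abs, abs_le]
  constructor
  · linarith [Real.cos_le_one (2 * Real.pi * inner ℝ u ξ)]
  · linarith [Real.neg_one_le_cos (2 * Real.pi * inner ℝ u ξ)]

theorem tendsto_transSq {f : E d → ℝ} (h1 : Integrable f) (h2 : MemLp f 2) :
    Tendsto (transSq f) (𝓝 0) (𝓝 0) := by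
  have := (continuous_transSq h1 h2).tendsto 0
  simpa [transSq] using this

theorem transSq_le {f : E d → ℝ} (h1 : Integrable f) (h2 : MemLp f 2) (u : E d) :
    transSq f u ≤ 4 * (spec f).real Set.univ := by
  have := isFiniteMeasure_spec h1 h2
  rw [transSq, integral_sq_translate_sub h1 h2]
  refine (integral_mono_of_nonneg (g := fun _ => (4 : ℝ)) (ae_of_all _ fun ξ => ?_)
    (integrable_const _) (ae_of_all _ fun ξ => ?_)).trans_eq ?_
  · simp only [Pi.zero_apply]
    linarith [Real.cos_le_one (2 * Real.pi * inner ℝ u ξ)]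
  · simp only
    linarith [Real.neg_one_le_cos (2 * Real.pi * inner ℝ u ξ)]
  · rw [integral_const, smul_eq_mul, mul_comm]

end AvgDensity

end

noncomputable section

namespace AvgDensity

/-! ### Kernel smoothing under the law of the data -/

variable {d : ℕ}

theorem integral_densityLaw {f : E d → ℝ} (hm : Measurable f) (h0 : ∀ x, 0 ≤ f x) (g : E d → ℝ) :
    ∫ x, g x ∂(densityLaw f) = ∫ x, f x * g x := by
  rw [densityLaw, integral_withDensity_eq_integral_toReal_smul (by fun_prop)
    (ae_of_all _ fun _ => ENNReal.ofReal_lt_top)]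
  refine integral_congr_ae (ae_of_all _ fun x => ?_)
  simp [ENNReal.toReal_ofReal (h0 x)]

theorem lintegral_densityLaw_le {f : E d → ℝ} (hm : Measurable f) {M : ℝ} (hM : ∀ x, f x ≤ M)
    (g : E d → ℝ≥0∞) : ∫⁻ x, g x ∂(densityLaw f) ≤ ENNReal.ofReal M * ∫⁻ x, g x := by
  rw [densityLaw, lintegral_withDensity_eq_lintegral_mul_non_measurable _ (by fun_prop)
    (ae_of_all _ fun _ => ENNReal.ofReal_lt_top), ← lintegral_const_mul' _ _ ENNReal.ofReal_ne_top]
  refine lintegral_mono fun y => ?_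
  rw [Pi.mul_apply]
  gcongr
  exact hM y

theorem integrable_of_isProbabilityMeasure_densityLaw {f : E d → ℝ} (hm : Measurable f)
    (h0 : ∀ x, 0 ≤ f x) [IsProbabilityMeasure (densityLaw f)] : Integrable f := by
  refine ⟨hm.aestronglyMeasurable, ?_⟩
  have h := measure_univ (μ := densityLaw f)
  rw [densityLaw, withDensity_apply _ MeasurableSet.univ, Measure.restrict_univ] at h
  rw [hasFiniteIntegral_iff_ofReal (ae_of_all _ h0), h]
  exact ENNReal.one_lt_top

/-- The substitution `z = y + h v`; evenness of the kernel absorbs the sign. -/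
theorem integral_scaledKernel_sub {κ : E d → ℝ} (heven : ∀ u, κ (-u) = κ u) {f : E d → ℝ}
    (hm : Measurable f) (h0 : ∀ x, 0 ≤ f x) {h : ℝ} (hh : 0 < h) (y : E d) :
    ∫ z, scaledKernel κ h (y - z) ∂(densityLaw f) = ∫ v, κ v * f (y + h • v) := by
  rw [integral_densityLaw hm h0, ← integral_add_left_eq_self _ y]
  have e : (fun w => f (y + w) * scaledKernel κ h (y - (y + w))) = fun w =>
      1 / h ^ d * (fun v => κ v * f (y + h • v)) (h⁻¹ • w) := by
    ext w
    rw [scaledKernel, sub_add_cancel_left, smul_neg, heven]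
    simp only [smul_smul, mul_inv_cancel₀ hh.ne', one_smul]
    ring
  have e2 := Measure.integral_comp_inv_smul (volume : Measure (E d))
    (fun v => κ v * f (y + h • v)) h
  rw [e, integral_const_mul, e2]
  simp only [finrank_euclideanSpace, Fintype.card_fin, smul_eq_mul, abs_of_pos (pow_pos hh d)]
  rw [← mul_assoc, one_div_mul_cancel (pow_pos hh d).ne', one_mul]

theorem measurable_scaledKernel {κ : E d → ℝ} (hκ : Measurable κ) (h : ℝ) :
    Measurable (scaledKernel κ h) := by
  unfold scaledKernel
  fun_prop

theorem scaledKernel_neg {κ : E d → ℝ} (heven : ∀ u, κ (-u) = κ u) (h : ℝ) (u : E d) :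
    scaledKernel κ h (-u) = scaledKernel κ h u := by
  rw [scaledKernel, scaledKernel, smul_neg, heven]

theorem abs_scaledKernel_le {κ : E d → ℝ} {B : ℝ} (hB : ∀ u, |κ u| ≤ B) {h : ℝ} (hh : 0 < h)
    (u : E d) : |scaledKernel κ h u| ≤ B / h ^ d := by
  rw [scaledKernel, abs_mul, abs_of_pos (by positivity), one_div_mul_eq_div]
  have := hB (h⁻¹ • u)
  gcongr

variable {P : ℝ} {κ : E d → ℝ}

theorem abs_integral_scaledKernel_le (hκ : EvenKernel P κ) {f : E d → ℝ} (hm : Measurable f)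
    (h0 : ∀ x, 0 ≤ f x) {M : ℝ} (hM : ∀ x, f x ≤ M) {h : ℝ} (hh : 0 < h) (y : E d) :
    ∫ z, |scaledKernel κ h (y - z)| ∂(densityLaw f) ≤ M * ∫ v, |κ v| := by
  have e : ∀ z, |scaledKernel κ h (y - z)| = scaledKernel (fun u => |κ u|) h (y - z) := by
    intro z
    rw [scaledKernel, scaledKernel, abs_mul, abs_of_pos (by positivity)]
  simp_rw [e]
  rw [integral_scaledKernel_sub (fun u => by rw [hκ.even]) hm h0 hh, ← integral_const_mul]
  refine integral_mono_of_nonneg (ae_of_all _ fun v => mul_nonneg (abs_nonneg _) (h0 _))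
    (hκ.integrable.abs.const_mul M) (ae_of_all _ fun v => ?_)
  simp only
  rw [mul_comm]
  exact mul_le_mul_of_nonneg_right (hM _) (abs_nonneg _)

/-- One factor of the square is bounded by its supremum `B / h ^ d`, the other is integrated at a
cost bounded uniformly in `h`. -/
theorem integral_integral_scaledKernel_sq_le (hκ : EvenKernel P κ) {f : E d → ℝ}
    (hm : Measurable f) (h0 : ∀ x, 0 ≤ f x) {M : ℝ} (hM : ∀ x, f x ≤ M) {B : ℝ}
    (hB : ∀ u, |κ u| ≤ B) [IsProbabilityMeasure (densityLaw f)] {h : ℝ} (hh : 0 < h) :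
    ∫ y, ∫ z, scaledKernel κ h (y - z) ^ 2 ∂(densityLaw f) ∂(densityLaw f) ≤
      B * (M * ∫ v, |κ v|) / h ^ d := by
  have hB0 : 0 ≤ B := (abs_nonneg _).trans (hB 0)
  have hmeas := measurable_scaledKernel hκ.measurable h
  have hin : ∀ y, ∫ z, scaledKernel κ h (y - z) ^ 2 ∂(densityLaw f) ≤
      B * (M * ∫ v, |κ v|) / h ^ d := by
    intro y
    calc ∫ z, scaledKernel κ h (y - z) ^ 2 ∂(densityLaw f)
        ≤ ∫ z, B / h ^ d * |scaledKernel κ h (y - z)| ∂(densityLaw f) := by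
          refine integral_mono_of_nonneg (ae_of_all _ fun z => sq_nonneg _) ?_
            (ae_of_all _ fun z => ?_)
          · refine Integrable.const_mul ?_ _
            refine Integrable.of_bound (by fun_prop : Measurable _).aestronglyMeasurable (B / h ^ d) (ae_of_all _ fun z => ?_)
            rw [Real.norm_eq_abs, abs_abs]
            exact abs_scaledKernel_le hB hh _
          · simp only
            rw [← sq_abs, sq]
            exact mul_le_mul_of_nonneg_right (abs_scaledKernel_le hB hh _) (abs_nonneg _)
      _ ≤ B / h ^ d * (M * ∫ v, |κ v|) := by
          rw [integral_const_mul]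
          exact mul_le_mul_of_nonneg_left (abs_integral_scaledKernel_le hκ hm h0 hM hh y)
            (by positivity)
      _ = _ := by ring
  refine (integral_mono_of_nonneg (ae_of_all _ fun y => integral_nonneg fun z => sq_nonneg _)
    (integrable_const _) (ae_of_all _ hin)).trans_eq ?_
  simp

theorem integral_mul_translate {f : E d → ℝ} (h2 : MemLp f 2) (u : E d) :
    ∫ y, f y * f (y + u) = (∫ y, f y ^ 2) - transSq f u / 2 := by
  have hu : MemLp (fun y => f (y + u)) 2 :=
    h2.comp_measurePreserving (measurePreserving_add_right volume u)
  have e1 : ∫ y, f (y + u) ^ 2 = ∫ y, f y ^ 2 :=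
    integral_add_right_eq_self (fun y => f y ^ 2) u
  have e2 : transSq f u = ∫ y, (f (y + u) ^ 2 - 2 * (f y * f (y + u)) + f y ^ 2) := by
    rw [transSq]; congr 1; ext y; ring
  have i1 := hu.integrable_sq
  have i2 := h2.integrable_sq
  have i3 : Integrable fun y => f y * f (y + u) := h2.integrable_mul hu
  have i4 : Integrable fun y => f (y + u) ^ 2 - 2 * (f y * f (y + u)) := i1.sub (i3.const_mul 2)
  rw [integral_add i4 i2, integral_sub i1 (i3.const_mul 2), integral_const_mul, e1] at e2
  linarith

/-- By Fubini the left side averages `∫ f(y) f(y + hv) dy` against `κ`. Polarization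
(`integral_mul_translate`) writes this correlation as `∫ f²` minus half a squared translation
distance, so no first-order bias appears. -/
theorem integral_theta_eq (hκ : EvenKernel P κ) {f : E d → ℝ}
    (hm : Measurable f) (h0 : ∀ x, 0 ≤ f x) {M : ℝ} (hM : ∀ x, f x ≤ M) (h1 : Integrable f)
    (h2 : MemLp f 2) {h : ℝ} (hh : 0 < h) :
    ∫ y, ∫ z, scaledKernel κ h (y - z) ∂(densityLaw f) ∂(densityLaw f) =
      theta0 f - (∫ v, κ v * transSq f (h • v)) / 2 := by
  have := isFiniteMeasure_spec h1 h2
  have hκm := hκ.measurable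
  rw [integral_densityLaw hm h0, theta0, integral_densityLaw hm h0]
  simp_rw [integral_scaledKernel_sub hκ.even hm h0 hh, ← integral_const_mul]
  rw [integral_integral_swap]
  · have e : ∀ v, ∫ y, f y * (κ v * f (y + h • v)) =
        κ v * (∫ y, f y ^ 2) - κ v * transSq f (h • v) / 2 := by
      intro v
      have : (fun y => f y * (κ v * f (y + h • v))) = fun y => κ v * (f y * f (y + h • v)) := by
        ext y; ring
      rw [this, integral_const_mul, integral_mul_translate h2]
      ring
    simp_rw [e]
    rw [integral_sub, integral_mul_const, hκ.integral_one, one_mul, integral_div]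
    · simp_rw [← sq]
    · exact hκ.integrable.mul_const _
    · refine Integrable.div_const ?_ 2
      refine hκ.integrable.mul_bdd (c := 4 * (spec f).real Set.univ) ?_ (ae_of_all _ fun v => ?_)
      · have := continuous_transSq h1 h2
        fun_prop
      · rw [Real.norm_eq_abs, abs_of_nonneg (transSq_nonneg _ _)]
        exact transSq_le h1 h2 _
  · have e : (Function.uncurry fun y v => f y * (κ v * f (y + h • v))) = fun p : E d × E d =>
        f p.1 * κ p.2 * f (p.1 + h • p.2) := by
      ext p; simp [Function.uncurry, mul_assoc]
    rw [e]
    refine (h1.mul_prod hκ.integrable).mul_bdd (c := M) ?_ (ae_of_all _ fun p => ?_)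
    · exact (by fun_prop : Measurable _).aestronglyMeasurable
    · rw [Real.norm_eq_abs, abs_of_nonneg (h0 _)]
      exact hM _

/-- Since `∫ κ = 1`, the error at `y` is `∫ κ(v)(f(y+hv) - f(y)) dv`. Cauchy–Schwarz with weight
`|κ|` and Tonelli give the bound. -/
theorem lintegral_smooth_sub_sq_le (hκ : EvenKernel P κ) {f : E d → ℝ}
    (hm : Measurable f) (h0 : ∀ x, 0 ≤ f x) {M : ℝ} (hM : ∀ x, f x ≤ M)
    (h2 : MemLp f 2) {h : ℝ} (hh : 0 < h) :
    ∫⁻ y, ENNReal.ofReal ((∫ z, scaledKernel κ h (y - z) ∂(densityLaw f) - f y) ^ 2) ≤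
      ENNReal.ofReal (∫ v, |κ v|) *
        ∫⁻ v, ENNReal.ofReal |κ v| * ENNReal.ofReal (transSq f (h • v)) := by
  have hκm := hκ.measurable
  have hI0 : 0 ≤ ∫ v, |κ v| := integral_nonneg fun v => abs_nonneg _
  have hbd : ∀ x y, |f x - f y| ≤ M := fun x y => by
    rw [abs_le]; constructor <;> linarith [h0 x, h0 y, hM x, hM y]
  have hpt : ∀ y, ENNReal.ofReal ((∫ z, scaledKernel κ h (y - z) ∂(densityLaw f) - f y) ^ 2) ≤
      ENNReal.ofReal (∫ v, |κ v|) *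
        ∫⁻ v, ENNReal.ofReal (|κ v| * (f (y + h • v) - f y) ^ 2) := by
    intro y
    have i0 : Integrable fun v => κ v * f (y + h • v) := by
      refine hκ.integrable.mul_bdd (c := M) (by fun_prop : Measurable _).aestronglyMeasurable
        (ae_of_all _ fun v => ?_)
      rw [Real.norm_eq_abs, abs_of_nonneg (h0 _)]
      exact hM _
    have i1 : Integrable fun v => |κ v| * |f (y + h • v) - f y| := by
      refine hκ.integrable.abs.mul_bdd (c := M) (by fun_prop : Measurable _).aestronglyMeasurable
        (ae_of_all _ fun v => ?_)
      rw [Real.norm_eq_abs, abs_abs]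
      exact hbd _ _
    have i2 : Integrable fun v => |κ v| * |f (y + h • v) - f y| ^ 2 := by
      refine hκ.integrable.abs.mul_bdd (c := M ^ 2) (by fun_prop : Measurable _).aestronglyMeasurable
        (ae_of_all _ fun v => ?_)
      rw [norm_pow, Real.norm_eq_abs, abs_abs]
      exact pow_le_pow_left₀ (abs_nonneg _) (hbd _ _) 2
    have e1 : ∫ z, scaledKernel κ h (y - z) ∂(densityLaw f) - f y =
        ∫ v, κ v * (f (y + h • v) - f y) := by
      rw [integral_scaledKernel_sub hκ.even hm h0 hh]
      simp_rw [mul_sub]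
      rw [integral_sub i0 (hκ.integrable.mul_const _), integral_mul_const, hκ.integral_one, one_mul]
    have e2 : (∫ v, κ v * (f (y + h • v) - f y)) ^ 2 ≤
        (∫ v, |κ v|) * ∫ v, |κ v| * |f (y + h • v) - f y| ^ 2 := by
      refine le_trans ?_ (sq_integral_mul_le (fun v => abs_nonneg _) hκ.integrable.abs i1 i2)
      rw [← sq_abs]
      refine pow_le_pow_left₀ (abs_nonneg _) ((abs_integral_le_integral_abs).trans_eq ?_) 2
      simp_rw [abs_mul]
    rw [e1]
    refine (ENNReal.ofReal_le_ofReal e2).trans_eq ?_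
    rw [ENNReal.ofReal_mul hI0, ofReal_integral_eq_lintegral_ofReal i2
      (ae_of_all _ fun v => by positivity)]
    simp_rw [sq_abs]
  refine (lintegral_mono hpt).trans_eq ?_
  rw [lintegral_const_mul' _ _ ENNReal.ofReal_ne_top, lintegral_lintegral_swap (by fun_prop)]
  congr 1
  refine lintegral_congr fun v => ?_
  have : Integrable fun y => (f (y + h • v) - f y) ^ 2 :=
    ((h2.comp_measurePreserving (measurePreserving_add_right volume (h • v))).sub h2).integrable_sq
  rw [transSq, ofReal_integral_eq_lintegral_ofReal this (ae_of_all _ fun _ => sq_nonneg _),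
    ← lintegral_const_mul' _ _ ENNReal.ofReal_ne_top]
  refine lintegral_congr fun y => ?_
  rw [ENNReal.ofReal_mul (abs_nonneg _)]

/-- The bounded density reduces the claim to Lebesgue measure. There dominated convergence applies,
since `transSq f` is bounded and tends to zero at the origin. -/
theorem tendsto_integral_smooth_sub_sq (hκ : EvenKernel P κ) {f : E d → ℝ}
    (hm : Measurable f) (h0 : ∀ x, 0 ≤ f x) {M : ℝ} (hM : ∀ x, f x ≤ M) (h1 : Integrable f)
    (h2 : MemLp f 2) {h : ℕ → ℝ} (hh : ∀ n, 0 < h n) (hlim : Tendsto h atTop (𝓝 0)) :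
    Tendsto (fun n => ∫ y, (∫ z, scaledKernel κ (h n) (y - z) ∂(densityLaw f) - f y) ^ 2
      ∂(densityLaw f)) atTop (𝓝 0) := by
  have := isFiniteMeasure_spec h1 h2
  have hκm := hκ.measurable
  have hM0 : 0 ≤ M := (h0 0).trans (hM 0)
  have hcont := continuous_transSq h1 h2
  have key : Tendsto (fun n => ∫⁻ v, ENNReal.ofReal |κ v| * ENNReal.ofReal (transSq f (h n • v)))
      atTop (𝓝 0) := by
    have : Tendsto (fun n => ∫⁻ v, ENNReal.ofReal |κ v| *
        ENNReal.ofReal (transSq f (h n • v))) atTop (𝓝 (∫⁻ _ : E d, 0)) := by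
      refine tendsto_lintegral_of_dominated_convergence
        (fun v => ENNReal.ofReal |κ v| * ENNReal.ofReal (4 * (spec f).real Set.univ)) ?_ ?_ ?_ ?_
      · intro n; fun_prop
      · intro n
        refine ae_of_all _ fun v => ?_
        simp only
        gcongr
        exact transSq_le h1 h2 _
      · rw [lintegral_mul_const' _ _ ENNReal.ofReal_ne_top]
        refine ENNReal.mul_ne_top ?_ ENNReal.ofReal_ne_top
        rw [← ofReal_integral_eq_lintegral_ofReal hκ.integrable.abs
          (ae_of_all _ fun _ => abs_nonneg _)]
        exact ENNReal.ofReal_ne_top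
      · refine ae_of_all _ fun v => ?_
        have l1 : Tendsto (fun n => transSq f (h n • v)) atTop (𝓝 0) := by
          have := (tendsto_transSq h1 h2).comp
            (by simpa using hlim.smul_const v : Tendsto (fun n => h n • v) atTop (𝓝 0))
          exact this
        have l2 := ENNReal.Tendsto.const_mul (a := ENNReal.ofReal |κ v|)
          (ENNReal.tendsto_ofReal l1) (Or.inr ENNReal.ofReal_ne_top)
        simpa using l2
    simpa using this
  have key2 : Tendsto (fun n => ENNReal.ofReal M * (ENNReal.ofReal (∫ v, |κ v|) *
      ∫⁻ v, ENNReal.ofReal |κ v| * ENNReal.ofReal (transSq f (h n • v)))) atTop (𝓝 0) := by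
    have := ENNReal.Tendsto.const_mul (a := ENNReal.ofReal M) (ENNReal.Tendsto.const_mul
      (a := ENNReal.ofReal (∫ v, |κ v|)) key (Or.inr ENNReal.ofReal_ne_top))
      (Or.inr ENNReal.ofReal_ne_top)
    simpa using this
  have key3 := (ENNReal.tendsto_toReal ENNReal.zero_ne_top).comp key2
  rw [ENNReal.toReal_zero] at key3
  refine tendsto_of_tendsto_of_tendsto_of_le_of_le' tendsto_const_nhds key3 ?_ ?_
  · exact Eventually.of_forall fun n => integral_nonneg fun y => sq_nonneg _
  · filter_upwards [key2.eventually_lt_const ENNReal.zero_lt_top] with n hn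
    rw [Function.comp_apply]
    refine ENNReal.ofReal_le_iff_le_toReal hn.ne |>.1 ?_
    rw [← abs_of_nonneg (integral_nonneg fun y => sq_nonneg _), ← Real.norm_eq_abs, ofReal_norm]
    refine (enorm_integral_le_lintegral_enorm _).trans ?_
    refine (lintegral_densityLaw_le hm hM _).trans ?_
    gcongr
    refine le_trans (le_of_eq (lintegral_congr fun y => ?_))
      (lintegral_smooth_sub_sq_le hκ hm h0 hM h2 (hh n))
    rw [← ofReal_norm, Real.norm_eq_abs, abs_of_nonneg (sq_nonneg _)]

end AvgDensity

end

noncomputable section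

namespace AvgDensity

/-! ### Quadratic forms in independent variables -/

section Hoeffding

theorem integral_pi_eval {ι : Type*} [Fintype ι] {𝓧 : Type*} [MeasurableSpace 𝓧]
    {ν : Measure 𝓧} [IsProbabilityMeasure ν] {φ : 𝓧 → ℝ} (hφ : Measurable φ) (j : ι) :
    ∫ y, φ (y j) ∂(Measure.pi fun _ : ι => ν) = ∫ x, φ x ∂ν := by
  have hp := measurePreserving_eval (fun _ : ι => ν) j
  conv_rhs => rw [← hp.map_eq]
  rw [integral_map hp.measurable.aemeasurable hφ.aestronglyMeasurable]

theorem measurable_eval_pair {ι : Type*} {𝓧 : Type*} [MeasurableSpace 𝓧] {φ : 𝓧 → 𝓧 → ℝ}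
    (hφ : Measurable (Function.uncurry φ)) (j k : ι) :
    Measurable fun y : ι → 𝓧 => φ (y j) (y k) :=
  hφ.comp (g := Function.uncurry φ) (f := fun y : ι → 𝓧 => (y j, y k))
    ((measurable_pi_apply j).prodMk (measurable_pi_apply k))

variable {ι : Type*} [Fintype ι] [DecidableEq ι] {𝓧 : Type*} [MeasurableSpace 𝓧]
  (ν : Measure 𝓧) [IsProbabilityMeasure ν]

/-- Resampling one coordinate independently leaves the product law unchanged. This gives
conditioning on the other coordinates without splitting the product. -/
theorem measurePreserving_update (k : ι) :
    MeasurePreserving (fun p : (ι → 𝓧) × 𝓧 => Function.update p.1 k p.2)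
      ((Measure.pi fun _ : ι => ν).prod ν) (Measure.pi fun _ : ι => ν) := by
  have hm : Measurable (fun p : (ι → 𝓧) × 𝓧 => Function.update p.1 k p.2) := by
    rw [measurable_pi_iff]
    intro i
    rcases eq_or_ne i k with rfl | h
    · simpa using measurable_snd
    · simp only [Function.update_of_ne h]
      fun_prop
  refine ⟨hm, ?_⟩
  symm
  refine Measure.pi_eq fun s hs => ?_
  rw [Measure.map_apply hm (MeasurableSet.univ_pi hs)]
  have e : (fun p : (ι → 𝓧) × 𝓧 => Function.update p.1 k p.2) ⁻¹' Set.univ.pi s =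
      (Set.univ.pi (Function.update s k Set.univ)) ×ˢ s k := by
    ext p
    simp only [Set.mem_preimage, Set.mem_pi, Set.mem_univ, true_imp_iff, Set.mem_prod]
    constructor
    · intro h
      refine ⟨fun i => ?_, by simpa using h k⟩
      rcases eq_or_ne i k with rfl | hi
      · simp
      · simpa [Function.update_of_ne hi] using h i
    · rintro ⟨h1, h2⟩ i
      rcases eq_or_ne i k with rfl | hi
      · simpa using h2
      · simpa [Function.update_of_ne hi] using h1 i
  rw [e, Measure.prod_prod, Measure.pi_pi, ← Finset.mul_prod_erase _ _ (Finset.mem_univ k),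
    ← Finset.mul_prod_erase _ (fun i => ν (s i)) (Finset.mem_univ k)]
  simp only [Function.update_self, measure_univ, one_mul]
  rw [mul_comm]
  congr 1
  refine Finset.prod_congr rfl fun i hi => ?_
  rw [Function.update_of_ne (Finset.ne_of_mem_erase hi)]

variable {ν}

theorem integral_pi_update {φ : (ι → 𝓧) → ℝ} (hφ : Integrable φ (Measure.pi fun _ : ι => ν))
    (k : ι) : ∫ y, φ y ∂(Measure.pi fun _ : ι => ν) =
      ∫ y, (∫ z, φ (Function.update y k z) ∂ν) ∂(Measure.pi fun _ : ι => ν) := by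
  have hp := measurePreserving_update ν k
  have h1 : Integrable (fun p : (ι → 𝓧) × 𝓧 => φ (Function.update p.1 k p.2))
      ((Measure.pi fun _ : ι => ν).prod ν) := hp.integrable_comp_of_integrable hφ
  rw [← integral_prod _ h1]
  conv_lhs => rw [← hp.map_eq]
  rw [integral_map hp.measurable.aemeasurable]
  rw [hp.map_eq]
  exact hφ.aestronglyMeasurable

theorem integral_pi_eq_zero {φ : (ι → 𝓧) → ℝ} (hφ : Integrable φ (Measure.pi fun _ : ι => ν))
    (k : ι) (h : ∀ y, ∫ z, φ (Function.update y k z) ∂ν = 0) :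
    ∫ y, φ y ∂(Measure.pi fun _ : ι => ν) = 0 := by
  rw [integral_pi_update hφ k]
  simp [h]

theorem integrable_of_abs_le {α : Type*} [MeasurableSpace α] {μ : Measure α} [IsFiniteMeasure μ]
    {φ : α → ℝ} (hφ : Measurable φ) {B : ℝ} (hB : ∀ x, |φ x| ≤ B) : Integrable φ μ :=
  Integrable.of_bound hφ.aestronglyMeasurable B (ae_of_all _ hB)

theorem integral_pi_eval_pair {φ : 𝓧 → 𝓧 → ℝ} (hφ : Measurable (Function.uncurry φ)) {B : ℝ}
    (hB : ∀ x y, |φ x y| ≤ B) {j k : ι} (hjk : j ≠ k) :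
    ∫ y, φ (y j) (y k) ∂(Measure.pi fun _ : ι => ν) = ∫ x, ∫ z, φ x z ∂ν ∂ν := by
  have hm : Measurable fun y : ι → 𝓧 => φ (y j) (y k) :=
    measurable_eval_pair hφ j k
  rw [integral_pi_update (integrable_of_abs_le hm fun y => hB _ _) k]
  simp only [Function.update_self, Function.update_of_ne hjk]
  exact integral_pi_eval (φ := fun x => ∫ z, φ x z ∂ν)
    (hφ.stronglyMeasurable.integral_prod_right (ν := ν)).measurable j

theorem integral_sq_sum_eval {φ : ι → 𝓧 → ℝ} (hφ : ∀ j, Measurable (φ j)) {B : ℝ}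
    (hB : ∀ j x, |φ j x| ≤ B) (h0 : ∀ j, ∫ x, φ j x ∂ν = 0) :
    ∫ y, (∑ j, φ j (y j)) ^ 2 ∂(Measure.pi fun _ : ι => ν) = ∑ j, ∫ x, φ j x ^ 2 ∂ν := by
  have hm : ∀ j k, Measurable fun y : ι → 𝓧 => φ j (y j) * φ k (y k) := fun j k =>
    ((hφ j).comp (measurable_pi_apply j)).mul ((hφ k).comp (measurable_pi_apply k))
  have hi : ∀ j k, Integrable (fun y : ι → 𝓧 => φ j (y j) * φ k (y k))
      (Measure.pi fun _ : ι => ν) := fun j k => by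
    refine integrable_of_abs_le (hm j k) (B := B * B) fun y => ?_
    rw [abs_mul]
    exact mul_le_mul (hB _ _) (hB _ _) (abs_nonneg _) ((abs_nonneg _).trans (hB j (y j)))
  have e : ∀ y : ι → 𝓧, (∑ j, φ j (y j)) ^ 2 = ∑ j, ∑ k, φ j (y j) * φ k (y k) := fun y => by
    rw [sq, Finset.sum_mul_sum]
  simp_rw [e]
  rw [integral_finsetSum _ fun j _ => integrable_finsetSum _ fun k _ => hi j k]
  refine Finset.sum_congr rfl fun j _ => ?_
  rw [integral_finsetSum _ fun k _ => hi j k, Finset.sum_eq_single j]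
  · rw [← integral_pi_eval (ν := ν) ((hφ j).pow_const 2) j]
    simp_rw [sq]
  · intro k _ hkj
    refine integral_pi_eq_zero (hi j k) k fun y => ?_
    simp only [Function.update_self, Function.update_of_ne hkj.symm]
    rw [integral_const_mul, h0, mul_zero]
  · simp

/-- Expanding the square, a product of two terms has mean zero unless the two index pairs coincide
up to order. This leaves at most two partners for each of the `n²` pairs. -/
theorem integral_sq_degenerate_le {q : 𝓧 → 𝓧 → ℝ} (hq : Measurable (Function.uncurry q)) {B : ℝ}
    (hB : ∀ x y, |q x y| ≤ B) (hsym : ∀ x y, q x y = q y x) (h0 : ∀ x, ∫ z, q x z ∂ν = 0)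
    (D : ι → ι → ℝ) (hD0 : ∀ j, D j j = 0) {a : ℝ} (hD : ∀ j k, |D j k| ≤ a) :
    ∫ y, (∑ j, ∑ k, D j k * q (y j) (y k)) ^ 2 ∂(Measure.pi fun _ : ι => ν) ≤
      2 * a ^ 2 * (Fintype.card ι) ^ 2 * ∫ x, ∫ z, q x z ^ 2 ∂ν ∂ν := by
  set Q := ∫ x, ∫ z, q x z ^ 2 ∂ν ∂ν with hQ
  have hQ0 : 0 ≤ Q := integral_nonneg fun x => integral_nonneg fun z => sq_nonneg _
  have hqm : ∀ p : ι × ι, Measurable fun y : ι → 𝓧 => q (y p.1) (y p.2) := fun p =>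
    measurable_eval_pair hq p.1 p.2
  have hi : ∀ p p' : ι × ι, Integrable
      (fun y : ι → 𝓧 => (D p.1 p.2 * q (y p.1) (y p.2)) * (D p'.1 p'.2 * q (y p'.1) (y p'.2)))
      (Measure.pi fun _ : ι => ν) := fun p p' => by
    refine integrable_of_abs_le (((hqm p).const_mul _).mul ((hqm p').const_mul _))
      (B := (|D p.1 p.2| * B) * (|D p'.1 p'.2| * B)) fun y => ?_
    rw [abs_mul, abs_mul, abs_mul]
    have := hB (y p.1) (y p.2)
    have := hB (y p'.1) (y p'.2)
    have := (abs_nonneg _).trans this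
    gcongr
  have hterm : ∀ p p' : ι × ι,
      ∫ y, (D p.1 p.2 * q (y p.1) (y p.2)) * (D p'.1 p'.2 * q (y p'.1) (y p'.2))
        ∂(Measure.pi fun _ : ι => ν) ≤
      (if p' = p then a ^ 2 * Q else 0) + (if p' = p.swap then a ^ 2 * Q else 0) := by
    rintro ⟨j, k⟩ ⟨l, m⟩
    have hn : 0 ≤ (if ((l, m) : ι × ι) = (j, k) then a ^ 2 * Q else 0) +
        (if ((l, m) : ι × ι) = (j, k).swap then a ^ 2 * Q else 0) := by
      split_ifs <;> positivity
    rcases eq_or_ne j k with rfl | hjk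
    · simp only [hD0, zero_mul, integral_zero]; exact hn
    rcases eq_or_ne l m with rfl | hlm
    · simp only [hD0, zero_mul, mul_zero, integral_zero]; exact hn
    have hdiag : ∀ c : ℝ, |c| ≤ a ^ 2 →
        ∫ y, c * q (y j) (y k) ^ 2 ∂(Measure.pi fun _ : ι => ν) ≤ a ^ 2 * Q := by
      intro c hc
      rw [integral_const_mul, integral_pi_eval_pair (φ := fun x z => q x z ^ 2) (B := B ^ 2)
        (hq.pow_const 2) (fun x y => by
          rw [abs_pow]; exact pow_le_pow_left₀ (abs_nonneg _) (hB x y) 2) hjk]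
      exact mul_le_mul_of_nonneg_right ((le_abs_self c).trans hc) hQ0
    have hprod : ∀ j k l m, |D j k * D l m| ≤ a ^ 2 := fun j k l m => by
      rw [abs_mul, sq]
      exact mul_le_mul (hD _ _) (hD _ _) (abs_nonneg _) ((abs_nonneg _).trans (hD j k))
    by_cases h1 : ((l, m) : ι × ι) = (j, k)
    · obtain ⟨rfl, rfl⟩ := Prod.mk.inj h1
      have e : ∀ y : ι → 𝓧, (D l m * q (y l) (y m)) * (D l m * q (y l) (y m)) =
          D l m * D l m * q (y l) (y m) ^ 2 := fun y => by ring
      simp only [e]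
      refine (hdiag _ (hprod _ _ _ _)).trans ?_
      rw [if_pos trivial]
      have : 0 ≤ if ((l, m) : ι × ι) = (l, m).swap then a ^ 2 * Q else 0 := by
        split_ifs <;> positivity
      linarith
    by_cases h2 : ((l, m) : ι × ι) = (k, j)
    · obtain ⟨rfl, rfl⟩ := Prod.mk.inj h2
      have e : ∀ y : ι → 𝓧, (D m l * q (y m) (y l)) * (D l m * q (y l) (y m)) =
          D m l * D l m * q (y m) (y l) ^ 2 := fun y => by rw [hsym (y l)]; ring
      simp only [e]
      refine (hdiag _ (hprod _ _ _ _)).trans ?_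
      rw [if_neg h1, zero_add, if_pos (show ((l, m) : ι × ι) = (m, l).swap from rfl)]
    refine le_trans (le_of_eq ?_) hn
    -- Some index of the first pair is missing from the second. Integrating out that coordinate
    -- gives zero by degeneracy, with the symmetry of `q` if the missing index is `j`.
    by_cases hk : k = l ∨ k = m
    · have hj : j ≠ l ∧ j ≠ m := by
        rcases hk with rfl | rfl
        · exact ⟨hjk, fun e => h2 (by rw [e])⟩
        · exact ⟨fun e => h1 (by rw [e]), hjk⟩
      refine integral_pi_eq_zero (hi (j, k) (l, m)) j fun y => ?_
      simp only [Function.update_self, Function.update_of_ne hjk.symm,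
        Function.update_of_ne hj.1.symm, Function.update_of_ne hj.2.symm]
      simp_rw [fun z => hsym z (y k)]
      rw [integral_mul_const, integral_const_mul, h0, mul_zero, zero_mul]
    · push Not at hk
      refine integral_pi_eq_zero (hi (j, k) (l, m)) k fun y => ?_
      simp only [Function.update_self, Function.update_of_ne hjk,
        Function.update_of_ne hk.1.symm, Function.update_of_ne hk.2.symm]
      rw [integral_mul_const, integral_const_mul, h0, mul_zero, zero_mul]
  have e : ∀ y : ι → 𝓧, (∑ j, ∑ k, D j k * q (y j) (y k)) ^ 2 = ∑ p : ι × ι, ∑ p' : ι × ι,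
      (D p.1 p.2 * q (y p.1) (y p.2)) * (D p'.1 p'.2 * q (y p'.1) (y p'.2)) := fun y => by
    rw [← Finset.sum_mul_sum, ← sq, ← Fintype.sum_prod_type']
  simp_rw [e]
  rw [integral_finsetSum _ fun p _ => integrable_finsetSum _ fun p' _ => hi p p']
  calc _ = ∑ p : ι × ι, ∑ p' : ι × ι,
        ∫ y, (D p.1 p.2 * q (y p.1) (y p.2)) * (D p'.1 p'.2 * q (y p'.1) (y p'.2))
        ∂(Measure.pi fun _ : ι => ν) :=
        Finset.sum_congr rfl fun p _ => integral_finsetSum _ fun p' _ => hi p p'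
    _ ≤ ∑ p : ι × ι, ∑ p' : ι × ι, ((if p' = p then a ^ 2 * Q else 0) +
        (if p' = p.swap then a ^ 2 * Q else 0)) :=
        Finset.sum_le_sum fun p _ => Finset.sum_le_sum fun p' _ => hterm p p'
    _ = _ := by
        simp only [Finset.sum_add_distrib, Finset.sum_ite_eq', Finset.mem_univ, if_true,
          Finset.sum_const, Finset.card_univ, Fintype.card_prod, nsmul_eq_mul]
        push_cast; ring

theorem abs_integral_le_of_abs_le {α : Type*} [MeasurableSpace α] {μ : Measure α}
    [IsProbabilityMeasure μ] {φ : α → ℝ} {B : ℝ} (hB : ∀ x, |φ x| ≤ B) : |∫ x, φ x ∂μ| ≤ B := by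
  have := norm_integral_le_of_norm_le_const (μ := μ) (f := φ) (C := B) (ae_of_all _ hB)
  simpa using this

theorem integral_sq_sub_mean_le {α : Type*} [MeasurableSpace α] {μ : Measure α}
    [IsProbabilityMeasure μ] {ψ : α → ℝ} (hψ : Measurable ψ) {B : ℝ} (hB : ∀ x, |ψ x| ≤ B) :
    ∫ x, (ψ x - ∫ z, ψ z ∂μ) ^ 2 ∂μ ≤ ∫ x, ψ x ^ 2 ∂μ := by
  have i1 : Integrable ψ μ := integrable_of_abs_le hψ hB
  have i2 : Integrable (fun x => ψ x ^ 2) μ := integrable_of_abs_le (hψ.pow_const 2) (B := B ^ 2)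
    fun x => by rw [abs_pow]; exact pow_le_pow_left₀ (abs_nonneg _) (hB x) 2
  set c := ∫ z, ψ z ∂μ
  have e : (fun x => (ψ x - c) ^ 2) = fun x => ψ x ^ 2 - 2 * c * ψ x + c ^ 2 := by ext x; ring
  have i3 : Integrable (fun x => ψ x ^ 2 - 2 * c * ψ x) μ := i2.sub (i1.const_mul _)
  rw [e, integral_add i3 (integrable_const _), integral_sub i2 (i1.const_mul _),
    integral_const_mul, integral_const]
  have : ∫ z, ψ z ∂μ = c := rfl
  rw [this]
  simp only [probReal_univ, one_smul]
  nlinarith [sq_nonneg c]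

/-- Second-moment bound for the error in replacing a quadratic form by a linear statistic. -/
theorem integral_sq_quadratic_sub_linear_le {H : 𝓧 → 𝓧 → ℝ} (hH : Measurable (Function.uncurry H))
    {B : ℝ} (hB : ∀ x y, |H x y| ≤ B) (hsym : ∀ x y, H x y = H y x)
    {f : 𝓧 → ℝ} (hf : Measurable f) {M : ℝ} (hM : ∀ x, |f x| ≤ M)
    (D : ι → ι → ℝ) (hD0 : ∀ j, D j j = 0) {a b τ : ℝ} (hD : ∀ j k, |D j k| ≤ a)
    (hδ : ∀ j, |∑ k, (D j k + D k j) - τ| ≤ b) :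
    ∫ y, (∑ j, ∑ k, D j k * H (y j) (y k) - (∑ j, ∑ k, D j k) * ∫ x, ∫ z, H x z ∂ν ∂ν -
        τ * ∑ j, (f (y j) - ∫ x, f x ∂ν)) ^ 2 ∂(Measure.pi fun _ : ι => ν) ≤
      (64 * a ^ 2 * (Fintype.card ι) ^ 2 + 4 * b ^ 2 * Fintype.card ι) *
          (∫ x, ∫ z, H x z ^ 2 ∂ν ∂ν) +
        4 * τ ^ 2 * Fintype.card ι * ∫ x, (∫ z, H x z ∂ν - f x) ^ 2 ∂ν := by
  -- Hoeffding projection: `H x z = q x z + g x + g z - θ`, with `q` integrating to zero in each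
  -- argument. The target `f` replaces `g` at the cost of the smoothing error, and `τ` replaces the
  -- row plus column sums at the cost `b`.
  set g : 𝓧 → ℝ := fun x => ∫ z, H x z ∂ν with hg
  set θ := ∫ x, g x ∂ν with hθ
  set Q := ∫ x, ∫ z, H x z ^ 2 ∂ν ∂ν with hQ
  set m := ∫ x, f x ∂ν with hm
  have hHx : ∀ x, Measurable (H x) := fun x => hH.comp measurable_prodMk_left
  have hHi : ∀ x, Integrable (H x) ν := fun x => integrable_of_abs_le (hHx x) (hB x)
  have hgm : Measurable g := (hH.stronglyMeasurable.integral_prod_right (ν := ν)).measurable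
  have hgB : ∀ x, |g x| ≤ B := fun x => abs_integral_le_of_abs_le (hB x)
  have hθB : |θ| ≤ B := abs_integral_le_of_abs_le hgB
  have hgi : Integrable g ν := integrable_of_abs_le hgm hgB
  have hH2 : ∀ x y, |H x y ^ 2| ≤ B ^ 2 := fun x y => by
    rw [abs_pow]; exact pow_le_pow_left₀ (abs_nonneg _) (hB x y) 2
  have hH2i : ∀ x, Integrable (fun z => H x z ^ 2) ν := fun x =>
    integrable_of_abs_le ((hHx x).pow_const 2) (hH2 x)
  have hH2m : Measurable fun x => ∫ z, H x z ^ 2 ∂ν :=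
    ((hH.pow_const 2).stronglyMeasurable.integral_prod_right (ν := ν)).measurable
  have hH2g : Integrable (fun x => ∫ z, H x z ^ 2 ∂ν) ν :=
    integrable_of_abs_le hH2m fun x => abs_integral_le_of_abs_le (hH2 x)
  have hg2i : Integrable (fun x => g x ^ 2) ν :=
    integrable_of_abs_le (hgm.pow_const 2) (B := B ^ 2) fun x => by
      rw [abs_pow]; exact pow_le_pow_left₀ (abs_nonneg _) (hgB x) 2
  have hgQ : ∫ x, g x ^ 2 ∂ν ≤ Q :=
    integral_mono hg2i hH2g fun x => sq_integral_le (hHi x) (hH2i x)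
  have hθQ : θ ^ 2 ≤ Q := (sq_integral_le hgi hg2i).trans hgQ
  -- the degenerate part
  set q : 𝓧 → 𝓧 → ℝ := fun x z => H x z - g x - g z + θ with hq
  have hqm : Measurable (Function.uncurry q) :=
    ((hH.sub (hgm.comp measurable_fst)).sub (hgm.comp measurable_snd)).add_const θ
  have hqB : ∀ x y, |q x y| ≤ 4 * B := fun x y => by
    have h1 := abs_le.1 (hB x y)
    have h2 := abs_le.1 (hgB x)
    have h3 := abs_le.1 (hgB y)
    have h4 := abs_le.1 hθB
    simp only [hq]
    rw [abs_le]; constructor <;> linarith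
  have hqsym : ∀ x y, q x y = q y x := fun x y => by simp only [hq, hsym x y]; ring
  have hq0 : ∀ x, ∫ z, q x z ∂ν = 0 := fun x => by
    have i1 : Integrable (fun z => H x z - g x) ν := (hHi x).sub (integrable_const _)
    have i2 : Integrable (fun z => H x z - g x - g z) ν := i1.sub hgi
    simp only [hq]
    rw [integral_add i2 (integrable_const _), integral_sub i1 hgi,
      integral_sub (hHi x) (integrable_const _)]
    simp [hg, hθ]
  -- The factor 16 comes from `(a - b - c + d)² ≤ 4 (a² + b² + c² + d²)`, each of the four second
  -- moments being at most `Q` by Jensen.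
  have hqQ : ∫ x, ∫ z, q x z ^ 2 ∂ν ∂ν ≤ 16 * Q := by
    have hin : ∀ x, ∫ z, q x z ^ 2 ∂ν ≤
        4 * (∫ z, H x z ^ 2 ∂ν) + 4 * g x ^ 2 + (4 * (∫ z, g z ^ 2 ∂ν) + 4 * θ ^ 2) := by
      intro x
      have e : 4 * (∫ z, H x z ^ 2 ∂ν) + 4 * g x ^ 2 + (4 * (∫ z, g z ^ 2 ∂ν) + 4 * θ ^ 2) =
          ∫ z, ((4 * H x z ^ 2 + 4 * g x ^ 2) + (4 * g z ^ 2 + 4 * θ ^ 2)) ∂ν := by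
        have i1 : Integrable (fun z => 4 * H x z ^ 2 + 4 * g x ^ 2) ν :=
          ((hH2i x).const_mul 4).add (integrable_const _)
        have i2 : Integrable (fun z => 4 * g z ^ 2 + 4 * θ ^ 2) ν :=
          (hg2i.const_mul 4).add (integrable_const _)
        rw [integral_add i1 i2, integral_add ((hH2i x).const_mul 4) (integrable_const _),
          integral_add (hg2i.const_mul 4) (integrable_const _)]
        simp [integral_const_mul]
      rw [e]
      refine integral_mono_of_nonneg (ae_of_all _ fun z => sq_nonneg _)
        ((((hH2i x).const_mul 4).add (integrable_const _)).add
          ((hg2i.const_mul 4).add (integrable_const _))) (ae_of_all _ fun z => ?_)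
      simp only [hq]
      nlinarith [sq_nonneg (H x z + g x), sq_nonneg (H x z + g z), sq_nonneg (H x z - θ),
        sq_nonneg (g x - g z), sq_nonneg (g x + θ), sq_nonneg (g z + θ)]
    have i3 : Integrable (fun x => 4 * (∫ z, H x z ^ 2 ∂ν) + 4 * g x ^ 2) ν :=
      (hH2g.const_mul 4).add (hg2i.const_mul 4)
    refine (integral_mono_of_nonneg (ae_of_all _ fun x => integral_nonneg fun z => sq_nonneg _)
      (i3.add (integrable_const (4 * (∫ z, g z ^ 2 ∂ν) + 4 * θ ^ 2))) (ae_of_all _ hin)).trans ?_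
    simp only [Pi.add_apply]
    rw [integral_add i3 (integrable_const _),
      integral_add (hH2g.const_mul 4) (hg2i.const_mul 4), integral_const_mul, integral_const_mul]
    simp only [integral_const, probReal_univ, one_smul]
    linarith
  -- the linear part
  set δ : ι → ℝ := fun j => ∑ k, (D j k + D k j) with hδd
  set ψ : ι → 𝓧 → ℝ := fun j x => δ j * g x - τ * f x with hψ
  have hψm : ∀ j, Measurable (ψ j) := fun j => (hgm.const_mul _).sub (hf.const_mul _)
  have hψB : ∀ j x, |ψ j x| ≤ (|τ| + b) * B + |τ| * M := fun j x => by
    have h1 : |δ j| ≤ |τ| + b := by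
      have := hδ j
      have := abs_sub_abs_le_abs_sub (δ j) τ
      linarith
    simp only [hψ]
    refine (abs_sub _ _).trans ?_
    rw [abs_mul, abs_mul]
    have := hgB x
    have := hM x
    have := (abs_nonneg _).trans h1
    gcongr
  have hψint : ∀ j, ∫ x, ψ j x ∂ν = δ j * θ - τ * m := fun j => by
    simp only [hψ]
    rw [integral_sub (hgi.const_mul _) ((integrable_of_abs_le hf hM).const_mul _),
      integral_const_mul, integral_const_mul]
  have hfg : Integrable (fun x => (g x - f x) ^ 2) ν := by
    refine integrable_of_abs_le ((hgm.sub hf).pow_const 2) (B := (B + M) ^ 2) fun x => ?_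
    rw [abs_pow]
    exact pow_le_pow_left₀ (abs_nonneg _) ((abs_sub _ _).trans (add_le_add (hgB x) (hM x))) 2
  have hψ2 : ∀ j, ∫ x, ψ j x ^ 2 ∂ν ≤ 2 * τ ^ 2 * ∫ x, (g x - f x) ^ 2 ∂ν + 2 * b ^ 2 * Q := by
    intro j
    have hb2 : (δ j - τ) ^ 2 ≤ b ^ 2 := by
      rw [← sq_abs]; exact pow_le_pow_left₀ (abs_nonneg _) (hδ j) 2
    calc ∫ x, ψ j x ^ 2 ∂ν ≤ ∫ x, (2 * τ ^ 2 * (g x - f x) ^ 2 + 2 * b ^ 2 * g x ^ 2) ∂ν := by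
          refine integral_mono_of_nonneg (ae_of_all _ fun x => sq_nonneg _)
            ((hfg.const_mul _).add (hg2i.const_mul _)) (ae_of_all _ fun x => ?_)
          simp only [hψ]
          have : δ j * g x - τ * f x = τ * (g x - f x) + (δ j - τ) * g x := by ring
          rw [this]
          nlinarith [sq_nonneg (τ * (g x - f x) - (δ j - τ) * g x),
            mul_le_mul_of_nonneg_right hb2 (sq_nonneg (g x))]
      _ = 2 * τ ^ 2 * ∫ x, (g x - f x) ^ 2 ∂ν + 2 * b ^ 2 * ∫ x, g x ^ 2 ∂ν := by
          rw [integral_add (hfg.const_mul _) (hg2i.const_mul _), integral_const_mul,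
            integral_const_mul]
      _ ≤ _ := by gcongr
  have hlin : ∫ y, (∑ j, (ψ j (y j) - ∫ x, ψ j x ∂ν)) ^ 2 ∂(Measure.pi fun _ : ι => ν) ≤
      Fintype.card ι * (2 * τ ^ 2 * ∫ x, (g x - f x) ^ 2 ∂ν + 2 * b ^ 2 * Q) := by
    rw [integral_sq_sum_eval (φ := fun j x => ψ j x - ∫ x, ψ j x ∂ν)
      (B := 2 * ((|τ| + b) * B + |τ| * M)) (fun j => (hψm j).sub_const _) (fun j x => ?_)
      (fun j => ?_)]
    · refine (Finset.sum_le_card_nsmul _ _ _ fun j _ =>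
        (integral_sq_sub_mean_le (hψm j) (hψB j)).trans (hψ2 j)).trans_eq ?_
      rw [nsmul_eq_mul, Finset.card_univ]
    · refine (abs_sub _ _).trans ?_
      rw [two_mul]
      exact add_le_add (hψB j x) (abs_integral_le_of_abs_le (hψB j))
    · rw [integral_sub (integrable_of_abs_le (hψm j) (hψB j)) (integrable_const _)]
      simp
  -- the decomposition
  have hdec : ∀ y : ι → 𝓧, ∑ j, ∑ k, D j k * H (y j) (y k) - (∑ j, ∑ k, D j k) * θ -
      τ * ∑ j, (f (y j) - m) =
      ∑ j, ∑ k, D j k * q (y j) (y k) + ∑ j, (ψ j (y j) - ∫ x, ψ j x ∂ν) := by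
    intro y
    have e1 : ∑ j, (ψ j (y j) - ∫ x, ψ j x ∂ν) =
        ∑ j, δ j * (g (y j) - θ) - τ * ∑ j, (f (y j) - m) := by
      rw [Finset.mul_sum, ← Finset.sum_sub_distrib]
      refine Finset.sum_congr rfl fun j _ => ?_
      rw [hψint]; simp only [hψ]; ring
    have e2 : ∑ j, δ j * (g (y j) - θ) =
        ∑ j, ∑ k, D j k * (g (y j) - θ) + ∑ j, ∑ k, D j k * (g (y k) - θ) := by
      have : ∑ j, ∑ k, D j k * (g (y k) - θ) = ∑ j, ∑ k, D k j * (g (y j) - θ) :=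
        Finset.sum_comm
      rw [this, ← Finset.sum_add_distrib]
      refine Finset.sum_congr rfl fun j _ => ?_
      simp only [hδd]
      rw [Finset.sum_mul, ← Finset.sum_add_distrib]
      refine Finset.sum_congr rfl fun k _ => ?_
      ring
    rw [e1, e2]
    have e3 : ∑ j, ∑ k, D j k * H (y j) (y k) = ∑ j, ∑ k, D j k * q (y j) (y k) +
        (∑ j, ∑ k, D j k * (g (y j) - θ) + ∑ j, ∑ k, D j k * (g (y k) - θ)) +
        (∑ j, ∑ k, D j k) * θ := by
      simp only [Finset.sum_mul, ← Finset.sum_add_distrib]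
      refine Finset.sum_congr rfl fun j _ => Finset.sum_congr rfl fun k _ => ?_
      simp only [hq]; ring
    rw [e3]; ring
  simp_rw [hdec]
  have hquad := integral_sq_degenerate_le hqm hqB hqsym hq0 D hD0 hD
  have hm1 : Measurable fun y : ι → 𝓧 => ∑ j, ∑ k, D j k * q (y j) (y k) :=
    Finset.measurable_sum _ fun j _ => Finset.measurable_sum _ fun k _ =>
      (measurable_eval_pair hqm j k).const_mul _
  have hm2 : Measurable fun y : ι → 𝓧 => ∑ j, (ψ j (y j) - ∫ x, ψ j x ∂ν) :=
    Finset.measurable_sum _ fun j _ => ((hψm j).comp (measurable_pi_apply j)).sub_const _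
  have hb1 : ∀ y : ι → 𝓧, |∑ j, ∑ k, D j k * q (y j) (y k)| ≤
      ∑ _j : ι, ∑ _k : ι, a * (4 * B) := fun y => by
    refine (Finset.abs_sum_le_sum_abs _ _).trans (Finset.sum_le_sum fun j _ =>
      (Finset.abs_sum_le_sum_abs _ _).trans (Finset.sum_le_sum fun k _ => ?_))
    rw [abs_mul]
    exact mul_le_mul (hD _ _) (hqB _ _) (abs_nonneg _) ((abs_nonneg _).trans (hD j k))
  have hb2 : ∀ y : ι → 𝓧, |∑ j, (ψ j (y j) - ∫ x, ψ j x ∂ν)| ≤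
      ∑ _j : ι, 2 * ((|τ| + b) * B + |τ| * M) := fun y => by
    refine (Finset.abs_sum_le_sum_abs _ _).trans (Finset.sum_le_sum fun j _ => ?_)
    refine (abs_sub _ _).trans ?_
    rw [two_mul]
    exact add_le_add (hψB j _) (abs_integral_le_of_abs_le (hψB j))
  have hi1 : Integrable (fun y : ι → 𝓧 => (∑ j, ∑ k, D j k * q (y j) (y k)) ^ 2)
      (Measure.pi fun _ : ι => ν) :=
    integrable_of_abs_le (hm1.pow_const 2) fun y => by
      rw [abs_pow]; exact pow_le_pow_left₀ (abs_nonneg _) (hb1 y) 2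
  have hi2 : Integrable (fun y : ι → 𝓧 => (∑ j, (ψ j (y j) - ∫ x, ψ j x ∂ν)) ^ 2)
      (Measure.pi fun _ : ι => ν) :=
    integrable_of_abs_le (hm2.pow_const 2) fun y => by
      rw [abs_pow]; exact pow_le_pow_left₀ (abs_nonneg _) (hb2 y) 2
  calc _ ≤ ∫ y, (2 * (∑ j, ∑ k, D j k * q (y j) (y k)) ^ 2 +
        2 * (∑ j, (ψ j (y j) - ∫ x, ψ j x ∂ν)) ^ 2) ∂(Measure.pi fun _ : ι => ν) := by
        refine integral_mono_of_nonneg (ae_of_all _ fun y => sq_nonneg _)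
          ((hi1.const_mul 2).add (hi2.const_mul 2)) (ae_of_all _ fun y => ?_)
        simp only
        nlinarith [sq_nonneg (∑ j, ∑ k, D j k * q (y j) (y k) -
          ∑ j, (ψ j (y j) - ∫ x, ψ j x ∂ν))]
    _ = 2 * (∫ y, (∑ j, ∑ k, D j k * q (y j) (y k)) ^ 2 ∂(Measure.pi fun _ : ι => ν)) +
        2 * ∫ y, (∑ j, (ψ j (y j) - ∫ x, ψ j x ∂ν)) ^ 2 ∂(Measure.pi fun _ : ι => ν) := by
        rw [integral_add (hi1.const_mul 2) (hi2.const_mul 2), integral_const_mul,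
          integral_const_mul]
    _ ≤ 2 * (2 * a ^ 2 * (Fintype.card ι) ^ 2 * (16 * Q)) +
        2 * (Fintype.card ι * (2 * τ ^ 2 * ∫ x, (g x - f x) ^ 2 ∂ν + 2 * b ^ 2 * Q)) := by
        gcongr
        exact hquad.trans (by gcongr)
    _ = _ := by ring

end Hoeffding

end AvgDensity

end

noncomputable section

namespace AvgDensity

/-! ### A uniform central limit theorem for bounded variables -/

/-- The distribution function of the centered normal law with variance `v`. -/
def normalCdf (v : ℝ≥0) (t : ℝ) : ℝ := (gaussianReal 0 v).real (Set.Iic t)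

theorem normalCdf_mono (v : ℝ≥0) : Monotone (normalCdf v) := fun _ _ h =>
  measureReal_mono (Set.Iic_subset_Iic.2 h)

theorem normalCdf_nonneg (v : ℝ≥0) (t : ℝ) : 0 ≤ normalCdf v t := measureReal_nonneg

theorem normalCdf_le_one (v : ℝ≥0) (t : ℝ) : normalCdf v t ≤ 1 := measureReal_le_one

theorem normalCdf_lipschitz {v : ℝ≥0} (hv : v ≠ 0) {x y : ℝ} (hxy : x ≤ y) :
    normalCdf v y ≤ normalCdf v x + (√(2 * Real.pi * v))⁻¹ * (y - x) := by
  have hd : Set.Iic y = Set.Iic x ∪ Set.Ioc x y := (Set.Iic_union_Ioc_eq_Iic hxy).symm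
  have hI : (gaussianReal 0 v).real (Set.Ioc x y) ≤ (√(2 * Real.pi * v))⁻¹ * (y - x) := by
    have hC : 0 ≤ (√(2 * Real.pi * v))⁻¹ := by positivity
    have h1 : gaussianReal 0 v (Set.Ioc x y) ≤ ENNReal.ofReal ((√(2 * Real.pi * v))⁻¹ * (y - x)) := by
      rw [gaussianReal_apply 0 hv]
      calc ∫⁻ t in Set.Ioc x y, gaussianPDF 0 v t
          ≤ ∫⁻ _ in Set.Ioc x y, ENNReal.ofReal (√(2 * Real.pi * v))⁻¹ := by
            refine lintegral_mono fun t => ENNReal.ofReal_le_ofReal ?_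
            rw [gaussianPDFReal]
            refine mul_le_of_le_one_right hC (Real.exp_le_one_iff.2 ?_)
            rw [neg_div, neg_nonpos]
            positivity
        _ = _ := by
            rw [setLIntegral_const, Real.volume_Ioc, ENNReal.ofReal_mul hC]
    rw [Measure.real]
    exact ENNReal.toReal_le_of_le_ofReal (mul_nonneg hC (sub_nonneg.2 hxy)) h1
  rw [normalCdf, hd]
  exact (measureReal_union_le _ _).trans (add_le_add le_rfl hI)

theorem normalCdf_eq_cdf (v : ℝ≥0) : normalCdf v = cdf (gaussianReal 0 v) := by
  ext t; rw [cdf_eq_real]; rfl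

/-- Pólya's theorem: pointwise convergence of distribution functions to a normal one is uniform. -/
theorem eventually_forall_abs_sub_normalCdf_le {v : ℝ≥0} (hv : v ≠ 0) {F : ℕ → ℝ → ℝ}
    (hF : ∀ k, Monotone (F k)) (h0 : ∀ k t, 0 ≤ F k t) (h1 : ∀ k t, F k t ≤ 1)
    (hlim : ∀ t, Tendsto (fun k => F k t) atTop (𝓝 (normalCdf v t))) {ε : ℝ} (hε : 0 < ε) :
    ∀ᶠ k in atTop, ∀ t, |F k t - normalCdf v t| ≤ ε := by
  set L := (√(2 * Real.pi * v))⁻¹ with hL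
  have hL0 : 0 < L := by
    have : (0 : ℝ) < v := by exact_mod_cast pos_iff_ne_zero.2 hv
    positivity
  obtain ⟨a, ha⟩ : ∃ a, normalCdf v a ≤ ε / 4 := by
    have := (tendsto_cdf_atBot (gaussianReal 0 v)).eventually_le_const
      (show (0 : ℝ) < ε / 4 by positivity)
    rw [← normalCdf_eq_cdf] at this
    exact this.exists
  obtain ⟨b, hb, hab⟩ : ∃ b, 1 - ε / 4 ≤ normalCdf v b ∧ a ≤ b := by
    have := (tendsto_cdf_atTop (gaussianReal 0 v)).eventually_const_le
      (show 1 - ε / 4 < 1 by linarith)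
    rw [← normalCdf_eq_cdf] at this
    exact (this.and (eventually_ge_atTop a)).exists
  -- Grid mesh on which the limit increases by at most `ε / 4` per cell. Finitely many grid points
  -- cover `[a, b]`; outside it the limit is within `ε / 4` of `0` or `1`, and monotonicity controls
  -- `F k`.
  set η := ε / (4 * L) with hη
  have hη0 : 0 < η := by positivity
  have hLη : L * η = ε / 4 := by rw [hη]; field_simp
  set N := ⌈(b - a) / η⌉₊ with hN
  have hNb : b ≤ a + N * η := by
    have := Nat.le_ceil ((b - a) / η)
    rw [div_le_iff₀ hη0] at this
    linarith
  have hgrid : ∀ᶠ k in atTop, ∀ i ∈ Finset.range (N + 1),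
      |F k (a + i * η) - normalCdf v (a + i * η)| ≤ ε / 4 := by
    rw [Filter.eventually_all_finset]
    intro i _
    have := (hlim (a + i * η)).sub_const (normalCdf v (a + i * η))
    rw [sub_self] at this
    have := this.abs
    rw [abs_zero] at this
    exact this.eventually_le_const (by positivity)
  filter_upwards [hgrid] with k hk t
  rw [abs_le]
  have hk' : ∀ i : ℕ, i ≤ N → |F k (a + i * η) - normalCdf v (a + i * η)| ≤ ε / 4 := fun i hi =>
    hk i (Finset.mem_range.2 (Nat.lt_succ_of_le hi))
  rcases lt_or_ge t a with hta | hta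
  · have e0 := abs_le.1 (hk' 0 (Nat.zero_le _))
    simp only [Nat.cast_zero, zero_mul, add_zero] at e0
    have e1 := hF k hta.le
    have e2 := normalCdf_mono v hta.le
    have e3 := normalCdf_nonneg v t
    have e4 := h0 k t
    constructor <;> linarith
  rcases le_or_gt (a + N * η) t with htN | htN
  · have e0 := abs_le.1 (hk' N le_rfl)
    have e1 := hF k htN
    have e2 := normalCdf_mono v htN
    have e3 := normalCdf_le_one v t
    have e4 := h1 k t
    have e5 := normalCdf_mono v hNb
    constructor <;> linarith
  · set i := ⌊(t - a) / η⌋₊ with hi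
    have hta' : 0 ≤ (t - a) / η := div_nonneg (by linarith) hη0.le
    have i1 : a + i * η ≤ t := by
      have := Nat.floor_le hta'
      rw [le_div_iff₀ hη0] at this
      linarith
    have i2 : t ≤ a + (i + 1 : ℕ) * η := by
      have := (Nat.lt_floor_add_one ((t - a) / η)).le
      rw [div_le_iff₀ hη0] at this
      push_cast; linarith
    have i3 : i + 1 ≤ N := by
      have : (i : ℝ) < N := by
        have : i * η < N * η := by linarith
        exact lt_of_mul_lt_mul_right this hη0.le
      exact_mod_cast this
    have e1 := abs_le.1 (hk' i (by omega))
    have e2 := abs_le.1 (hk' (i + 1) i3)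
    have e3 := hF k i1
    have e4 := hF k i2
    have e5 := normalCdf_lipschitz hv i1
    have e6 := normalCdf_lipschitz hv i2
    have e7 : L * (t - (a + i * η)) ≤ ε / 4 := by
      rw [← hLη]; refine mul_le_mul_of_nonneg_left ?_ hL0.le
      push_cast at i2; linarith
    have e8 : L * (a + (i + 1 : ℕ) * η - t) ≤ ε / 4 := by
      rw [← hLη]; refine mul_le_mul_of_nonneg_left ?_ hL0.le
      push_cast; linarith
    have e9 := normalCdf_mono v i1
    have e10 := normalCdf_mono v i2
    constructor <;> linarith

/-! ### Characteristic functions of normalized sums -/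

theorem norm_pow_sub_pow_le {z w : ℂ} (hz : ‖z‖ ≤ 1) (hw : ‖w‖ ≤ 1) (n : ℕ) :
    ‖z ^ n - w ^ n‖ ≤ n * ‖z - w‖ := by
  induction n with
  | zero => simp
  | succ n ih =>
    have e : z ^ (n + 1) - w ^ (n + 1) = z ^ n * (z - w) + (z ^ n - w ^ n) * w := by ring
    rw [e]
    refine (norm_add_le _ _).trans ?_
    rw [norm_mul, norm_mul, norm_pow]
    have h1 : ‖z‖ ^ n ≤ 1 := pow_le_one₀ (norm_nonneg _) hz
    have h2 : ‖z‖ ^ n * ‖z - w‖ ≤ 1 * ‖z - w‖ := by gcongr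
    have h3 : ‖z ^ n - w ^ n‖ * ‖w‖ ≤ n * ‖z - w‖ * 1 := by gcongr
    push_cast
    linarith

theorem norm_exp_I_sub_le {x : ℝ} (hx : |x| ≤ 1) :
    ‖Complex.exp (x * Complex.I) - (1 + x * Complex.I - (x ^ 2 / 2 : ℝ))‖ ≤ |x| ^ 3 := by
  have h := Complex.exp_bound (x := x * Complex.I) (by simpa using hx) (n := 3) (by norm_num)
  have e : ∑ m ∈ Finset.range 3, ((x : ℂ) * Complex.I) ^ m / (m.factorial : ℂ) =
      1 + x * Complex.I - (x ^ 2 / 2 : ℝ) := by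
    simp only [Finset.sum_range_succ, Finset.sum_range_zero, pow_zero, pow_one, mul_pow,
      Complex.I_sq, Nat.factorial]
    push_cast; ring
  rw [e] at h
  refine h.trans ?_
  rw [norm_mul, Complex.norm_I, mul_one, Complex.norm_real, Real.norm_eq_abs]
  refine mul_le_of_le_one_right (by positivity) ?_
  norm_num [Nat.factorial]

/-- Both terms are `n`-th powers of numbers of modulus at most one, so the error is at most `n`
times the error of one factor, which a third-order expansion controls. The law enters only through
the bound `B` and the second moment, and this yields uniformity over laws. -/
theorem norm_integral_exp_pow_sub_le {α : Type*} [MeasurableSpace α] {μ : Measure α}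
    [IsProbabilityMeasure μ] {ψ : α → ℝ} (hψ : Measurable ψ) {B : ℝ} (hB : ∀ x, |ψ x| ≤ B)
    (h0 : ∫ x, ψ x ∂μ = 0) {v t : ℝ} (hv : 0 ≤ v) {n : ℕ} (hn : 0 < n) (h1 : B * |t| ≤ √n)
    (h2 : v * t ^ 2 ≤ n) :
    ‖(∫ x, Complex.exp (((√n)⁻¹ * t * ψ x : ℝ) * Complex.I) ∂μ) ^ n -
      Complex.exp (-(v * t ^ 2 / 2 : ℝ))‖ ≤
      B ^ 3 * |t| ^ 3 / √n + |∫ x, ψ x ^ 2 ∂μ - v| * t ^ 2 / 2 + v ^ 2 * t ^ 4 / n := by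
  have hn' : (0 : ℝ) < n := by exact_mod_cast hn
  have hs : 0 < √(n : ℝ) := Real.sqrt_pos.2 hn'
  have hss : √(n : ℝ) ^ 2 = n := Real.sq_sqrt hn'.le
  have hμ : (μ Set.univ).toReal = 1 := by simp
  obtain ⟨x₀⟩ : Nonempty α := μ.nonempty_of_neZero
  have hB0 : 0 ≤ B := (abs_nonneg _).trans (hB x₀)
  set u := (√(n : ℝ))⁻¹ * t with hu
  have hu2 : u ^ 2 = t ^ 2 / n := by rw [hu, mul_pow, inv_pow, hss]; field_simp
  have huB : ∀ x, |u * ψ x| ≤ 1 := fun x => by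
    rw [hu, abs_mul, abs_mul, abs_of_pos (inv_pos.2 hs), mul_assoc, inv_mul_le_iff₀ hs, mul_one]
    refine le_trans ?_ h1
    rw [mul_comm]
    exact mul_le_mul_of_nonneg_right (hB x) (abs_nonneg _)
  set z := ∫ x, Complex.exp ((u * ψ x : ℝ) * Complex.I) ∂μ with hz
  set w := Complex.exp (-(v * u ^ 2 / 2 : ℝ)) with hw
  have hwn : Complex.exp (-(v * t ^ 2 / 2 : ℝ)) = w ^ n := by
    rw [hw, ← Complex.exp_nat_mul, hu2]
    congr 1
    have hnC : (n : ℂ) ≠ 0 := by exact_mod_cast hn.ne'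
    push_cast; field_simp
  have hz1 : ‖z‖ ≤ 1 := by
    refine (norm_integral_le_of_norm_le_const (C := 1) (ae_of_all _ fun x => ?_)).trans (by simp)
    rw [Complex.norm_exp_ofReal_mul_I]
  have hw1 : ‖w‖ ≤ 1 := by
    rw [hw, ← Complex.ofReal_neg, Complex.norm_exp_ofReal, Real.exp_le_one_iff]
    have : 0 ≤ v * u ^ 2 / 2 := by positivity
    linarith
  have iψ : Integrable ψ μ := integrable_of_abs_le hψ hB
  have iψ2 : Integrable (fun x => ψ x ^ 2) μ := integrable_of_abs_le (hψ.pow_const 2) (B := B ^ 2)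
    fun x => by rw [abs_pow]; exact pow_le_pow_left₀ (abs_nonneg _) (hB x) 2
  set V := ∫ x, ψ x ^ 2 ∂μ with hV
  have hzb : ‖z - (1 - (u ^ 2 * V / 2 : ℝ))‖ ≤ B ^ 3 * |u| ^ 3 := by
    have i1 : Integrable (fun x => Complex.exp ((u * ψ x : ℝ) * Complex.I)) μ := by
      refine Integrable.of_bound (by fun_prop : Measurable _).aestronglyMeasurable 1
        (ae_of_all _ fun x => ?_)
      rw [Complex.norm_exp_ofReal_mul_I]
    have i2 : Integrable (fun x => ((u * ψ x : ℝ) : ℂ) * Complex.I) μ :=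
      ((iψ.const_mul u).ofReal).mul_const _
    have i3 : Integrable (fun x => (((u * ψ x) ^ 2 / 2 : ℝ) : ℂ)) μ := by
      have : Integrable (fun x => (u * ψ x) ^ 2 / 2) μ := by
        simp_rw [mul_pow]; exact (iψ2.const_mul _).div_const 2
      exact this.ofReal
    have i4 : Integrable (fun x => (1 : ℂ) + ((u * ψ x : ℝ) : ℂ) * Complex.I) μ :=
      (integrable_const _).add i2
    have i5 : Integrable (fun x => (1 : ℂ) + ((u * ψ x : ℝ) : ℂ) * Complex.I -
      (((u * ψ x) ^ 2 / 2 : ℝ) : ℂ)) μ := i4.sub i3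
    have e : (1 - (u ^ 2 * V / 2 : ℝ) : ℂ) = ∫ x, ((1 : ℂ) + ((u * ψ x : ℝ) : ℂ) * Complex.I -
        (((u * ψ x) ^ 2 / 2 : ℝ) : ℂ)) ∂μ := by
      rw [integral_sub i4 i3, integral_add (integrable_const _) i2, integral_mul_const,
        integral_complex_ofReal, integral_complex_ofReal, integral_const_mul, h0, integral_div]
      simp_rw [mul_pow]
      rw [integral_const_mul]
      simp [hV]
    rw [e, hz, ← integral_sub i1 i5]
    refine (norm_integral_le_of_norm_le_const (C := B ^ 3 * |u| ^ 3)
      (ae_of_all _ fun x => ?_)).trans (by simp)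
    refine (norm_exp_I_sub_le (huB x)).trans ?_
    rw [abs_mul, mul_pow, mul_comm]
    have := hB x
    gcongr
  have hwb : ‖w - (1 - (v * u ^ 2 / 2 : ℝ))‖ ≤ (v * u ^ 2 / 2) ^ 2 := by
    have h0' : 0 ≤ v * u ^ 2 / 2 := by positivity
    have := Complex.norm_exp_sub_one_sub_id_le (x := -(v * u ^ 2 / 2 : ℝ)) (by
      rw [norm_neg, Complex.norm_real, Real.norm_eq_abs, abs_of_nonneg h0', hu2]
      have : v * (t ^ 2 / n) ≤ 1 := by
        rw [← mul_div_assoc, div_le_one hn']; exact h2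
      linarith)
    rw [norm_neg, Complex.norm_real, Real.norm_eq_abs, abs_of_nonneg h0'] at this
    convert this using 2
    ring
  have hzw : ‖z - w‖ ≤ B ^ 3 * |u| ^ 3 + |V - v| * u ^ 2 / 2 + (v * u ^ 2 / 2) ^ 2 := by
    have e : z - w = (z - (1 - (u ^ 2 * V / 2 : ℝ))) - (w - (1 - (v * u ^ 2 / 2 : ℝ))) +
        ((-((V - v) * u ^ 2 / 2) : ℝ) : ℂ) := by push_cast; ring
    rw [e]
    refine (norm_add_le _ _).trans ?_
    have h3 : ‖((-((V - v) * u ^ 2 / 2) : ℝ) : ℂ)‖ = |V - v| * u ^ 2 / 2 := by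
      rw [Complex.norm_real, Real.norm_eq_abs, abs_neg, abs_div, abs_mul, abs_two,
        abs_of_nonneg (sq_nonneg u)]
    have h4 := norm_sub_le (z - (1 - (u ^ 2 * V / 2 : ℝ))) (w - (1 - (v * u ^ 2 / 2 : ℝ)))
    linarith
  rw [hwn]
  refine (norm_pow_sub_pow_le hz1 hw1 n).trans ?_
  refine (mul_le_mul_of_nonneg_left hzw hn'.le).trans ?_
  have e1 : n * |u| ^ 3 = |t| ^ 3 / √n := by
    rw [hu, abs_mul, abs_of_pos (inv_pos.2 hs), mul_pow]
    nth_rewrite 1 [← hss]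
    field_simp
  have e2 : n * u ^ 2 = t ^ 2 := by rw [hu2]; field_simp
  have e3 : n * (v * u ^ 2 / 2) ^ 2 = v ^ 2 * t ^ 4 / n / 4 := by
    rw [hu2]; field_simp; ring
  have e4 : 0 ≤ v ^ 2 * t ^ 4 / n := by positivity
  calc n * (B ^ 3 * |u| ^ 3 + |V - v| * u ^ 2 / 2 + (v * u ^ 2 / 2) ^ 2)
      = B ^ 3 * (n * |u| ^ 3) + |V - v| * (n * u ^ 2) / 2 + n * (v * u ^ 2 / 2) ^ 2 := by ring
    _ ≤ _ := by
      rw [e1, e2, e3, ← mul_div_assoc]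
      linarith

/-- The standardized linear statistic `2 n^{-1/2} ∑ᵢ (f(yᵢ) - ν f)`. -/
def linStat {n : ℕ} {𝓧 : Type*} [MeasurableSpace 𝓧] (f : 𝓧 → ℝ) (ν : Measure 𝓧)
    (y : Fin n → 𝓧) : ℝ :=
  2 / √(n : ℝ) * ∑ i, (f (y i) - ∫ x, f x ∂ν)

theorem measurable_linStat {n : ℕ} {𝓧 : Type*} [MeasurableSpace 𝓧] {f : 𝓧 → ℝ} (hf : Measurable f)
    (ν : Measure 𝓧) : Measurable (linStat (n := n) f ν) := by
  unfold linStat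
  exact (Finset.measurable_sum _ fun i _ =>
    (hf.comp (measurable_pi_apply i)).sub_const _).const_mul _

theorem charFun_linStat {n : ℕ} {𝓧 : Type*} [MeasurableSpace 𝓧] {f : 𝓧 → ℝ} (hf : Measurable f)
    (ν : Measure 𝓧) [IsProbabilityMeasure ν] (t : ℝ) :
    charFun ((Measure.pi fun _ : Fin n => ν).map (linStat f ν)) t =
      (∫ x, Complex.exp (((√(n : ℝ))⁻¹ * t * (2 * (f x - ∫ x, f x ∂ν)) : ℝ) * Complex.I) ∂ν) ^
        n := by
  rw [charFun_apply_real, integral_map (measurable_linStat hf ν).aemeasurable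
    (by fun_prop : Measurable _).aestronglyMeasurable]
  have e : ∀ y : Fin n → 𝓧, Complex.exp (t * (linStat f ν y : ℝ) * Complex.I) =
      ∏ i, Complex.exp (((√(n : ℝ))⁻¹ * t * (2 * (f (y i) - ∫ x, f x ∂ν)) : ℝ) * Complex.I) := by
    intro y
    rw [← Complex.exp_sum, linStat, ← Finset.sum_mul]
    congr 2
    push_cast
    rw [Finset.mul_sum, Finset.mul_sum]
    refine Finset.sum_congr rfl fun i _ => ?_
    ring
  simp_rw [e]
  rw [integral_fintype_prod_eq_prod (𝕜 := ℂ) (fun _ : Fin n => fun x : 𝓧 =>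
    Complex.exp (((√(n : ℝ))⁻¹ * t * (2 * (f x - ∫ x, f x ∂ν)) : ℝ) * Complex.I))]
  simp

/-- The central limit theorem for bounded variables, uniformly in the underlying law. -/
theorem exists_forall_abs_linStat_sub_normalCdf_le {𝓧 : Type*} [MeasurableSpace 𝓧] {f : 𝓧 → ℝ}
    (hf : Measurable f) {M : ℝ} (hM : ∀ x, |f x| ≤ M) {v : ℝ≥0} (hv : v ≠ 0) {ε : ℝ} (hε : 0 < ε) :
    ∃ δ : ℝ, 0 < δ ∧ ∃ N : ℕ, ∀ n ≥ N, ∀ (ν : Measure 𝓧) [IsProbabilityMeasure ν],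
      |(∫ x, (2 * (f x - ∫ x, f x ∂ν)) ^ 2 ∂ν) - (v : ℝ)| ≤ δ → ∀ t,
        |(Measure.pi fun _ : Fin n => ν).real {y | linStat f ν y ≤ t} - normalCdf v t| ≤ ε := by
  -- If uniformity failed, there would be laws `ν k` with variances within `1/(k+1)` of `v` and
  -- sample sizes `n k ≥ k` violating the bound. Lévy's continuity theorem and Pólya's theorem along
  -- this sequence give a contradiction.
  by_contra hcon
  push Not at hcon
  choose n hn ν hν hvar t ht using fun k : ℕ => hcon (1 / ((k : ℝ) + 1)) (by positivity) k
  have hmeas := fun k => measurable_linStat (n := n k) hf (ν k)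
  let p : ℕ → ProbabilityMeasure ℝ := fun k =>
    ⟨(Measure.pi fun _ : Fin (n k) => ν k).map (linStat f (ν k)),
      Measure.isProbabilityMeasure_map (hmeas k).aemeasurable⟩
  let g : ProbabilityMeasure ℝ := ⟨gaussianReal 0 v, inferInstance⟩
  have hncast : Tendsto (fun k => (n k : ℝ)) atTop atTop :=
    tendsto_natCast_atTop_atTop.comp (tendsto_atTop_mono hn tendsto_id)
  have hsq : Tendsto (fun k => √(n k : ℝ)) atTop atTop := Real.tendsto_sqrt_atTop.comp hncast
  have hweak : Tendsto p atTop (𝓝 g) := by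
    refine ProbabilityMeasure.tendsto_of_tendsto_charFun fun s => ?_
    have e1 : charFun (g : Measure ℝ) s = Complex.exp (-(v * s ^ 2 / 2 : ℝ)) := by
      show charFun (gaussianReal 0 v) s = _
      rw [charFun_gaussianReal]
      congr 1
      push_cast; ring
    rw [e1, tendsto_iff_norm_sub_tendsto_zero]
    have hbound : Tendsto (fun k => (4 * M) ^ 3 * |s| ^ 3 / √(n k : ℝ) +
        (1 / ((k : ℝ) + 1)) * s ^ 2 / 2 + (v : ℝ) ^ 2 * s ^ 4 / (n k : ℝ)) atTop (𝓝 0) := by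
      have a1 : Tendsto (fun k => (4 * M) ^ 3 * |s| ^ 3 / √(n k : ℝ)) atTop (𝓝 0) :=
        hsq.const_div_atTop _
      have a2 : Tendsto (fun k : ℕ => (1 / ((k : ℝ) + 1)) * s ^ 2 / 2) atTop (𝓝 0) := by
        have := (tendsto_one_div_add_atTop_nhds_zero_nat (𝕜 := ℝ)).mul_const (s ^ 2)
        simpa using this.div_const 2
      have a3 : Tendsto (fun k => (v : ℝ) ^ 2 * s ^ 4 / (n k : ℝ)) atTop (𝓝 0) :=
        hncast.const_div_atTop _
      simpa using (a1.add a2).add a3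
    refine squeeze_zero' (Eventually.of_forall fun k => norm_nonneg _) ?_ hbound
    filter_upwards [hsq.eventually_ge_atTop (4 * M * |s|),
      hncast.eventually_ge_atTop ((v : ℝ) * s ^ 2), hncast.eventually_gt_atTop 0] with k k1 k2 k3
    have := hν k
    have hi : Integrable f (ν k) := integrable_of_abs_le hf hM
    have hb := norm_integral_exp_pow_sub_le (μ := ν k) (ψ := fun x => 2 * (f x - ∫ x, f x ∂(ν k)))
      ((hf.sub_const _).const_mul 2) (B := 4 * M) (fun x => by
        rw [abs_mul, abs_two]
        have h1 := abs_sub (f x) (∫ x, f x ∂(ν k))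
        have h2 := hM x
        have h3 := abs_integral_le_of_abs_le (μ := ν k) hM
        linarith)
      (by rw [integral_const_mul, integral_sub hi (integrable_const _)]; simp)
      (v := v) (t := s) v.2 (n := n k) (by exact_mod_cast k3) k1 k2
    have e2 : charFun (p k : Measure ℝ) s = (∫ x, Complex.exp (((√(n k : ℝ))⁻¹ * s *
        (2 * (f x - ∫ x, f x ∂(ν k))) : ℝ) * Complex.I) ∂(ν k)) ^ (n k) :=
      charFun_linStat hf (ν k) s
    rw [e2]
    refine hb.trans ?_
    have := hvar k
    gcongr
  have hcdf : ∀ s, Tendsto (fun k => ((p k : Measure ℝ)).real (Set.Iic s)) atTop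
      (𝓝 (normalCdf v s)) := by
    intro s
    -- A normal law with `v ≠ 0` has no atoms, so every half-line is a continuity set.
    have h1 := ProbabilityMeasure.tendsto_measure_of_null_frontier_of_tendsto' hweak
      (E := Set.Iic s) (by
        rw [frontier_Iic]
        show gaussianReal 0 v {s} = 0
        have := nullSingletonClass_gaussianReal (μ := 0) hv
        exact measure_singleton s)
    have := (ENNReal.tendsto_toReal (measure_ne_top _ _)).comp h1
    exact this
  have hpol := eventually_forall_abs_sub_normalCdf_le hv
    (F := fun k s => ((p k : Measure ℝ)).real (Set.Iic s))
    (fun k x y hxy => measureReal_mono (Set.Iic_subset_Iic.2 hxy)) (fun k s => measureReal_nonneg)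
    (fun k s => measureReal_le_one) hcdf hε
  obtain ⟨k, hk⟩ := hpol.exists
  have h1 := hk (t k)
  have h2 := ht k
  have e : ((p k : Measure ℝ)).real (Set.Iic (t k)) =
      (Measure.pi fun _ : Fin (n k) => ν k).real {y | linStat f (ν k) y ≤ t k} := by
    show ((Measure.pi fun _ : Fin (n k) => ν k).map (linStat f (ν k))).real (Set.Iic (t k)) = _
    rw [map_measureReal_apply (hmeas k) measurableSet_Iic]
    rfl
  simp only [e] at h1
  linarith

end AvgDensity

end

noncomputable section

namespace AvgDensity

/-! ### Distribution of quadratic statistics under a product law -/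

/-- The matrix `A` with its diagonal replaced by zero. -/
def offDiag {n : ℕ} (A : Fin n → Fin n → ℝ) (j k : Fin n) : ℝ := if j = k then 0 else A j k

theorem offDiag_self {n : ℕ} (A : Fin n → Fin n → ℝ) (j : Fin n) : offDiag A j j = 0 := if_pos rfl

theorem sum_eq_diag_add_offDiag {n : ℕ} (A H : Fin n → Fin n → ℝ) {H₀ : ℝ}
    (h0 : ∀ j, H j j = H₀) :
    ∑ j, ∑ k, A j k * H j k = (∑ j, A j j) * H₀ + ∑ j, ∑ k, offDiag A j k * H j k := by
  rw [Finset.sum_mul, ← Finset.sum_add_distrib]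
  refine Finset.sum_congr rfl fun j _ => ?_
  rw [← h0 j, ← Finset.add_sum_erase _ _ (Finset.mem_univ j),
    ← Finset.add_sum_erase _ (fun k => offDiag A j k * H j k) (Finset.mem_univ j),
    offDiag_self, zero_mul, zero_add]
  congr 1
  refine Finset.sum_congr rfl fun k hk => ?_
  rw [offDiag, if_neg (Finset.ne_of_mem_erase hk).symm]

/-- Slutsky's lemma with explicit error: off an event of probability `r / η²` (Chebyshev) the
remainder moves the threshold by less than `η`, which the Lipschitz normal distribution function
tolerates. The shift `b` is deterministic and may be arbitrarily large. -/
theorem abs_cdf_add_sub_normalCdf_le {α : Type*} [MeasurableSpace α] {Q : Measure α}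
    [IsProbabilityMeasure Q] {L R : α → ℝ} (hR : Integrable (fun y => R y ^ 2) Q)
    {v : ℝ≥0} (hv : v ≠ 0) {ε : ℝ}
    (hclt : ∀ t, |Q.real {y | L y ≤ t} - normalCdf v t| ≤ ε) {r : ℝ}
    (hr : ∫ y, R y ^ 2 ∂Q ≤ r) (b : ℝ) {η : ℝ} (hη : 0 < η) (t : ℝ) :
    |Q.real {y | L y + R y + b ≤ t} - normalCdf v (t - b)| ≤
      ε + r / η ^ 2 + (√(2 * Real.pi * v))⁻¹ * η := by
  have hcheb : Q.real {y | η ≤ |R y|} ≤ r / η ^ 2 := by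
    rw [le_div_iff₀ (by positivity), mul_comm]
    refine le_trans ?_ hr
    have := mul_meas_ge_le_integral_of_nonneg (μ := Q) (f := fun y => R y ^ 2)
      (ae_of_all _ fun y => sq_nonneg _) hR (η ^ 2)
    refine le_trans (le_of_eq ?_) this
    congr 2
    ext y
    simp only [Set.mem_ofPred_eq]
    rw [← sq_abs (R y), sq_le_sq₀ hη.le (abs_nonneg _)]
  have s1 : {y | L y + R y + b ≤ t} ⊆ {y | L y ≤ t - b + η} ∪ {y | η ≤ |R y|} := by
    intro y hy
    by_cases h : η ≤ |R y|
    · exact Or.inr h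
    · left
      have := (abs_lt.1 (not_le.1 h)).1
      simp only [Set.mem_ofPred_eq] at hy ⊢
      linarith
  have s2 : {y | L y ≤ t - b - η} ⊆ {y | L y + R y + b ≤ t} ∪ {y | η ≤ |R y|} := by
    intro y hy
    by_cases h : η ≤ |R y|
    · exact Or.inr h
    · left
      have := (abs_lt.1 (not_le.1 h)).2
      simp only [Set.mem_ofPred_eq] at hy ⊢
      linarith
  have m1 := (measureReal_mono (μ := Q) s1).trans (measureReal_union_le _ _)
  have m2 := (measureReal_mono (μ := Q) s2).trans (measureReal_union_le _ _)
  have c1 := abs_le.1 (hclt (t - b + η))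
  have c2 := abs_le.1 (hclt (t - b - η))
  have l1 := normalCdf_lipschitz hv (show t - b ≤ t - b + η by linarith)
  have l2 := normalCdf_lipschitz hv (show t - b - η ≤ t - b by linarith)
  rw [show t - b + η - (t - b) = η by ring] at l1
  rw [show t - b - (t - b - η) = η by ring] at l2
  rw [abs_le]
  constructor <;> linarith

variable {𝓧 : Type*} [MeasurableSpace 𝓧]

/-- The mean square of `∫ H(·, z) ν(dz) - f` under `ν`. -/
def smoothErr (ν : Measure 𝓧) (H : 𝓧 → 𝓧 → ℝ) (f : 𝓧 → ℝ) : ℝ :=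
  ∫ x, (∫ z, H x z ∂ν - f x) ^ 2 ∂ν

/-- The second moment of `H` under `ν ⊗ ν`. -/
def kernelSq (ν : Measure 𝓧) (H : 𝓧 → 𝓧 → ℝ) : ℝ := ∫ x, ∫ z, H x z ^ 2 ∂ν ∂ν

/-- The mean of `H` under `ν ⊗ ν`. -/
def kernelMean (ν : Measure 𝓧) (H : 𝓧 → 𝓧 → ℝ) : ℝ := ∫ x, ∫ z, H x z ∂ν ∂ν

theorem kernelSq_nonneg (ν : Measure 𝓧) (H : 𝓧 → 𝓧 → ℝ) : 0 ≤ kernelSq ν H :=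
  integral_nonneg fun _ => integral_nonneg fun _ => sq_nonneg _

theorem smoothErr_nonneg (ν : Measure 𝓧) (H : 𝓧 → 𝓧 → ℝ) (f : 𝓧 → ℝ) : 0 ≤ smoothErr ν H f :=
  integral_nonneg fun _ => sq_nonneg _

/-- Normal approximation of a quadratic statistic of an i.i.d. sample, with explicit error. -/
theorem abs_quadratic_cdf_sub_normalCdf_le {n : ℕ} (hn : 0 < n) {ν : Measure 𝓧}
    [IsProbabilityMeasure ν] {H : 𝓧 → 𝓧 → ℝ}
    (hH : Measurable (Function.uncurry H)) {B : ℝ} (hB : ∀ x y, |H x y| ≤ B)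
    (hsym : ∀ x y, H x y = H y x) {H₀ : ℝ} (hH0 : ∀ x, H x x = H₀)
    {f : 𝓧 → ℝ} (hf : Measurable f) {M : ℝ} (hM : ∀ x, |f x| ≤ M)
    (A : Fin n → Fin n → ℝ) {C : ℝ} (hA : ∀ j k, |A j k| ≤ C / n ^ 2)
    (hδ : ∀ j, |∑ k, (offDiag A j k + offDiag A k j) - 2 / n| ≤ C / n ^ 2)
    {T : (Fin n → 𝓧) → ℝ} {c : ℝ} (hT : ∀ y, T y = ∑ j, ∑ k, A j k * H (y j) (y k) + c)
    {v : ℝ≥0} (hv : v ≠ 0) {ε : ℝ}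
    (hclt : ∀ t, |(Measure.pi fun _ : Fin n => ν).real {y | linStat f ν y ≤ t} -
      normalCdf v t| ≤ ε) (m : ℝ) {η : ℝ} (hη : 0 < η) (t : ℝ) :
    |(Measure.pi fun _ : Fin n => ν).real {y | √(n : ℝ) * (T y - m) ≤ t} -
        normalCdf v (t - √(n : ℝ) * ((∑ j, A j j) * H₀))| ≤
      ε + (136 * C ^ 2 / n * kernelSq ν H + 32 * smoothErr ν H f +
        2 * (√(n : ℝ) * ((∑ j, ∑ k, offDiag A j k) * kernelMean ν H + c - m)) ^ 2) / η ^ 2 +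
        (√(2 * Real.pi * v))⁻¹ * η := by
  have hn' : (0 : ℝ) < n := by exact_mod_cast hn
  have hn1 : (1 : ℝ) ≤ n := by exact_mod_cast hn
  have hs : 0 < √(n : ℝ) := Real.sqrt_pos.2 hn'
  have hss : √(n : ℝ) ^ 2 = n := Real.sq_sqrt hn'.le
  obtain ⟨x₀⟩ : Nonempty 𝓧 := ν.nonempty_of_neZero
  have hC0 : 0 ≤ C / n ^ 2 := (abs_nonneg _).trans (hA ⟨0, hn⟩ ⟨0, hn⟩)
  have hC : 0 ≤ C := by
    by_contra h
    exact absurd (div_neg_of_neg_of_pos (not_le.1 h) (by positivity : (0 : ℝ) < n ^ 2))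
      (not_lt.2 hC0)
  have hoff : ∀ j k, |offDiag A j k| ≤ C / n ^ 2 := fun j k => by
    rw [offDiag]
    split_ifs
    · simpa using hC0
    · exact hA j k
  set D := offDiag A with hD
  -- The deterministic centering error of the off-diagonal part. The diagonal is kept out of it,
  -- because its contribution need not be small.
  set e := √(n : ℝ) * ((∑ j, ∑ k, D j k) * kernelMean ν H + c - m) with he
  set rem : (Fin n → 𝓧) → ℝ := fun y => ∑ j, ∑ k, D j k * H (y j) (y k) -
    (∑ j, ∑ k, D j k) * kernelMean ν H - 2 / n * ∑ j, (f (y j) - ∫ x, f x ∂ν) with hrem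
  have hbound := integral_sq_quadratic_sub_linear_le (ν := ν) hH hB hsym hf hM D
    (offDiag_self A) hoff hδ
  rw [Fintype.card_fin] at hbound
  change ∫ y, rem y ^ 2 ∂(Measure.pi fun _ : Fin n => ν) ≤ (64 * (C / n ^ 2) ^ 2 * (n : ℝ) ^ 2 +
    4 * (C / n ^ 2) ^ 2 * n) * kernelSq ν H + 4 * (2 / (n : ℝ)) ^ 2 * n * smoothErr ν H f at hbound
  have hremm : Measurable rem := by
    refine Measurable.sub (Measurable.sub_const ?_ _) (Measurable.const_mul ?_ _)
    · exact Finset.measurable_sum _ fun j _ => Finset.measurable_sum _ fun k _ =>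
        (measurable_eval_pair hH j k).const_mul _
    · exact Finset.measurable_sum _ fun j _ => (hf.comp (measurable_pi_apply j)).sub_const _
  have hremb : ∀ y, |rem y| ≤ ∑ _j : Fin n, ∑ _k : Fin n, C / n ^ 2 * B +
      |(∑ j, ∑ k, D j k) * kernelMean ν H| + 2 / n * ∑ _j : Fin n, (M + M) := by
    intro y
    refine (abs_sub _ _).trans (add_le_add ((abs_sub _ _).trans (add_le_add ?_ le_rfl)) ?_)
    · refine (Finset.abs_sum_le_sum_abs _ _).trans (Finset.sum_le_sum fun j _ =>
        (Finset.abs_sum_le_sum_abs _ _).trans (Finset.sum_le_sum fun k _ => ?_))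
      rw [abs_mul]
      exact mul_le_mul (hoff _ _) (hB _ _) (abs_nonneg _) hC0
    · rw [abs_mul, abs_of_nonneg (by positivity : (0 : ℝ) ≤ 2 / n)]
      refine mul_le_mul_of_nonneg_left ?_ (by positivity)
      refine (Finset.abs_sum_le_sum_abs _ _).trans (Finset.sum_le_sum fun j _ => ?_)
      exact (abs_sub _ _).trans (add_le_add (hM _) (abs_integral_le_of_abs_le hM))
  have hrem2 : Integrable (fun y => rem y ^ 2) (Measure.pi fun _ : Fin n => ν) :=
    integrable_of_abs_le (hremm.pow_const 2) fun y => by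
      rw [abs_pow]; exact pow_le_pow_left₀ (abs_nonneg _) (hremb y) 2
  have hRm : Integrable (fun y => (√(n : ℝ) * rem y + e) ^ 2) (Measure.pi fun _ : Fin n => ν) :=
    integrable_of_abs_le (((hremm.const_mul _).add_const _).pow_const 2)
      (B := (√(n : ℝ) * (∑ _j : Fin n, ∑ _k : Fin n, C / n ^ 2 * B +
        |(∑ j, ∑ k, D j k) * kernelMean ν H| + 2 / n * ∑ _j : Fin n, (M + M)) + |e|) ^ 2)
      fun y => by
      rw [abs_pow]
      refine pow_le_pow_left₀ (abs_nonneg _) ((abs_add_le _ _).trans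
        (add_le_add ?_ le_rfl)) 2
      rw [abs_mul, abs_of_pos hs]
      exact mul_le_mul_of_nonneg_left (hremb y) hs.le
  have hr : ∫ y, (√(n : ℝ) * rem y + e) ^ 2 ∂(Measure.pi fun _ : Fin n => ν) ≤
      136 * C ^ 2 / n * kernelSq ν H + 32 * smoothErr ν H f + 2 * e ^ 2 := by
    calc _ ≤ ∫ y, (2 * n * rem y ^ 2 + 2 * e ^ 2) ∂(Measure.pi fun _ : Fin n => ν) := by
          refine integral_mono hRm ((hrem2.const_mul _).add (integrable_const _)) fun y => ?_
          have : 2 * (n : ℝ) * rem y ^ 2 = 2 * (√(n : ℝ) * rem y) ^ 2 := by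
            rw [mul_pow, hss]; ring
          simp only [this]
          nlinarith [sq_nonneg (√(n : ℝ) * rem y - e)]
      _ = 2 * n * (∫ y, rem y ^ 2 ∂(Measure.pi fun _ : Fin n => ν)) + 2 * e ^ 2 := by
          rw [integral_add (hrem2.const_mul _) (integrable_const _), integral_const_mul]
          simp
      _ ≤ 2 * n * ((64 * (C / n ^ 2) ^ 2 * (n : ℝ) ^ 2 +
          4 * (C / n ^ 2) ^ 2 * n) * kernelSq ν H + 4 * (2 / (n : ℝ)) ^ 2 * n * smoothErr ν H f) +
          2 * e ^ 2 := by gcongr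
      _ ≤ _ := by
          -- The factor `2 n` comes from splitting the square and from the scaling by `√n`. The term
          -- with the extra `1/n` is absorbed using `n ≥ 1`, so 128 and 8 combine to 136.
          have h1 : 2 * n * ((64 * (C / n ^ 2) ^ 2 * (n : ℝ) ^ 2 +
              4 * (C / n ^ 2) ^ 2 * n) * kernelSq ν H +
              4 * (2 / (n : ℝ)) ^ 2 * n * smoothErr ν H f) =
              (128 * C ^ 2 / n + 8 * C ^ 2 / n / n) * kernelSq ν H + 32 * smoothErr ν H f := by
            field_simp
            ring
          have h2 : 8 * C ^ 2 / n / n ≤ 8 * C ^ 2 / n := div_le_self (by positivity) hn1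
          have h3 : 128 * C ^ 2 / n + 8 * C ^ 2 / n / n ≤ 136 * C ^ 2 / n := by
            have : 136 * C ^ 2 / n = 128 * C ^ 2 / n + 8 * C ^ 2 / n := by ring
            linarith
          rw [h1]
          have := mul_le_mul_of_nonneg_right h3 (kernelSq_nonneg ν H)
          linarith
  have hfin := abs_cdf_add_sub_normalCdf_le (Q := Measure.pi fun _ : Fin n => ν)
    (L := linStat f ν) hRm hv hclt hr (√(n : ℝ) * ((∑ j, A j j) * H₀)) hη t
  -- The statistic splits exactly into linear part, remainder with centering error, and diagonal
  -- shift; the factor `2 / n` times `√n` equals `2 / √n`.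
  have hset : {y : Fin n → 𝓧 | √(n : ℝ) * (T y - m) ≤ t} = {y | linStat f ν y +
      (√(n : ℝ) * rem y + e) + √(n : ℝ) * ((∑ j, A j j) * H₀) ≤ t} := by
    ext y
    simp only [Set.mem_ofPred_eq]
    have h1 := sum_eq_diag_add_offDiag A (fun j k => H (y j) (y k)) (H₀ := H₀)
      (fun j => hH0 (y j))
    have h2 : linStat f ν y = √(n : ℝ) * (2 / n * ∑ j, (f (y j) - ∫ x, f x ∂ν)) := by
      rw [linStat, ← mul_assoc]
      congr 1
      rw [mul_div_assoc', div_eq_div_iff hs.ne' hn'.ne']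
      linear_combination -2 * hss
    have h3 : √(n : ℝ) * (T y - m) = linStat f ν y +
        (√(n : ℝ) * rem y + e) + √(n : ℝ) * ((∑ j, A j j) * H₀) := by
      rw [hT, h1, h2, he, hrem]
      ring
    rw [h3]
  rw [hset]
  exact hfin

/-- Second moment of a row sum of a kernel centered in its second argument. -/
theorem integral_sq_row_le {n : ℕ} {ν : Measure 𝓧} [IsProbabilityMeasure ν] {q : 𝓧 → 𝓧 → ℝ}
    (hq : Measurable (Function.uncurry q)) {B : ℝ} (hB : ∀ x y, |q x y| ≤ B)
    (h0 : ∀ x, ∫ z, q x z ∂ν = 0) (i : Fin n) :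
    ∫ y, (∑ j ∈ Finset.univ.erase i, q (y i) (y j)) ^ 2 ∂(Measure.pi fun _ : Fin n => ν) ≤
      n * ∫ x, ∫ z, q x z ^ 2 ∂ν ∂ν := by
  have hQ0 : 0 ≤ ∫ x, ∫ z, q x z ^ 2 ∂ν ∂ν :=
    integral_nonneg fun x => integral_nonneg fun z => sq_nonneg _
  have hi : ∀ j k, Integrable (fun y : Fin n → 𝓧 => q (y i) (y j) * q (y i) (y k))
      (Measure.pi fun _ : Fin n => ν) := fun j k => by
    refine integrable_of_abs_le ((measurable_eval_pair hq i j).mul (measurable_eval_pair hq i k))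
      (B := B * B) fun y => ?_
    rw [abs_mul]
    exact mul_le_mul (hB _ _) (hB _ _) (abs_nonneg _) ((abs_nonneg _).trans (hB (y i) (y j)))
  have e : ∀ y : Fin n → 𝓧, (∑ j ∈ Finset.univ.erase i, q (y i) (y j)) ^ 2 =
      ∑ j ∈ Finset.univ.erase i, ∑ k ∈ Finset.univ.erase i, q (y i) (y j) * q (y i) (y k) :=
    fun y => by rw [sq, Finset.sum_mul_sum]
  simp_rw [e]
  rw [integral_finsetSum _ fun j _ => integrable_finsetSum _ fun k _ => hi j k]
  calc _ = ∑ j ∈ Finset.univ.erase i, ∫ x, ∫ z, q x z ^ 2 ∂ν ∂ν := by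
        refine Finset.sum_congr rfl fun j hj => ?_
        have hji := Finset.ne_of_mem_erase hj
        rw [integral_finsetSum _ fun k _ => hi j k, Finset.sum_eq_single j]
        · rw [← integral_pi_eval_pair (ν := ν) (φ := fun x z => q x z ^ 2) (B := B ^ 2)
            (hq.pow_const 2) (fun x y => by
              rw [abs_pow]; exact pow_le_pow_left₀ (abs_nonneg _) (hB x y) 2) hji.symm]
          simp_rw [sq]
        · intro k hk hkj
          have hki := Finset.ne_of_mem_erase hk
          refine integral_pi_eq_zero (hi j k) k fun y => ?_
          simp only [Function.update_self, Function.update_of_ne hkj.symm,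
            Function.update_of_ne hki.symm]
          rw [integral_const_mul, h0, mul_zero]
        · intro h; exact absurd hj h
    _ ≤ _ := by
        rw [Finset.sum_const, nsmul_eq_mul]
        refine mul_le_mul_of_nonneg_right ?_ hQ0
        have : (Finset.univ.erase i).card ≤ n := by
          simp
        exact_mod_cast this

/-! ### The empirical distribution -/

variable {d n : ℕ}

theorem isProbabilityMeasure_empirical (hn : 0 < n) (x : Fin n → E d) :
    IsProbabilityMeasure (empirical x) := by
  refine ⟨?_⟩
  have : (n : ℝ≥0∞) ≠ 0 := by exact_mod_cast hn.ne'
  rw [empirical, Measure.smul_apply, Measure.finsetSum_apply]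
  simp only [measure_univ, Finset.sum_const, Finset.card_univ, Fintype.card_fin, nsmul_eq_mul,
    mul_one, smul_eq_mul]
  exact ENNReal.inv_mul_cancel this (ENNReal.natCast_ne_top n)

theorem integral_empirical (x : Fin n → E d) (g : E d → ℝ) :
    ∫ z, g z ∂(empirical x) = (n : ℝ)⁻¹ * ∑ i, g (x i) := by
  rw [empirical, integral_smul_measure, integral_finsetSum_measure]
  · simp
  · intro i _
    exact integrable_dirac (by simp)

end AvgDensity

end

noncomputable section

namespace AvgDensity

/-! ### Moments of functionals of the empirical distribution -/

variable {d n : ℕ} {ν : Measure (E d)} [IsProbabilityMeasure ν] {H : E d → E d → ℝ}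

theorem integral_sq_mean_sub_le (hn : 0 < n) {g : E d → ℝ} (hg : Measurable g) {M : ℝ}
    (hM : ∀ x, |g x| ≤ M) :
    ∫ x, ((n : ℝ)⁻¹ * ∑ i, g (x i) - ∫ z, g z ∂ν) ^ 2 ∂(Measure.pi fun _ : Fin n => ν) ≤
      M ^ 2 / n := by
  have hn' : (0 : ℝ) < n := by exact_mod_cast hn
  have e : ∀ x : Fin n → E d, ((n : ℝ)⁻¹ * ∑ i, g (x i) - ∫ z, g z ∂ν) ^ 2 =
      (n : ℝ)⁻¹ ^ 2 * (∑ i, (g (x i) - ∫ z, g z ∂ν)) ^ 2 := fun x => by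
    rw [← mul_pow, Finset.sum_sub_distrib, mul_sub]
    simp only [Finset.sum_const, Finset.card_univ, Fintype.card_fin, nsmul_eq_mul]
    rw [inv_mul_cancel_left₀ hn'.ne']
  simp_rw [e]
  rw [integral_const_mul, integral_sq_sum_eval (φ := fun _ x => g x - ∫ z, g z ∂ν)
    (fun _ => hg.sub_const _) (B := M + M)
    (fun _ x => (abs_sub _ _).trans (add_le_add (hM x) (abs_integral_le_of_abs_le hM)))
    (fun _ => by
      rw [integral_sub (integrable_of_abs_le hg hM) (integrable_const _)]
      simp)]
  have h2 : ∫ x, (g x - ∫ z, g z ∂ν) ^ 2 ∂ν ≤ M ^ 2 :=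
    (integral_sq_sub_mean_le hg hM).trans ((le_abs_self _).trans
      (abs_integral_le_of_abs_le fun x => by
        rw [abs_pow]; exact pow_le_pow_left₀ (abs_nonneg _) (hM x) 2))
  simp only [Finset.sum_const, Finset.card_univ, Fintype.card_fin, nsmul_eq_mul]
  calc (n : ℝ)⁻¹ ^ 2 * (n * ∫ x, (g x - ∫ z, g z ∂ν) ^ 2 ∂ν)
      ≤ (n : ℝ)⁻¹ ^ 2 * (n * M ^ 2) := by gcongr
    _ = M ^ 2 / n := by field_simp

/-- The variance of `2 f` under `ν`. -/
def influenceSq {𝓧 : Type*} [MeasurableSpace 𝓧] (ν : Measure 𝓧) (f : 𝓧 → ℝ) : ℝ :=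
  ∫ x, (2 * (f x - ∫ z, f z ∂ν)) ^ 2 ∂ν

theorem influenceSq_eq {𝓧 : Type*} [MeasurableSpace 𝓧] {ν : Measure 𝓧} [IsProbabilityMeasure ν]
    {f : 𝓧 → ℝ} (hf : Measurable f) {M : ℝ} (hM : ∀ x, |f x| ≤ M) :
    influenceSq ν f = 4 * (∫ x, f x ^ 2 ∂ν - (∫ x, f x ∂ν) ^ 2) := by
  set m := ∫ x, f x ∂ν with hm
  have i1 : Integrable f ν := integrable_of_abs_le hf hM
  have i2 : Integrable (fun x => f x ^ 2) ν := integrable_of_abs_le (hf.pow_const 2) (B := M ^ 2)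
    fun x => by rw [abs_pow]; exact pow_le_pow_left₀ (abs_nonneg _) (hM x) 2
  have e : ∀ x, (2 * (f x - m)) ^ 2 = 4 * f x ^ 2 - 8 * m * f x + 4 * m ^ 2 := fun x => by ring
  rw [influenceSq, ← hm]
  simp_rw [e]
  have i3 : Integrable (fun x => 4 * f x ^ 2 - 8 * m * f x) ν :=
    (i2.const_mul _).sub (i1.const_mul _)
  rw [integral_add i3 (integrable_const _),
    integral_sub (i2.const_mul _) (i1.const_mul _), integral_const_mul, integral_const_mul, ← hm]
  simp only [integral_const, probReal_univ, smul_eq_mul, one_mul]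
  ring

theorem measurable_mean {g : E d → ℝ} (hg : Measurable g) :
    Measurable fun x : Fin n → E d => (n : ℝ)⁻¹ * ∑ i, g (x i) :=
  (Finset.measurable_sum _ fun j _ => hg.comp (measurable_pi_apply j)).const_mul _

theorem abs_mean_le (hn : 0 < n) {a : Fin n → ℝ} {M : ℝ} (hM : ∀ i, |a i| ≤ M) :
    |(n : ℝ)⁻¹ * ∑ i, a i| ≤ M := by
  have hn' : (0 : ℝ) < n := by exact_mod_cast hn
  rw [abs_mul, abs_of_pos (inv_pos.2 hn'), inv_mul_le_iff₀ hn']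
  refine (Finset.abs_sum_le_sum_abs _ _).trans ((Finset.sum_le_sum fun i _ => hM i).trans ?_)
  simp

theorem measurable_influenceSq_empirical (hn : 0 < n) {f : E d → ℝ} (hf : Measurable f) {M : ℝ}
    (hM : ∀ x, |f x| ≤ M) : Measurable fun x : Fin n → E d => influenceSq (empirical x) f := by
  have e : (fun x : Fin n → E d => influenceSq (empirical x) f) = fun x =>
      4 * ((n : ℝ)⁻¹ * ∑ i, f (x i) ^ 2 - ((n : ℝ)⁻¹ * ∑ i, f (x i)) ^ 2) := by
    funext x
    have := isProbabilityMeasure_empirical hn x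
    rw [influenceSq_eq hf hM, integral_empirical, integral_empirical]
  rw [e]
  exact ((measurable_mean (hf.pow_const 2)).sub ((measurable_mean hf).pow_const 2)).const_mul _

/-- The variance is four times second moment minus squared mean, so its fluctuation is controlled by
those of two empirical means, each with mean square `O(1/n)`. This places the empirical law within
reach of the uniform central limit theorem. -/
theorem integral_sq_influenceSq_empirical_sub_le (hn : 0 < n) {f : E d → ℝ} (hf : Measurable f)
    {M : ℝ} (hM : ∀ x, |f x| ≤ M) :
    ∫ x, (influenceSq (empirical x) f - influenceSq ν f) ^ 2 ∂(Measure.pi fun _ : Fin n => ν) ≤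
      160 * M ^ 4 / n := by
  have hM2 : ∀ x, |f x ^ 2| ≤ M ^ 2 := fun x => by
    rw [abs_pow]; exact pow_le_pow_left₀ (abs_nonneg _) (hM x) 2
  set μ₁ := ∫ x, f x ∂ν with hμ₁
  set μ₂ := ∫ x, f x ^ 2 ∂ν with hμ₂
  have hμ₁M : |μ₁| ≤ M := abs_integral_le_of_abs_le hM
  have hμ₂M : |μ₂| ≤ M ^ 2 := abs_integral_le_of_abs_le hM2
  set m₁ : (Fin n → E d) → ℝ := fun x => (n : ℝ)⁻¹ * ∑ i, f (x i)
  set m₂ : (Fin n → E d) → ℝ := fun x => (n : ℝ)⁻¹ * ∑ i, f (x i) ^ 2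
  have hm₁ : ∀ x, |m₁ x| ≤ M := fun x => abs_mean_le hn fun i => hM _
  have hm₂ : ∀ x, |m₂ x| ≤ M ^ 2 := fun x => abs_mean_le hn fun i => hM2 _
  have i1 : Integrable (fun x => (m₁ x - μ₁) ^ 2) (Measure.pi fun _ : Fin n => ν) :=
    integrable_of_abs_le (((measurable_mean hf).sub_const _).pow_const 2) (B := (M + M) ^ 2)
      fun x => by
        rw [abs_pow]
        exact pow_le_pow_left₀ (abs_nonneg _) ((abs_sub _ _).trans (add_le_add (hm₁ x) hμ₁M)) 2
  have i2 : Integrable (fun x => (m₂ x - μ₂) ^ 2) (Measure.pi fun _ : Fin n => ν) :=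
    integrable_of_abs_le (((measurable_mean (hf.pow_const 2)).sub_const _).pow_const 2)
      (B := (M ^ 2 + M ^ 2) ^ 2) fun x => by
        rw [abs_pow]
        exact pow_le_pow_left₀ (abs_nonneg _) ((abs_sub _ _).trans (add_le_add (hm₂ x) hμ₂M)) 2
  have hpt : ∀ x, (influenceSq (empirical x) f - influenceSq ν f) ^ 2 ≤
      32 * (m₂ x - μ₂) ^ 2 + 128 * M ^ 2 * (m₁ x - μ₁) ^ 2 := fun x => by
    have := isProbabilityMeasure_empirical hn x
    rw [influenceSq_eq hf hM, influenceSq_eq hf hM, integral_empirical, integral_empirical]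
    change (4 * (m₂ x - m₁ x ^ 2) - 4 * (μ₂ - μ₁ ^ 2)) ^ 2 ≤ _
    have h1 : (m₁ x + μ₁) ^ 2 ≤ (2 * M) ^ 2 := by
      rw [← sq_abs]
      refine pow_le_pow_left₀ (abs_nonneg _) ((abs_add_le _ _).trans ?_) 2
      linarith [hm₁ x]
    have h2 := mul_le_mul_of_nonneg_right h1 (sq_nonneg (m₁ x - μ₁))
    nlinarith [sq_nonneg (m₂ x - μ₂ + (m₁ x + μ₁) * (m₁ x - μ₁))]
  calc _ ≤ ∫ x, (32 * (m₂ x - μ₂) ^ 2 + 128 * M ^ 2 * (m₁ x - μ₁) ^ 2)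
        ∂(Measure.pi fun _ : Fin n => ν) :=
        integral_mono_of_nonneg (ae_of_all _ fun x => sq_nonneg _)
          ((i2.const_mul _).add (i1.const_mul _)) (ae_of_all _ hpt)
    _ ≤ 32 * ((M ^ 2) ^ 2 / n) + 128 * M ^ 2 * (M ^ 2 / n) := by
        rw [integral_add (i2.const_mul _) (i1.const_mul _), integral_const_mul, integral_const_mul]
        gcongr
        · exact integral_sq_mean_sub_le hn (hf.pow_const 2) hM2
        · exact integral_sq_mean_sub_le hn hf hM
    _ = _ := by ring

theorem kernelSq_empirical (x : Fin n → E d) :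
    kernelSq (empirical x) H = (n : ℝ)⁻¹ * ∑ i, (n : ℝ)⁻¹ * ∑ j, H (x i) (x j) ^ 2 := by
  rw [kernelSq, integral_empirical]
  simp_rw [integral_empirical]

theorem kernelMean_empirical (x : Fin n → E d) :
    kernelMean (empirical x) H = (n : ℝ)⁻¹ * ∑ i, (n : ℝ)⁻¹ * ∑ j, H (x i) (x j) := by
  rw [kernelMean, integral_empirical]
  simp_rw [integral_empirical]

theorem smoothErr_empirical (x : Fin n → E d) (f : E d → ℝ) :
    smoothErr (empirical x) H f =
      (n : ℝ)⁻¹ * ∑ i, ((n : ℝ)⁻¹ * ∑ j, H (x i) (x j) - f (x i)) ^ 2 := by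
  rw [smoothErr, integral_empirical]
  simp_rw [integral_empirical]

theorem measurable_kernelSq_empirical (hH : Measurable (Function.uncurry H)) :
    Measurable fun x : Fin n → E d => kernelSq (empirical x) H := by
  simp_rw [kernelSq_empirical]
  exact (Finset.measurable_sum _ fun i _ => (Finset.measurable_sum _ fun j _ =>
    (measurable_eval_pair hH i j).pow_const 2).const_mul _).const_mul _

theorem measurable_kernelMean_empirical (hH : Measurable (Function.uncurry H)) :
    Measurable fun x : Fin n → E d => kernelMean (empirical x) H := by
  simp_rw [kernelMean_empirical]
  exact (Finset.measurable_sum _ fun i _ => (Finset.measurable_sum _ fun j _ =>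
    measurable_eval_pair hH i j).const_mul _).const_mul _

theorem measurable_smoothErr_empirical (hH : Measurable (Function.uncurry H)) {f : E d → ℝ}
    (hf : Measurable f) : Measurable fun x : Fin n → E d => smoothErr (empirical x) H f := by
  simp_rw [smoothErr_empirical]
  exact (Finset.measurable_sum _ fun i _ => (((Finset.measurable_sum _ fun j _ =>
    measurable_eval_pair hH i j).const_mul _).sub
      (hf.comp (measurable_pi_apply i))).pow_const 2).const_mul _

/-- The `n` diagonal pairs contribute `H₀² / n`; every other pair has mean `kernelSq ν H`. -/
theorem integral_kernelSq_empirical_le (hn : 0 < n) (hH : Measurable (Function.uncurry H)) {B : ℝ}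
    (hB : ∀ x y, |H x y| ≤ B) {H₀ : ℝ} (hH0 : ∀ x, H x x = H₀) :
    ∫ x, kernelSq (empirical x) H ∂(Measure.pi fun _ : Fin n => ν) ≤
      H₀ ^ 2 / n + kernelSq ν H := by
  have hn' : (0 : ℝ) < n := by exact_mod_cast hn
  have hi : ∀ i j, Integrable (fun x : Fin n → E d => H (x i) (x j) ^ 2)
      (Measure.pi fun _ : Fin n => ν) := fun i j =>
    integrable_of_abs_le ((measurable_eval_pair hH i j).pow_const 2) (B := B ^ 2) fun x => by
      rw [abs_pow]; exact pow_le_pow_left₀ (abs_nonneg _) (hB _ _) 2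
  have hb : ∀ i j, ∫ x : Fin n → E d, H (x i) (x j) ^ 2 ∂(Measure.pi fun _ : Fin n => ν) ≤
      (if i = j then H₀ ^ 2 else 0) + kernelSq ν H := fun i j => by
    split_ifs with hij
    · subst hij
      simp only [hH0]
      rw [integral_const, probReal_univ, one_smul]
      linarith [kernelSq_nonneg ν H]
    · rw [zero_add, kernelSq]
      exact (integral_pi_eval_pair (φ := fun x z => H x z ^ 2) (hH.pow_const 2) (B := B ^ 2)
        (fun x y => by
          rw [abs_pow]; exact pow_le_pow_left₀ (abs_nonneg _) (hB x y) 2) hij).le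
  simp_rw [kernelSq_empirical]
  rw [integral_const_mul, integral_finsetSum _ fun i _ =>
    (integrable_finsetSum _ fun j _ => hi i j).const_mul _]
  have e : ∀ i : Fin n, ∫ x : Fin n → E d, (n : ℝ)⁻¹ * ∑ j, H (x i) (x j) ^ 2
      ∂(Measure.pi fun _ : Fin n => ν) ≤ (n : ℝ)⁻¹ * (H₀ ^ 2 + n * kernelSq ν H) := fun i => by
    rw [integral_const_mul, integral_finsetSum _ fun j _ => hi i j]
    refine mul_le_mul_of_nonneg_left ((Finset.sum_le_sum fun j _ => hb i j).trans (le_of_eq ?_))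
      (inv_nonneg.2 hn'.le)
    rw [Finset.sum_add_distrib]
    simp
  calc _ ≤ (n : ℝ)⁻¹ * ∑ _i : Fin n, (n : ℝ)⁻¹ * (H₀ ^ 2 + n * kernelSq ν H) := by
        gcongr with i; exact e i
    _ = _ := by
        simp only [Finset.sum_const, Finset.card_univ, Fintype.card_fin, nsmul_eq_mul]
        field_simp

/-- At the sample point `x i` the empirical smoothing error has three parts: the self-term `j = i`,
of size `(H₀ - g)/n`; a centered average over the other points, with mean square at most `kernelSq ν
H / n`; and the population smoothing error. -/
theorem integral_smoothErr_empirical_le (hn : 0 < n) (hH : Measurable (Function.uncurry H))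
    {B : ℝ} (hB : ∀ x y, |H x y| ≤ B) {H₀ : ℝ} (hH0 : ∀ x, H x x = H₀) {C₁ : ℝ}
    (hC₁ : ∀ x, |∫ z, H x z ∂ν| ≤ C₁) {f : E d → ℝ} (hf : Measurable f) {M : ℝ}
    (hM : ∀ x, |f x| ≤ M) :
    ∫ x, smoothErr (empirical x) H f ∂(Measure.pi fun _ : Fin n => ν) ≤
      3 * (2 * (H₀ / n) ^ 2 + 2 * (C₁ / n) ^ 2 + kernelSq ν H / n + smoothErr ν H f) := by
  have hn' : (0 : ℝ) < n := by exact_mod_cast hn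
  set g : E d → ℝ := fun x => ∫ z, H x z ∂ν with hg
  have hHx : ∀ x, Measurable (H x) := fun x => hH.comp measurable_prodMk_left
  have hgm : Measurable g := (hH.stronglyMeasurable.integral_prod_right).measurable
  set q : E d → E d → ℝ := fun x z => H x z - g x with hq
  have hqm : Measurable (Function.uncurry q) := hH.sub (hgm.comp measurable_fst)
  have hqB : ∀ x z, |q x z| ≤ B + C₁ := fun x z =>
    (abs_sub _ _).trans (add_le_add (hB x z) (hC₁ x))
  have hq0 : ∀ x, ∫ z, q x z ∂ν = 0 := fun x => by
    simp only [hq]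
    rw [integral_sub (integrable_of_abs_le (hHx x) (hB x)) (integrable_const _)]
    simp [hg]
  have hqsq : ∫ x, ∫ z, q x z ^ 2 ∂ν ∂ν ≤ kernelSq ν H := by
    refine integral_mono_of_nonneg (ae_of_all _ fun x => integral_nonneg fun z => sq_nonneg _)
      ?_ (ae_of_all _ fun x => integral_sq_sub_mean_le (hHx x) (hB x))
    refine integrable_of_abs_le (B := B ^ 2)
      ((hH.pow_const 2).stronglyMeasurable.integral_prod_right).measurable fun x => ?_
    exact abs_integral_le_of_abs_le fun z => by
      rw [abs_pow]; exact pow_le_pow_left₀ (abs_nonneg _) (hB x z) 2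
  have hfi : Integrable (fun x => (g x - f x) ^ 2) ν :=
    integrable_of_abs_le ((hgm.sub hf).pow_const 2) (B := (C₁ + M) ^ 2) fun x => by
      rw [abs_pow]
      exact pow_le_pow_left₀ (abs_nonneg _) ((abs_sub _ _).trans (add_le_add (hC₁ x) (hM x))) 2
  set R : Fin n → (Fin n → E d) → ℝ := fun i x => ∑ j ∈ Finset.univ.erase i, q (x i) (x j) with hR
  have hRm : ∀ i, Measurable (R i) := fun i =>
    Finset.measurable_sum _ fun j _ => measurable_eval_pair hqm i j
  have hRi : ∀ i, Integrable (fun x => R i x ^ 2) (Measure.pi fun _ : Fin n => ν) := fun i =>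
    integrable_of_abs_le ((hRm i).pow_const 2)
      (B := (∑ _j ∈ Finset.univ.erase i, (B + C₁)) ^ 2) fun x => by
      rw [abs_pow]
      exact pow_le_pow_left₀ (abs_nonneg _) ((Finset.abs_sum_le_sum_abs _ _).trans
        (Finset.sum_le_sum fun j _ => hqB _ _)) 2
  have hgi : ∀ i : Fin n, Integrable (fun x : Fin n → E d => (g (x i) - f (x i)) ^ 2)
      (Measure.pi fun _ : Fin n => ν) := fun i =>
    integrable_of_abs_le (((hgm.sub hf).pow_const 2).comp (measurable_pi_apply i))
      (B := (C₁ + M) ^ 2) fun x => by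
      rw [abs_pow]
      exact pow_le_pow_left₀ (abs_nonneg _) ((abs_sub _ _).trans (add_le_add (hC₁ _) (hM _))) 2
  have hpt : ∀ i (x : Fin n → E d), ((n : ℝ)⁻¹ * ∑ j, H (x i) (x j) - f (x i)) ^ 2 ≤
      3 * (2 * (H₀ / n) ^ 2 + 2 * (C₁ / n) ^ 2) + 3 * (n : ℝ)⁻¹ ^ 2 * R i x ^ 2 +
        3 * (g (x i) - f (x i)) ^ 2 := fun i x => by
    have h1 : (n : ℝ)⁻¹ * ∑ j, H (x i) (x j) - f (x i) =
        (H₀ / n - g (x i) / n) + (n : ℝ)⁻¹ * R i x + (g (x i) - f (x i)) := by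
      have : ∑ j, H (x i) (x j) = ∑ j, q (x i) (x j) + n * g (x i) := by
        simp [hq]
      rw [this, ← Finset.add_sum_erase _ _ (Finset.mem_univ i)]
      simp only [hq, hH0, hR]
      field_simp
      ring
    rw [h1]
    have h2 : (g (x i) / n) ^ 2 ≤ (C₁ / n) ^ 2 := by
      rw [← sq_abs, abs_div, abs_of_pos hn']
      have := hC₁ (x i)
      gcongr
    have h3 : ((n : ℝ)⁻¹ * R i x) ^ 2 = (n : ℝ)⁻¹ ^ 2 * R i x ^ 2 := mul_pow _ _ _
    rw [mul_assoc 3, ← h3]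
    generalize (n : ℝ)⁻¹ * R i x = b
    generalize g (x i) - f (x i) = c
    generalize g (x i) / (n : ℝ) = u at *
    nlinarith [sq_nonneg (H₀ / n - u - b), sq_nonneg (H₀ / n - u - c), sq_nonneg (b - c),
      sq_nonneg (H₀ / n + u)]
  have hint : ∀ i, ∫ x : Fin n → E d, ((n : ℝ)⁻¹ * ∑ j, H (x i) (x j) - f (x i)) ^ 2
      ∂(Measure.pi fun _ : Fin n => ν) ≤
      3 * (2 * (H₀ / n) ^ 2 + 2 * (C₁ / n) ^ 2 + kernelSq ν H / n + smoothErr ν H f) := fun i => by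
    calc _ ≤ ∫ x : Fin n → E d, (3 * (2 * (H₀ / n) ^ 2 + 2 * (C₁ / n) ^ 2) +
            3 * (n : ℝ)⁻¹ ^ 2 * R i x ^ 2 + 3 * (g (x i) - f (x i)) ^ 2)
            ∂(Measure.pi fun _ : Fin n => ν) :=
          integral_mono_of_nonneg (ae_of_all _ fun x => sq_nonneg _)
            (((integrable_const _).add ((hRi i).const_mul _)).add ((hgi i).const_mul _))
            (ae_of_all _ (hpt i))
      _ = 3 * (2 * (H₀ / n) ^ 2 + 2 * (C₁ / n) ^ 2) +
            3 * (n : ℝ)⁻¹ ^ 2 * (∫ x, R i x ^ 2 ∂(Measure.pi fun _ : Fin n => ν)) +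
            3 * smoothErr ν H f := by
          have i3 : Integrable (fun x => 3 * (2 * (H₀ / n) ^ 2 + 2 * (C₁ / n) ^ 2) +
              3 * (n : ℝ)⁻¹ ^ 2 * R i x ^ 2) (Measure.pi fun _ : Fin n => ν) :=
            (integrable_const _).add ((hRi i).const_mul _)
          rw [integral_add i3 ((hgi i).const_mul _),
            integral_add (integrable_const _) ((hRi i).const_mul _), integral_const,
            integral_const_mul, integral_const_mul, probReal_univ, one_smul, smoothErr,
            integral_pi_eval (φ := fun y => (g y - f y) ^ 2) ((hgm.sub hf).pow_const 2) i]
      _ ≤ 3 * (2 * (H₀ / n) ^ 2 + 2 * (C₁ / n) ^ 2) +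
            3 * (n : ℝ)⁻¹ ^ 2 * (n * kernelSq ν H) + 3 * smoothErr ν H f := by
          gcongr
          exact (integral_sq_row_le hqm hqB hq0 i).trans (by gcongr)
      _ = _ := by field_simp
  simp_rw [smoothErr_empirical]
  have hSi : ∀ i : Fin n, Integrable (fun x : Fin n → E d =>
      ((n : ℝ)⁻¹ * ∑ j, H (x i) (x j) - f (x i)) ^ 2) (Measure.pi fun _ : Fin n => ν) := fun i =>
    integrable_of_abs_le ((((Finset.measurable_sum _ fun j _ =>
      measurable_eval_pair hH i j).const_mul _).sub
        (hf.comp (measurable_pi_apply i))).pow_const 2) (B := (B + M) ^ 2) fun x => by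
      rw [abs_pow]
      exact pow_le_pow_left₀ (abs_nonneg _) ((abs_sub _ _).trans
        (add_le_add (abs_mean_le hn fun j => hB _ _) (hM _))) 2
  rw [integral_const_mul, integral_finsetSum _ fun i _ => hSi i, inv_mul_le_iff₀ hn']
  refine (Finset.sum_le_sum fun i _ => hint i).trans (le_of_eq ?_)
  simp

/-- Second moment of the difference between the bootstrap mean and the value of a quadratic
statistic. -/
theorem integral_sq_bootstrap_center_le (hn : 0 < n) (hH : Measurable (Function.uncurry H))
    {B : ℝ} (hB : ∀ x y, |H x y| ≤ B) (hsym : ∀ x y, H x y = H y x)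
    {H₀ : ℝ} (hH0 : ∀ x, H x x = H₀) {C₁ : ℝ} (hC₁ : |kernelMean ν H| ≤ C₁)
    (A : Fin n → Fin n → ℝ) {C : ℝ} (hA : ∀ j k, |A j k| ≤ C / n ^ 2)
    (hA1 : ∑ j, ∑ k, A j k = 1)
    (hδ : ∀ j, |∑ k, (offDiag A j k + offDiag A k j) - 2 / n| ≤ C / n ^ 2) :
    ∫ x : Fin n → E d, (√(n : ℝ) * ((∑ j, ∑ k, offDiag A j k) * kernelMean (empirical x) H -
        ∑ j, ∑ k, A j k * H (x j) (x k))) ^ 2 ∂(Measure.pi fun _ : Fin n => ν) ≤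
      3 * (√(n : ℝ) * (((1 - ∑ j, A j j) / n - ∑ j, A j j) * H₀)) ^ 2 +
        204 * (2 + 3 * C) ^ 2 / n * kernelSq ν H + 3 * ((1 + C) * C₁) ^ 2 / n := by
  have hn' : (0 : ℝ) < n := by exact_mod_cast hn
  have hn1 : (1 : ℝ) ≤ n := by exact_mod_cast hn
  have hss : √(n : ℝ) ^ 2 = n := Real.sq_sqrt hn'.le
  have hC : 0 ≤ C := by
    have hC0 : 0 ≤ C / (n : ℝ) ^ 2 := (abs_nonneg _).trans (hA ⟨0, hn⟩ ⟨0, hn⟩)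
    by_contra h
    exact absurd (div_neg_of_neg_of_pos (not_le.1 h) (by positivity : (0 : ℝ) < n ^ 2))
      (not_lt.2 hC0)
  set tr := ∑ j, A j j with htr
  have htrC : |tr| ≤ C / n := by
    refine (Finset.abs_sum_le_sum_abs _ _).trans ((Finset.sum_le_sum fun j _ => hA j j).trans ?_)
    simp only [Finset.sum_const, Finset.card_univ, Fintype.card_fin, nsmul_eq_mul]
    exact le_of_eq (by field_simp)
  have htrC' : |tr| ≤ C := htrC.trans (div_le_self hC hn1)
  have h1tr : |1 - tr| ≤ 1 + C := (abs_sub _ _).trans (by rw [abs_one]; linarith)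
  have hoffsum : ∑ j, ∑ k, offDiag A j k = 1 - tr := by
    have := sum_eq_diag_add_offDiag A (fun _ _ => (1 : ℝ)) (H₀ := 1) fun _ => rfl
    simp only [mul_one] at this
    rw [hA1] at this
    linarith
  have hones : ∀ j : Fin n, ∑ k, offDiag (fun _ _ => (1 : ℝ)) j k = n - 1 := fun j => by
    rw [← Finset.add_sum_erase _ _ (Finset.mem_univ j), offDiag_self, zero_add,
      Finset.sum_congr rfl fun k hk => show offDiag (fun _ _ => (1 : ℝ)) j k = 1 from
        if_neg (Finset.ne_of_mem_erase hk).symm]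
    simp [Finset.card_erase_of_mem, Nat.cast_sub (Nat.succ_le_of_lt hn)]
  -- `D` compares the off-diagonal weights of the bootstrap mean with those of the statistic. Their
  -- row plus column sums nearly agree, so the linear parts cancel and the quadratic bound applies
  -- with `τ = 0` and zero target.
  set D : Fin n → Fin n → ℝ := fun j k => (1 - tr) / n ^ 2 * offDiag (fun _ _ => (1 : ℝ)) j k -
    offDiag A j k with hD
  have hD0 : ∀ j, D j j = 0 := fun j => by simp [hD, offDiag_self]
  have hone : ∀ j k : Fin n, |offDiag (fun _ _ => (1 : ℝ)) j k| ≤ 1 := fun j k => by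
    rw [offDiag]; split_ifs <;> simp
  have hoff : ∀ j k, |offDiag A j k| ≤ C / n ^ 2 := fun j k => by
    rw [offDiag]
    split_ifs
    · simpa using div_nonneg hC (sq_nonneg (n : ℝ))
    · exact hA j k
  -- The constant `2 + 3 C` is dictated by the row plus column sums below; the entries alone would
  -- need only `1 + 2 C`.
  have hDa : ∀ j k, |D j k| ≤ (2 + 3 * C) / n ^ 2 := fun j k => by
    calc |D j k| ≤ (1 + C) / n ^ 2 * 1 + C / n ^ 2 := by
          refine (abs_sub _ _).trans (add_le_add ?_ (hoff j k))
          rw [abs_mul, abs_div, abs_of_pos (by positivity : (0 : ℝ) < n ^ 2)]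
          gcongr
          exact hone j k
      _ = (1 + 2 * C) / n ^ 2 := by ring
      _ ≤ _ := by gcongr <;> linarith
  have honesym : ∀ j k : Fin n, offDiag (fun _ _ => (1 : ℝ)) j k =
      offDiag (fun _ _ => (1 : ℝ)) k j := fun j k => by
    simp only [offDiag, eq_comm]
  have hDδ : ∀ j, |∑ k, (D j k + D k j) - 0| ≤ (2 + 3 * C) / n ^ 2 := fun j => by
    have e : ∑ k, (D j k + D k j) - 0 = -(2 * (1 + (n - 1) * tr) / n ^ 2) -
        (∑ k, (offDiag A j k + offDiag A k j) - 2 / n) := by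
      have : ∀ k, D j k + D k j = 2 * ((1 - tr) / n ^ 2) * offDiag (fun _ _ => (1 : ℝ)) j k -
          (offDiag A j k + offDiag A k j) := fun k => by
        simp only [hD]; rw [honesym k j]; ring
      simp_rw [this]
      rw [Finset.sum_sub_distrib, ← Finset.mul_sum, hones]
      field_simp
      ring
    rw [e]
    have h1 : |2 * (1 + ((n : ℝ) - 1) * tr) / n ^ 2| ≤ 2 * (1 + C) / n ^ 2 := by
      rw [abs_div, abs_of_pos (by positivity : (0 : ℝ) < n ^ 2), abs_mul, abs_two]
      gcongr
      refine (abs_add_le _ _).trans ?_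
      rw [abs_one, abs_mul, abs_of_nonneg (by linarith : (0 : ℝ) ≤ n - 1)]
      have : ((n : ℝ) - 1) * |tr| ≤ n * (C / n) := by gcongr; linarith
      rw [mul_div_cancel₀ _ hn'.ne'] at this
      linarith
    refine (abs_sub _ _).trans ?_
    rw [abs_neg]
    refine (add_le_add h1 (hδ j)).trans (le_of_eq ?_)
    ring
  have hDsum : ∑ j, ∑ k, D j k = -((1 - tr) / n) := by
    simp only [hD, Finset.sum_sub_distrib, ← Finset.mul_sum, hones, hoffsum]
    simp only [Finset.sum_const, Finset.card_univ, Fintype.card_fin, nsmul_eq_mul]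
    field_simp
    ring
  set rem : (Fin n → E d) → ℝ := fun x => ∑ j, ∑ k, D j k * H (x j) (x k) -
    (∑ j, ∑ k, D j k) * kernelMean ν H with hrem
  have hbound := integral_sq_quadratic_sub_linear_le (ν := ν) hH hB hsym
    (measurable_const (a := (0 : ℝ))) (M := 0) (by simp) D hD0 hDa hDδ
  rw [Fintype.card_fin] at hbound
  simp only [zero_mul, mul_zero, sub_zero, ne_eq, OfNat.ofNat_ne_zero, not_false_eq_true,
    zero_pow, add_zero] at hbound
  change ∫ x, rem x ^ 2 ∂(Measure.pi fun _ : Fin n => ν) ≤ _ * kernelSq ν H at hbound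
  have hremm : Measurable rem := Measurable.sub_const (Finset.measurable_sum _ fun j _ =>
    Finset.measurable_sum _ fun k _ => (measurable_eval_pair hH j k).const_mul _) _
  have hrem2 : Integrable (fun x => rem x ^ 2) (Measure.pi fun _ : Fin n => ν) :=
    integrable_of_abs_le (hremm.pow_const 2)
      (B := (∑ _j : Fin n, ∑ _k : Fin n, (2 + 3 * C) / n ^ 2 * B +
        |(∑ j, ∑ k, D j k) * kernelMean ν H|) ^ 2) fun x => by
      rw [abs_pow]
      refine pow_le_pow_left₀ (abs_nonneg _) ((abs_sub _ _).trans (add_le_add ?_ le_rfl)) 2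
      refine (Finset.abs_sum_le_sum_abs _ _).trans (Finset.sum_le_sum fun j _ =>
        (Finset.abs_sum_le_sum_abs _ _).trans (Finset.sum_le_sum fun k _ => ?_))
      rw [abs_mul]
      exact mul_le_mul (hDa _ _) (hB _ _) (abs_nonneg _) (by positivity)
  -- The centering error splits into the deterministic diagonal mismatch, a mean-zero quadratic
  -- form, and its `O(1/n)` mean. Only the first depends on how close the trace of `A` is to `1/n`.
  have hdec : ∀ x : Fin n → E d, (∑ j, ∑ k, offDiag A j k) * kernelMean (empirical x) H -
      ∑ j, ∑ k, A j k * H (x j) (x k) =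
      ((1 - tr) / n - tr) * H₀ + rem x + -((1 - tr) / n) * kernelMean ν H := fun x => by
    have h1 := sum_eq_diag_add_offDiag A (fun j k => H (x j) (x k)) (H₀ := H₀)
      fun j => hH0 (x j)
    have h2 := sum_eq_diag_add_offDiag (fun _ _ => (1 : ℝ)) (fun j k => H (x j) (x k)) (H₀ := H₀)
      fun j => hH0 (x j)
    simp only [one_mul, Finset.sum_const, Finset.card_univ, Fintype.card_fin, nsmul_eq_mul,
      mul_one] at h2
    have h3 : ∑ j, ∑ k, D j k * H (x j) (x k) =
        (1 - tr) / n ^ 2 * ∑ j, ∑ k, offDiag (fun _ _ => (1 : ℝ)) j k * H (x j) (x k) -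
          ∑ j, ∑ k, offDiag A j k * H (x j) (x k) := by
      simp only [hD, sub_mul, Finset.sum_sub_distrib, Finset.mul_sum, mul_assoc]
    rw [kernelMean_empirical, ← Finset.mul_sum, h1, h2, hoffsum]
    simp only [hrem]
    rw [h3, hDsum]
    field_simp
    ring
  have hpt : ∀ x : Fin n → E d, (√(n : ℝ) * ((∑ j, ∑ k, offDiag A j k) *
      kernelMean (empirical x) H - ∑ j, ∑ k, A j k * H (x j) (x k))) ^ 2 ≤
      (3 * (√(n : ℝ) * (((1 - tr) / n - tr) * H₀)) ^ 2 + 3 * ((1 + C) * C₁) ^ 2 / n) +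
        3 * n * rem x ^ 2 := fun x => by
    rw [hdec, mul_pow, mul_pow, hss]
    have h1 : (-((1 - tr) / n) * kernelMean ν H) ^ 2 ≤ ((1 + C) * C₁) ^ 2 / n ^ 2 := by
      rw [← sq_abs, abs_mul, abs_neg, abs_div, abs_of_pos hn', ← div_pow, mul_div_right_comm]
      gcongr
    have h2 : n * (((1 + C) * C₁) ^ 2 / (n : ℝ) ^ 2) = ((1 + C) * C₁) ^ 2 / n := by field_simp
    have h3 := mul_le_mul_of_nonneg_left h1 hn'.le
    rw [h2] at h3
    generalize -((1 - tr) / n) * kernelMean ν H = w at *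
    generalize ((1 - tr) / n - tr) * H₀ = u at *
    have h4 : (u + rem x + w) ^ 2 ≤ 3 * u ^ 2 + 3 * rem x ^ 2 + 3 * w ^ 2 := by
      nlinarith [sq_nonneg (u - rem x), sq_nonneg (u - w), sq_nonneg (rem x - w)]
    have h5 := mul_le_mul_of_nonneg_left h4 hn'.le
    have h6 : 3 * ((1 + C) * C₁) ^ 2 / n = 3 * (((1 + C) * C₁) ^ 2 / n) := by ring
    rw [h6]
    linarith
  calc _ ≤ ∫ x, ((3 * (√(n : ℝ) * (((1 - tr) / n - tr) * H₀)) ^ 2 + 3 * ((1 + C) * C₁) ^ 2 / n) +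
        3 * n * rem x ^ 2) ∂(Measure.pi fun _ : Fin n => ν) :=
        integral_mono_of_nonneg (ae_of_all _ fun x => sq_nonneg _)
          ((integrable_const _).add (hrem2.const_mul _)) (ae_of_all _ hpt)
    _ = (3 * (√(n : ℝ) * (((1 - tr) / n - tr) * H₀)) ^ 2 + 3 * ((1 + C) * C₁) ^ 2 / n) +
        3 * n * ∫ x, rem x ^ 2 ∂(Measure.pi fun _ : Fin n => ν) := by
        rw [integral_add (integrable_const _) (hrem2.const_mul _), integral_const_mul,
          integral_const, probReal_univ, one_smul]
    _ ≤ (3 * (√(n : ℝ) * (((1 - tr) / n - tr) * H₀)) ^ 2 + 3 * ((1 + C) * C₁) ^ 2 / n) +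
        3 * n * ((64 * ((2 + 3 * C) / n ^ 2) ^ 2 * n ^ 2 + 4 * ((2 + 3 * C) / n ^ 2) ^ 2 * n) *
          kernelSq ν H) := by gcongr
    _ ≤ _ := by
        have h1 : 3 * (n : ℝ) * ((64 * ((2 + 3 * C) / n ^ 2) ^ 2 * n ^ 2 +
            4 * ((2 + 3 * C) / n ^ 2) ^ 2 * n) * kernelSq ν H) =
            (192 * (2 + 3 * C) ^ 2 / n + 12 * (2 + 3 * C) ^ 2 / n / n) * kernelSq ν H := by
          field_simp
          ring
        have h2 : 12 * (2 + 3 * C) ^ 2 / n / n ≤ 12 * (2 + 3 * C) ^ 2 / n :=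
          div_le_self (by positivity) hn1
        have h3 : 192 * (2 + 3 * C) ^ 2 / n + 12 * (2 + 3 * C) ^ 2 / n / n ≤
            204 * (2 + 3 * C) ^ 2 / n := by
          have : 204 * (2 + 3 * C) ^ 2 / n = 192 * (2 + 3 * C) ^ 2 / n +
            12 * (2 + 3 * C) ^ 2 / (n : ℝ) := by ring
          linarith
        have := mul_le_mul_of_nonneg_right h3 (kernelSq_nonneg ν H)
        rw [h1]
        linarith

end AvgDensity

end

noncomputable section

namespace AvgDensity

/-! ### Bootstrap consistency for quadratic statistics -/

variable {d : ℕ} {Ω : Type*} [MeasurableSpace Ω] {μ : Measure Ω} {ν : Measure (E d)}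
  {X : ℕ → Ω → E d}

theorem aemeasurable_sample (hlaw : ∀ i, HasLaw (X i) ν μ) (n : ℕ) :
    AEMeasurable (fun ω (i : Fin n) => X i ω) μ :=
  aemeasurable_pi_lambda _ fun i => (hlaw i).aemeasurable

theorem map_sample_eq [IsProbabilityMeasure μ] (hind : iIndepFun X μ) (hlaw : ∀ i, HasLaw (X i) ν μ) (n : ℕ) :
    μ.map (fun ω (i : Fin n) => X i ω) = Measure.pi fun _ => ν := by
  have h := (iIndepFun_iff_map_fun_eq_pi_map
    (fun i : Fin n => (hlaw i).aemeasurable)).1 (hind.precomp Fin.val_injective)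
  rw [h]
  congr 1
  funext i
  exact (hlaw i).map_eq

/-- The error term in the normal approximation of the quadratic statistic
`∑ A j k * H (y j) (y k) + c`, centered at `m`. -/
def quadErr {𝓧 : Type*} [MeasurableSpace 𝓧] {n : ℕ} (ν : Measure 𝓧) (H : 𝓧 → 𝓧 → ℝ) (f : 𝓧 → ℝ)
    (A : Fin n → Fin n → ℝ) (C c m : ℝ) : ℝ :=
  136 * C ^ 2 / n * kernelSq ν H + 32 * smoothErr ν H f +
    2 * (√(n : ℝ) * ((∑ j, ∑ k, offDiag A j k) * kernelMean ν H + c - m)) ^ 2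

theorem quadErr_nonneg {𝓧 : Type*} [MeasurableSpace 𝓧] {n : ℕ} (ν : Measure 𝓧) (H : 𝓧 → 𝓧 → ℝ)
    (f : 𝓧 → ℝ) (A : Fin n → Fin n → ℝ) (C c m : ℝ) : 0 ≤ quadErr ν H f A C c m := by
  have := kernelSq_nonneg ν H
  have := smoothErr_nonneg ν H f
  unfold quadErr
  positivity

variable {n : ℕ} {H : E d → E d → ℝ} {B H₀ : ℝ} {f : E d → ℝ} {M : ℝ} {A : Fin n → Fin n → ℝ}
  {C c : ℝ} {T : (Fin n → E d) → ℝ}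

theorem measurable_quadratic (hH : Measurable (Function.uncurry H))
    (hT : ∀ y, T y = ∑ j, ∑ k, A j k * H (y j) (y k) + c) : Measurable T := by
  rw [funext hT]
  exact (Finset.measurable_sum _ fun j _ => Finset.measurable_sum _ fun k _ =>
    (measurable_eval_pair hH j k).const_mul _).add_const _

/-- Both distribution functions are approximated by the same normal one at the same shifted point:
the diagonal contribution `√n tr(A) H₀` depends neither on the sampling law nor on the data. The
bootstrap therefore remains valid when this shift does not vanish. -/
theorem bootDist_le [IsProbabilityMeasure μ] [IsProbabilityMeasure ν] (hind : iIndepFun X μ) (hlaw : ∀ i, HasLaw (X i) ν μ) (hn : 0 < n)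
    (hH : Measurable (Function.uncurry H)) (hB : ∀ x y, |H x y| ≤ B)
    (hsym : ∀ x y, H x y = H y x) (hH0 : ∀ x, H x x = H₀)
    (hf : Measurable f) (hM : ∀ x, |f x| ≤ M) (hA : ∀ j k, |A j k| ≤ C / n ^ 2)
    (hδ : ∀ j, |∑ k, (offDiag A j k + offDiag A k j) - 2 / n| ≤ C / n ^ 2)
    (hT : ∀ y, T y = ∑ j, ∑ k, A j k * H (y j) (y k) + c)
    {v : ℝ≥0} (hv : v ≠ 0) {ε : ℝ} (x : Fin n → E d)
    (hclt : ∀ t, |(Measure.pi fun _ : Fin n => ν).real {y | linStat f ν y ≤ t} -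
      normalCdf v t| ≤ ε)
    (hclt' : ∀ t, |(Measure.pi fun _ : Fin n => empirical x).real
      {y | linStat f (empirical x) y ≤ t} - normalCdf v t| ≤ ε)
    (θ₀ : ℝ) {η : ℝ} (hη : 0 < η) :
    bootDist μ X θ₀ n T x ≤ 2 * ε + (quadErr ν H f A C c θ₀ +
      quadErr (empirical x) H f A C c (T x)) / η ^ 2 + 2 * ((√(2 * Real.pi * v))⁻¹ * η) := by
  refine ciSup_le fun t => ?_
  have := isProbabilityMeasure_empirical hn x
  have h1 := abs_quadratic_cdf_sub_normalCdf_le hn hH hB hsym hH0 hf hM A hA hδ hT hv hclt θ₀ hη t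
  have h2 := abs_quadratic_cdf_sub_normalCdf_le hn hH hB hsym hH0 hf hM A hA hδ hT hv hclt'
    (T x) hη t
  have hset : μ.real {ω | √(n : ℝ) * (T (fun i => X i ω) - θ₀) ≤ t} =
      (Measure.pi fun _ : Fin n => ν).real {y | √(n : ℝ) * (T y - θ₀) ≤ t} := by
    rw [← map_sample_eq hind hlaw n, map_measureReal_apply_of_aemeasurable
      (aemeasurable_sample hlaw n)]
    · rfl
    · exact measurableSet_le (((measurable_quadratic hH hT).sub_const _).const_mul _)
        measurable_const
  rw [hset, bootLaw]
  refine (abs_sub_le _ (normalCdf v (t - √(n : ℝ) * ((∑ j, A j j) * H₀))) _).trans ?_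
  rw [abs_sub_comm (normalCdf _ _)]
  refine (add_le_add h1 h2).trans (le_of_eq ?_)
  simp only [quadErr]
  ring

theorem measurable_quadErr_empirical (hH : Measurable (Function.uncurry H)) (hf : Measurable f)
    (hT : ∀ y, T y = ∑ j, ∑ k, A j k * H (y j) (y k) + c) :
    Measurable fun x : Fin n → E d => quadErr (empirical x) H f A C c (T x) :=
  (((measurable_kernelSq_empirical hH).const_mul _).add
    ((measurable_smoothErr_empirical hH hf).const_mul _)).add
    ((((((measurable_kernelMean_empirical hH).const_mul _).add_const _).sub
      (measurable_quadratic hH hT)).const_mul _).pow_const 2 |>.const_mul _)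

theorem abs_kernelMean_empirical_le (hn : 0 < n) (hB : ∀ x y, |H x y| ≤ B) (x : Fin n → E d) :
    |kernelMean (empirical x) H| ≤ B := by
  rw [kernelMean_empirical]
  exact abs_mean_le hn fun i => abs_mean_le hn fun j => hB _ _

/-- The constant `c` drops out of the bootstrap centering, because it occurs both in the resampled
and in the original statistic. -/
theorem integrable_and_integral_quadErr_empirical_le [IsProbabilityMeasure ν] (hn : 0 < n)
    (hH : Measurable (Function.uncurry H)) (hB : ∀ x y, |H x y| ≤ B)
    (hsym : ∀ x y, H x y = H y x) (hH0 : ∀ x, H x x = H₀) {C₁ : ℝ}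
    (hC₁ : ∀ x, |∫ z, H x z ∂ν| ≤ C₁) (hf : Measurable f) (hM : ∀ x, |f x| ≤ M)
    (hA : ∀ j k, |A j k| ≤ C / n ^ 2) (hA1 : ∑ j, ∑ k, A j k = 1)
    (hδ : ∀ j, |∑ k, (offDiag A j k + offDiag A k j) - 2 / n| ≤ C / n ^ 2)
    (hT : ∀ y, T y = ∑ j, ∑ k, A j k * H (y j) (y k) + c) :
    Integrable (fun x => quadErr (empirical x) H f A C c (T x)) (Measure.pi fun _ : Fin n => ν) ∧
    ∫ x, quadErr (empirical x) H f A C c (T x) ∂(Measure.pi fun _ : Fin n => ν) ≤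
      136 * C ^ 2 * ((H₀ / n) ^ 2 + kernelSq ν H / n) +
      96 * (2 * (H₀ / n) ^ 2 + 2 * C₁ ^ 2 * (1 / n) ^ 2 + kernelSq ν H / n + smoothErr ν H f) +
      2 * (3 * (√(n : ℝ) * (((1 - ∑ j, A j j) / n - ∑ j, A j j) * H₀)) ^ 2 +
        204 * (2 + 3 * C) ^ 2 * (kernelSq ν H / n) + 3 * ((1 + C) * C₁) ^ 2 * (1 / n)) := by
  have hn' : (0 : ℝ) < n := by exact_mod_cast hn
  have hC0 : 0 ≤ C / (n : ℝ) ^ 2 := (abs_nonneg _).trans (hA ⟨0, hn⟩ ⟨0, hn⟩)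
  set S := ∑ j, ∑ k, offDiag A j k with hS
  have hkm : |kernelMean ν H| ≤ C₁ := abs_integral_le_of_abs_le hC₁
  have hcen : ∀ x, (S * kernelMean (empirical x) H + c - T x) =
      S * kernelMean (empirical x) H - ∑ j, ∑ k, A j k * H (x j) (x k) := fun x => by
    rw [hT]; ring
  have hmeas : Measurable fun x : Fin n → E d => (√(n : ℝ) * (S * kernelMean (empirical x) H -
      ∑ j, ∑ k, A j k * H (x j) (x k))) ^ 2 :=
    ((((measurable_kernelMean_empirical hH).const_mul _).sub (Finset.measurable_sum _ fun j _ =>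
      Finset.measurable_sum _ fun k _ => (measurable_eval_pair hH j k).const_mul _)).const_mul
        _).pow_const 2
  have i1 : Integrable (fun x => kernelSq (empirical x) H) (Measure.pi fun _ : Fin n => ν) :=
    integrable_of_abs_le (measurable_kernelSq_empirical hH) (B := B ^ 2) fun x => by
      rw [kernelSq_empirical]
      exact abs_mean_le hn fun i => abs_mean_le hn fun j => by
        rw [abs_pow]; exact pow_le_pow_left₀ (abs_nonneg _) (hB _ _) 2
  have i2 : Integrable (fun x => smoothErr (empirical x) H f) (Measure.pi fun _ : Fin n => ν) :=
    integrable_of_abs_le (measurable_smoothErr_empirical hH hf) (B := (B + M) ^ 2) fun x => by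
      rw [smoothErr_empirical]
      refine abs_mean_le hn fun i => ?_
      rw [abs_pow]
      exact pow_le_pow_left₀ (abs_nonneg _) ((abs_sub _ _).trans
        (add_le_add (abs_mean_le hn fun j => hB _ _) (hM _))) 2
  have i3 : Integrable (fun x : Fin n → E d => (√(n : ℝ) * (S * kernelMean (empirical x) H -
      ∑ j, ∑ k, A j k * H (x j) (x k))) ^ 2) (Measure.pi fun _ : Fin n => ν) :=
    integrable_of_abs_le hmeas (B := (√(n : ℝ) * (|S| * B +
      ∑ _j : Fin n, ∑ _k : Fin n, C / n ^ 2 * B)) ^ 2) fun x => by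
      rw [abs_pow]
      refine pow_le_pow_left₀ (abs_nonneg _) ?_ 2
      rw [abs_mul, abs_of_nonneg (Real.sqrt_nonneg _)]
      refine mul_le_mul_of_nonneg_left ((abs_sub _ _).trans (add_le_add ?_ ?_))
        (Real.sqrt_nonneg _)
      · rw [abs_mul]
        exact mul_le_mul_of_nonneg_left (abs_kernelMean_empirical_le hn hB x) (abs_nonneg _)
      · refine (Finset.abs_sum_le_sum_abs _ _).trans (Finset.sum_le_sum fun j _ =>
          (Finset.abs_sum_le_sum_abs _ _).trans (Finset.sum_le_sum fun k _ => ?_))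
        rw [abs_mul]
        exact mul_le_mul (hA _ _) (hB _ _) (abs_nonneg _) hC0
  have e : (fun x => quadErr (empirical x) H f A C c (T x)) = fun x =>
      136 * C ^ 2 / n * kernelSq (empirical x) H + 32 * smoothErr (empirical x) H f +
        2 * (√(n : ℝ) * (S * kernelMean (empirical x) H -
          ∑ j, ∑ k, A j k * H (x j) (x k))) ^ 2 := by
    funext x
    rw [quadErr, ← hS, hcen]
  have i12 : Integrable (fun x => 136 * C ^ 2 / n * kernelSq (empirical x) H +
      32 * smoothErr (empirical x) H f) (Measure.pi fun _ : Fin n => ν) :=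
    (i1.const_mul _).add (i2.const_mul _)
  rw [e]
  refine ⟨i12.add (i3.const_mul _), ?_⟩
  rw [integral_add i12 (i3.const_mul _), integral_add (i1.const_mul _) (i2.const_mul _),
    integral_const_mul, integral_const_mul, integral_const_mul]
  have b1 := integral_kernelSq_empirical_le (ν := ν) hn hH hB hH0
  have b2 := integral_smoothErr_empirical_le (ν := ν) hn hH hB hH0 hC₁ hf hM
  have b3 := integral_sq_bootstrap_center_le (ν := ν) hn hH hB hsym hH0 hkm A hA hA1 hδ
  refine add_le_add (add_le_add ?_ ?_) (mul_le_mul_of_nonneg_left (b3.trans (le_of_eq ?_))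
    zero_le_two)
  · refine (mul_le_mul_of_nonneg_left b1 (by positivity)).trans (le_of_eq ?_)
    ring
  · refine (mul_le_mul_of_nonneg_left b2 (by norm_num)).trans (le_of_eq ?_)
    ring
  · ring

theorem sum_offDiag (A : Fin n → Fin n → ℝ) :
    ∑ j, ∑ k, offDiag A j k = ∑ j, ∑ k, A j k - ∑ j, A j j := by
  have := sum_eq_diag_add_offDiag A (fun _ _ => (1 : ℝ)) (H₀ := 1) fun _ => rfl
  simp only [mul_one] at this
  linarith

theorem abs_sum_diag_le (hn : 0 < n) (hA : ∀ j k, |A j k| ≤ C / n ^ 2) :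
    |∑ j, A j j| ≤ C / n := by
  have hn' : (0 : ℝ) < n := by exact_mod_cast hn
  refine (Finset.abs_sum_le_sum_abs _ _).trans ((Finset.sum_le_sum fun j _ => hA j j).trans ?_)
  simp only [Finset.sum_const, Finset.card_univ, Fintype.card_fin, nsmul_eq_mul]
  exact le_of_eq (by field_simp)

theorem tendsto_sqrt_div_self : Tendsto (fun n : ℕ => √(n : ℝ) / n) atTop (𝓝 0) := by
  simp_rw [Real.sqrt_div_self', one_div]
  exact (Real.tendsto_sqrt_atTop.comp tendsto_natCast_atTop_atTop).inv_tendsto_atTop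

/-- Bootstrap consistency of quadratic statistics with kernels `H n`, from the behaviour of the
moments of `H n` under the law of the data. -/
theorem bootstrapConsistent_of_quadratic [IsProbabilityMeasure μ] [IsProbabilityMeasure ν]
    (hind : iIndepFun X μ) (hlaw : ∀ i, HasLaw (X i) ν μ)
    {f : E d → ℝ} (hf : Measurable f) {M : ℝ} (hM : ∀ x, |f x| ≤ M) (hv : 0 < influenceSq ν f)
    {H : ℕ → E d → E d → ℝ} (hH : ∀ n, Measurable (Function.uncurry (H n)))
    (hB : ∀ n, ∃ B, ∀ x y, |H n x y| ≤ B) (hsym : ∀ n x y, H n x y = H n y x)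
    {H₀ : ℕ → ℝ} (hH0 : ∀ n x, H n x x = H₀ n) {C₁ : ℝ} (hC₁ : ∀ n x, |∫ z, H n x z ∂ν| ≤ C₁)
    (hH₀n : Tendsto (fun n => H₀ n / n) atTop (𝓝 0))
    (hsq : Tendsto (fun n => kernelSq ν (H n) / n) atTop (𝓝 0))
    (hsm : Tendsto (fun n => smoothErr ν (H n) f) atTop (𝓝 0)) {θ₀ : ℝ}
    (hbias : Tendsto (fun n : ℕ => √(n : ℝ) * (kernelMean ν (H n) - θ₀)) atTop (𝓝 0))
    {A : ∀ n, Fin n → Fin n → ℝ} {C : ℝ} (hA : ∀ᶠ n : ℕ in atTop, ∀ j k, |A n j k| ≤ C / n ^ 2)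
    (hA1 : ∀ᶠ n in atTop, ∑ j, ∑ k, A n j k = 1)
    (hδ : ∀ᶠ n : ℕ in atTop, ∀ j, |∑ k, (offDiag (A n) j k + offDiag (A n) k j) - 2 / n| ≤
      C / n ^ 2)
    (hdiag : Tendsto (fun n : ℕ => √(n : ℝ) *
      (((1 - ∑ j, A n j j) / n - ∑ j, A n j j) * H₀ n)) atTop (𝓝 0))
    {c : ℕ → ℝ} (hc : Tendsto (fun n : ℕ => √(n : ℝ) * c n) atTop (𝓝 0))
    {T : ∀ n, (Fin n → E d) → ℝ}
    (hT : ∀ᶠ n in atTop, ∀ y, T n y = ∑ j, ∑ k, A n j k * H n (y j) (y k) + c n) :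
    BootstrapConsistent μ X θ₀ T := by
  rw [BootstrapConsistent, tendstoInMeasure_iff_measureReal_norm]
  intro ε hε
  choose B hB using hB
  set v : ℝ≥0 := ⟨influenceSq ν f, hv.le⟩ with hvdef
  have hv0 : v ≠ 0 := fun h => hv.ne' (congrArg NNReal.toReal h)
  have hvpos : (0 : ℝ) < v := hv
  -- Error budget: the two normal approximations cost `2 · ε/8`, the remainders `ε/4`, and the
  -- Lipschitz term `2 L η = ε/4`. The total `3ε/4` is below `ε`.
  obtain ⟨δ, hδ0, N, hN⟩ := exists_forall_abs_linStat_sub_normalCdf_le hf hM hv0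
    (show 0 < ε / 8 by positivity)
  set L := (√(2 * Real.pi * v))⁻¹ with hL
  have hLpos : 0 < L := by
    rw [hL]
    have := Real.pi_pos
    positivity
  set η := ε / (8 * L) with hη
  have hηpos : 0 < η := by positivity
  have hLη : L * η = ε / 8 := by rw [hη]; field_simp
  -- Below this threshold the empirical variance is within `δ` of the true one and the conditional
  -- remainder is below `η² ε/8`.
  set c₀ := min (δ ^ 2) (η ^ 2 * (ε / 8)) with hc₀
  have hc₀pos : 0 < c₀ := lt_min (by positivity) (by positivity)
  have hinv : Tendsto (fun n : ℕ => 1 / (n : ℝ)) atTop (𝓝 0) := tendsto_one_div_atTop_nhds_zero_nat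
  -- A bound for the expectation of `Z`, continuous in five null sequences; each hypothesis of the
  -- theorem supplies one, except `1/n`.
  set R : ℕ → ℝ := fun n => 160 * M ^ 4 * (1 / n) +
    (136 * C ^ 2 * ((H₀ n / n) ^ 2 + kernelSq ν (H n) / n) +
      96 * (2 * (H₀ n / n) ^ 2 + 2 * C₁ ^ 2 * (1 / n) ^ 2 + kernelSq ν (H n) / n +
        smoothErr ν (H n) f) +
      2 * (3 * (√(n : ℝ) * (((1 - ∑ j, A n j j) / n - ∑ j, A n j j) * H₀ n)) ^ 2 +
        204 * (2 + 3 * C) ^ 2 * (kernelSq ν (H n) / n) + 3 * ((1 + C) * C₁) ^ 2 * (1 / n))) with hR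
  have hRlim : Tendsto R atTop (𝓝 0) := by
    have hF : Continuous fun p : ℝ × ℝ × ℝ × ℝ × ℝ => 160 * M ^ 4 * p.1 +
        (136 * C ^ 2 * (p.2.1 ^ 2 + p.2.2.1) +
        96 * (2 * p.2.1 ^ 2 + 2 * C₁ ^ 2 * p.1 ^ 2 + p.2.2.1 + p.2.2.2.1) +
        2 * (3 * p.2.2.2.2 ^ 2 + 204 * (2 + 3 * C) ^ 2 * p.2.2.1 +
          3 * ((1 + C) * C₁) ^ 2 * p.1)) := by fun_prop
    exact (hF.tendsto' (0, 0, 0, 0, 0) 0 (by simp)).comp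
      (hinv.prodMk_nhds (hH₀n.prodMk_nhds (hsq.prodMk_nhds (hsm.prodMk_nhds hdiag))))
  have hreal : Tendsto (fun n => quadErr ν (H n) f (A n) C (c n) θ₀) atTop (𝓝 0) := by
    -- The off-diagonal weights sum to `1 - tr A` rather than one. The missing mass multiplies the
    -- mean of `H`, which is bounded uniformly in `n`, and so costs `O(n^{-1/2})` after scaling.
    have htr : Tendsto (fun n : ℕ => √(n : ℝ) * ((∑ j, A n j j) * kernelMean ν (H n)))
        atTop (𝓝 0) := by
      refine squeeze_zero_norm' ?_ (by simpa using tendsto_sqrt_div_self.const_mul (C * C₁))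
      filter_upwards [hA, eventually_gt_atTop 0] with n hAn hn
      have hkm : |kernelMean ν (H n)| ≤ C₁ := abs_integral_le_of_abs_le (hC₁ n)
      have htr := abs_sum_diag_le hn hAn
      rw [Real.norm_eq_abs, abs_mul, abs_of_nonneg (Real.sqrt_nonneg _), abs_mul]
      calc _ ≤ √(n : ℝ) * (C / n * C₁) := by
            refine mul_le_mul_of_nonneg_left (mul_le_mul htr hkm (abs_nonneg _)
              ((abs_nonneg _).trans htr)) (Real.sqrt_nonneg _)
        _ = _ := by ring
    have hF : Continuous fun p : ℝ × ℝ × ℝ × ℝ × ℝ => 136 * C ^ 2 * p.1 + 32 * p.2.1 +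
        2 * (p.2.2.1 + p.2.2.2.1 - p.2.2.2.2) ^ 2 := by fun_prop
    refine Tendsto.congr' ?_ ((hF.tendsto' (0, 0, 0, 0, 0) 0 (by simp)).comp
      (hsq.prodMk_nhds (hsm.prodMk_nhds (hbias.prodMk_nhds (hc.prodMk_nhds htr)))))
    filter_upwards [hA1] with n hn
    simp only [Function.comp_apply, quadErr, sum_offDiag, hn]
    ring
  have hev : ∀ᶠ n in atTop, quadErr ν (H n) f (A n) C (c n) θ₀ < η ^ 2 * (ε / 8) :=
    hreal.eventually (gt_mem_nhds (by positivity))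
  refine tendsto_of_tendsto_of_tendsto_of_le_of_le' tendsto_const_nhds
    (by simpa using hRlim.div_const c₀) (Eventually.of_forall fun n => measureReal_nonneg) ?_
  filter_upwards [hA, hA1, hδ, hT, hev, eventually_gt_atTop 0, eventually_ge_atTop N] with
    n hAn hA1n hδn hTn hrn hn hNn
  set Z : (Fin n → E d) → ℝ := fun x => (influenceSq (empirical x) f - influenceSq ν f) ^ 2 +
    quadErr (empirical x) (H n) f (A n) C (c n) (T n x) with hZ
  obtain ⟨hqi, hqb⟩ := integrable_and_integral_quadErr_empirical_le (ν := ν) hn (hH n) (hB n)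
    (hsym n) (hH0 n) (hC₁ n) hf hM hAn hA1n hδn hTn
  have hZm : Measurable Z :=
    (((measurable_influenceSq_empirical hn hf hM).sub_const _).pow_const 2).add
      (measurable_quadErr_empirical (hH n) hf hTn)
  have hvi : Integrable (fun x : Fin n → E d =>
      (influenceSq (empirical x) f - influenceSq ν f) ^ 2) (Measure.pi fun _ : Fin n => ν) := by
    refine integrable_of_abs_le
      (((measurable_influenceSq_empirical hn hf hM).sub_const _).pow_const 2)
      (B := ((2 * (M + M)) ^ 2 + influenceSq ν f) ^ 2) fun x => ?_
    have := isProbabilityMeasure_empirical hn x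
    rw [abs_pow]
    refine pow_le_pow_left₀ (abs_nonneg _) ((abs_sub _ _).trans (add_le_add ?_
      (abs_of_nonneg hv.le).le)) 2
    refine abs_integral_le_of_abs_le fun z => ?_
    rw [abs_pow, abs_mul, abs_two]
    have := (abs_sub (f z) (∫ z, f z ∂(empirical x))).trans
      (add_le_add (hM z) (abs_integral_le_of_abs_le hM))
    gcongr
  have hZint : ∫ x, Z x ∂(Measure.pi fun _ : Fin n => ν) ≤ R n := by
    rw [hZ, integral_add hvi hqi]
    refine add_le_add ((integral_sq_influenceSq_empirical_sub_le hn hf hM).trans (le_of_eq ?_)) hqb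
    ring
  -- All randomness of the data enters through `Z`: once `Z < c₀`, the distance is deterministically
  -- below `ε`. Markov's inequality then bounds the probability by `R n / c₀`.
  have hsub : {ω | ε ≤ ‖bootDist μ X θ₀ n (T n) (fun i => X i ω) - 0‖} ⊆
      {ω | c₀ ≤ Z fun i => X i ω} := by
    intro ω hω
    rw [Set.mem_ofPred_eq] at hω ⊢
    by_contra hlt
    rw [not_le] at hlt
    set x : Fin n → E d := fun i => X i ω
    have := isProbabilityMeasure_empirical hn x
    have hq0 := quadErr_nonneg (empirical x) (H n) f (A n) C (c n) (T n x)
    have hd : |influenceSq (empirical x) f - influenceSq ν f| ≤ δ := by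
      refine abs_le_of_sq_le_sq (le_of_lt ?_) hδ0.le
      exact lt_of_le_of_lt (le_add_of_nonneg_right hq0) (hlt.trans_le (min_le_left _ _))
    have hq : quadErr (empirical x) (H n) f (A n) C (c n) (T n x) < η ^ 2 * (ε / 8) :=
      lt_of_le_of_lt (le_add_of_nonneg_left (sq_nonneg _)) (hlt.trans_le (min_le_right _ _))
    have hb := bootDist_le hind hlaw hn (hH n) (hB n) (hsym n) (hH0 n) hf hM hAn hδn hTn hv0 x
      (hN n hNn ν (by
        change |influenceSq ν f - influenceSq ν f| ≤ δ
        simpa using hδ0.le))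
      (hN n hNn (empirical x) hd) θ₀ hηpos
    rw [← hL, hLη] at hb
    have hdiv : (quadErr ν (H n) f (A n) C (c n) θ₀ +
        quadErr (empirical x) (H n) f (A n) C (c n) (T n x)) / η ^ 2 ≤ ε / 4 := by
      rw [div_le_iff₀ (by positivity)]
      linarith
    have hnn : 0 ≤ bootDist μ X θ₀ n (T n) x := Real.iSup_nonneg fun t => abs_nonneg _
    rw [sub_zero, Real.norm_of_nonneg hnn] at hω
    linarith
  refine (measureReal_mono hsub).trans ?_
  have hmap : μ.real {ω | c₀ ≤ Z fun i => X i ω} =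
      (Measure.pi fun _ : Fin n => ν).real {x | c₀ ≤ Z x} := by
    rw [← map_sample_eq hind hlaw n, map_measureReal_apply_of_aemeasurable
      (aemeasurable_sample hlaw n) (measurableSet_le measurable_const hZm)]
    rfl
  rw [hmap, le_div_iff₀ hc₀pos, mul_comm]
  exact (mul_meas_ge_le_integral_of_nonneg (ae_of_all _ fun x => add_nonneg (sq_nonneg _)
    (quadErr_nonneg _ _ _ _ _ _ _)) (hvi.add hqi) c₀).trans hZint

end AvgDensity

end

noncomputable section

namespace AvgDensity

/-! ### The autocorrelation of the kernel -/

variable {d : ℕ}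

theorem norm_le_l1norm (u : E d) : ‖u‖ ≤ l1norm u := by
  rw [EuclideanSpace.norm_eq, Real.sqrt_le_iff]
  exact ⟨Finset.sum_nonneg fun i _ => abs_nonneg _,
    Finset.sum_sq_le_sq_sum_of_nonneg fun i _ => abs_nonneg _⟩

theorem abs_monom_le (u : E d) (l : Fin d → ℕ) : |monom u l| ≤ ‖u‖ ^ ∑ i, l i := by
  rw [monom, Finset.abs_prod, ← Finset.prod_pow_eq_pow_sum]
  refine Finset.prod_le_prod (fun i _ => abs_nonneg _) fun i _ => ?_
  rw [abs_pow]
  exact pow_le_pow_left₀ (abs_nonneg _) (PiLp.norm_apply_le u i) _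

theorem norm_sub_rpow_le {V : Type*} [SeminormedAddCommGroup V] {p : ℝ} (hp : 0 ≤ p) (w y : V) :
    ‖w - y‖ ^ p ≤ 2 ^ p * ‖y‖ ^ p + 2 ^ p * ‖w‖ ^ p := by
  have h1 := Real.rpow_nonneg (norm_nonneg w) p
  have h2 := Real.rpow_nonneg (norm_nonneg y) p
  have h3 : (0 : ℝ) ≤ 2 ^ p := Real.rpow_nonneg zero_le_two p
  rcases le_total ‖w‖ ‖y‖ with h | h
  · have : ‖w - y‖ ≤ 2 * ‖y‖ := (norm_sub_le _ _).trans (by linarith)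
    refine (Real.rpow_le_rpow (norm_nonneg _) this hp).trans ?_
    rw [Real.mul_rpow zero_le_two (norm_nonneg _)]
    exact le_add_of_nonneg_right (mul_nonneg h3 h1)
  · have : ‖w - y‖ ≤ 2 * ‖w‖ := (norm_sub_le _ _).trans (by linarith)
    refine (Real.rpow_le_rpow (norm_nonneg _) this hp).trans ?_
    rw [Real.mul_rpow zero_le_two (norm_nonneg _)]
    exact le_add_of_nonneg_left (mul_nonneg h3 h2)

variable {P : ℝ} {K : E d → ℝ}

theorem CondK.P_pos (hK : CondK d P K) : 0 < P := lt_of_le_of_lt (by positivity) hK.P_gt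

theorem CondK.integrable_mul_rpow (hK : CondK d P K) {p : ℝ} (hp : 0 ≤ p) (hpP : p ≤ P) :
    Integrable fun u => |K u| * ‖u‖ ^ p := by
  have hm := hK.measurable
  refine hK.integrable.mono' (by fun_prop : Measurable _).aestronglyMeasurable
    (ae_of_all _ fun u => ?_)
  have h1 := Real.rpow_nonneg (norm_nonneg u) p
  rw [Real.norm_of_nonneg (by positivity)]
  refine mul_le_mul_of_nonneg_left ((rpow_le_one_add_rpow (norm_nonneg u) hp hpP).trans ?_)
    (abs_nonneg _)
  have := Real.rpow_le_rpow (norm_nonneg u) (norm_le_l1norm u) hK.P_pos.le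
  linarith

theorem CondK.integrable_kernel (hK : CondK d P K) : Integrable K := by
  have := hK.integrable_mul_rpow le_rfl hK.P_pos.le
  simp only [Real.rpow_zero, mul_one] at this
  exact (integrable_norm_iff hK.measurable.aestronglyMeasurable).1 this

theorem CondK.integrable_mul_of_abs_le (hK : CondK d P K) {φ : E d → ℝ} (hφ : Measurable φ)
    {m : ℕ} (hm : (m : ℝ) < P) {C : ℝ} (h : ∀ u, |φ u| ≤ C * ‖u‖ ^ m) :
    Integrable fun u => K u * φ u := by
  refine ((hK.integrable_mul_rpow (Nat.cast_nonneg m) hm.le).const_mul C).mono'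
    (hK.measurable.mul hφ).aestronglyMeasurable (ae_of_all _ fun u => ?_)
  rw [Real.norm_eq_abs, abs_mul, Real.rpow_natCast]
  calc |K u| * |φ u| ≤ |K u| * (C * ‖u‖ ^ m) := by gcongr; exact h u
    _ = _ := by ring

theorem abs_inner_pow_le (u ξ : E d) (m : ℕ) : |(inner ℝ u ξ) ^ m| ≤ ‖ξ‖ ^ m * ‖u‖ ^ m := by
  rw [abs_pow, ← mul_pow, mul_comm]
  exact pow_le_pow_left₀ (abs_nonneg _) (abs_real_inner_le_norm u ξ) m

theorem CondK.integrable_mul_inner_pow (hK : CondK d P K) {m : ℕ} (hm : (m : ℝ) < P) (ξ : E d) :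
    Integrable fun u => K u * (inner ℝ u ξ) ^ m :=
  hK.integrable_mul_of_abs_le (by fun_prop) hm fun u => abs_inner_pow_le u ξ m

/-- The multinomial theorem reduces powers of a linear form to the monomials in the moment
condition. -/
theorem CondK.integral_mul_inner_pow (hK : CondK d P K) {m : ℕ} (hm0 : 0 < m) (hm : (m : ℝ) < P)
    (ξ : E d) : ∫ u, K u * (inner ℝ u ξ) ^ m = 0 := by
  have e : ∀ u : E d, K u * (inner ℝ u ξ) ^ m = ∑ k ∈ Finset.univ.piAntidiag m,
      (Nat.multinomial Finset.univ k * ∏ i, ξ i ^ k i) * (K u * monom u k) := fun u => by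
    have : inner ℝ u ξ = ∑ i, u i * ξ i := by
      rw [PiLp.inner_apply]
      exact Finset.sum_congr rfl fun i _ => by simp [mul_comm]
    rw [this, Finset.sum_pow_eq_sum_piAntidiag, Finset.mul_sum]
    refine Finset.sum_congr rfl fun k _ => ?_
    simp only [mul_pow, Finset.prod_mul_distrib, monom]
    ring
  simp_rw [e]
  have hk : ∀ k ∈ (Finset.univ : Finset (Fin d)).piAntidiag m, ∑ i, k i = m := fun k hk =>
    (Finset.mem_piAntidiag.1 hk).1
  rw [integral_finsetSum]
  · refine Finset.sum_eq_zero fun k hkm => ?_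
    rw [integral_const_mul]
    have := hK.moment_zero k (by rwa [hk k hkm]) (by rwa [hk k hkm])
    simp_rw [mul_comm (K _)]
    rw [this, mul_zero]
  · intro k hkm
    refine (hK.integrable_mul_of_abs_le (C := 1) ?_ hm fun u => ?_).const_mul _
    · unfold monom
      fun_prop
    · rw [one_mul, ← hk k hkm]
      exact abs_monom_le u k

/-- The autocorrelation `∫ K(y) K(y + u) dy` of `K`. -/
def autocorr (K : E d → ℝ) (u : E d) : ℝ := ∫ y, K y * K (y + u)

/-- The shear `(y, u) ↦ (y, y + u)` preserves Lebesgue measure. It turns integrals against the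
autocorrelation into double integrals against `K ⊗ K`, so the moments of `autocorr K` come from
those of `K`. -/
theorem integrable_and_integral_autocorr_mul {φ : E d → ℝ}
    (hi : Integrable (fun z : E d × E d => K z.1 * K z.2 * φ (z.2 - z.1))
      ((volume : Measure (E d)).prod volume)) :
    Integrable (fun u => autocorr K u * φ u) ∧ ∫ u, autocorr K u * φ u =
      ∫ z, K z.1 * K z.2 * φ (z.2 - z.1) ∂((volume : Measure (E d)).prod volume) := by
  have hp := measurePreserving_prod_add (volume : Measure (E d)) volume
  have hG := (hp.integrable_comp hi.aestronglyMeasurable).2 hi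
  have e : ((fun z : E d × E d => K z.1 * K z.2 * φ (z.2 - z.1)) ∘ fun z => (z.1, z.1 + z.2)) =
      fun z : E d × E d => K z.1 * K (z.1 + z.2) * φ z.2 := by
    funext z
    simp
  rw [e] at hG
  have e2 : ∀ u, ∫ y, K y * K (y + u) * φ u = autocorr K u * φ u := fun u => by
    rw [integral_mul_const, autocorr]
  constructor
  · refine hG.integral_prod_right.congr (ae_of_all _ fun u => ?_)
    exact e2 u
  · have h1 : ∫ z, K z.1 * K z.2 * φ (z.2 - z.1) ∂((volume : Measure (E d)).prod volume) =
        ∫ z, K z.1 * K (z.1 + z.2) * φ z.2 ∂((volume : Measure (E d)).prod volume) := by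
      rw [← e]
      conv_lhs => rw [← hp.map_eq]
      rw [integral_map hp.measurable.aemeasurable]
      · rfl
      · rw [hp.map_eq]; exact hi.aestronglyMeasurable
    rw [h1, integral_prod_symm _ hG]
    exact integral_congr_ae (ae_of_all _ fun u => (e2 u).symm)

theorem integrable_mul_mul_sub (hK : Integrable K) (hm : Measurable K) {φ : E d → ℝ}
    (hφ : Measurable φ) {a : E d → ℝ} (ha : Integrable fun u => |K u| * a u)
    (h : ∀ y w, |φ (w - y)| ≤ a y + a w) :
    Integrable (fun z : E d × E d => K z.1 * K z.2 * φ (z.2 - z.1))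
      ((volume : Measure (E d)).prod volume) := by
  refine ((ha.mul_prod hK.abs).add (hK.abs.mul_prod ha)).mono'
    (by fun_prop : Measurable _).aestronglyMeasurable (ae_of_all _ fun z => ?_)
  rw [Real.norm_eq_abs, abs_mul, abs_mul, Pi.add_apply]
  calc |K z.1| * |K z.2| * |φ (z.2 - z.1)| ≤ |K z.1| * |K z.2| * (a z.1 + a z.2) := by
        gcongr; exact h _ _
    _ = _ := by ring

theorem CondK.integrable_mul_mul_sub_rpow (hK : CondK d P K) {φ : E d → ℝ} (hφ : Measurable φ)
    {p : ℝ} (hp : 0 ≤ p) (hpP : p ≤ P) {C : ℝ} (hC : 0 ≤ C) (h : ∀ u, |φ u| ≤ C * ‖u‖ ^ p) :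
    Integrable (fun z : E d × E d => K z.1 * K z.2 * φ (z.2 - z.1))
      ((volume : Measure (E d)).prod volume) := by
  refine integrable_mul_mul_sub hK.integrable_kernel hK.measurable hφ
    (a := fun u => C * 2 ^ p * ‖u‖ ^ p) ?_ fun y w => ?_
  · refine ((hK.integrable_mul_rpow hp hpP).const_mul (C * 2 ^ p)).congr (ae_of_all _ fun u => ?_)
    simp only
    ring
  · refine (h _).trans ((mul_le_mul_of_nonneg_left (norm_sub_rpow_le hp w y) hC).trans
      (le_of_eq ?_))
    ring

/-- Mass, moments and bounds pass from `K` to its autocorrelation through the double integral;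
evenness is automatic by translation. -/
theorem CondK.evenKernel_autocorr (hK : CondK d P K) : EvenKernel P (autocorr K) := by
  have hKi := hK.integrable_kernel
  have hm := hK.measurable
  have hmeas : Measurable (autocorr K) := by
    have : Measurable (Function.uncurry fun u y => K y * K (y + u)) := by
      unfold Function.uncurry; fun_prop
    exact (this.stronglyMeasurable.integral_prod_right).measurable
  have h0 := integrable_and_integral_autocorr_mul (K := K) (φ := fun _ => 1) (by
    simpa using hKi.mul_prod hKi)
  simp only [mul_one] at h0
  refine ⟨hmeas, ?_, ?_, h0.1, ?_, ?_, ?_⟩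
  · obtain ⟨M, hM⟩ := hK.bounded
    refine ⟨∫ y, |K y| * M, fun u => ?_⟩
    refine norm_integral_le_of_norm_le (f := fun y => K y * K (y + u)) (hKi.abs.mul_const M) (ae_of_all _ fun y => ?_)
    rw [Real.norm_eq_abs, abs_mul]
    exact mul_le_mul_of_nonneg_left (hM _) (abs_nonneg _)
  · intro u
    rw [autocorr, autocorr, ← integral_add_right_eq_self _ u]
    refine integral_congr_ae (ae_of_all _ fun y => ?_)
    simp only [add_neg_cancel_right]
    ring
  · have h1 := (integrable_and_integral_autocorr_mul (K := K) (φ := fun u => ‖u‖ ^ P)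
      (hK.integrable_mul_mul_sub_rpow (φ := fun u => ‖u‖ ^ P) (by fun_prop) hK.P_pos.le le_rfl zero_le_one fun u => by
        rw [one_mul, abs_of_nonneg (Real.rpow_nonneg (norm_nonneg u) P)])).1.abs
    refine h1.congr (ae_of_all _ fun u => ?_)
    simp only
    rw [abs_mul, abs_of_nonneg (Real.rpow_nonneg (norm_nonneg u) P)]
  · rw [h0.2, integral_prod_mul, hK.integral_one, one_mul]
  · intro k hk hkP ξ
    have hkP' : ((2 * k : ℕ) : ℝ) < P := by exact_mod_cast hkP
    rw [(integrable_and_integral_autocorr_mul (φ := fun u => (inner ℝ u ξ) ^ (2 * k))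
      (hK.integrable_mul_mul_sub_rpow (φ := fun u => (inner ℝ u ξ) ^ (2 * k)) (by fun_prop)
        (Nat.cast_nonneg (2 * k)) hkP'.le (C := ‖ξ‖ ^ (2 * k)) (by positivity) fun u => by
          rw [Real.rpow_natCast]; exact abs_inner_pow_le u ξ _)).2]
    have e : ∀ z : E d × E d, K z.1 * K z.2 * (inner ℝ (z.2 - z.1) ξ) ^ (2 * k) =
        ∑ i ∈ Finset.range (2 * k + 1), ((2 * k).choose i * (-1) ^ (2 * k - i)) *
          ((K z.1 * (inner ℝ z.1 ξ) ^ (2 * k - i)) * (K z.2 * (inner ℝ z.2 ξ) ^ i)) := fun z => by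
      rw [inner_sub_left, sub_eq_add_neg, add_pow, Finset.mul_sum]
      refine Finset.sum_congr rfl fun i _ => ?_
      rw [neg_pow]
      ring
    have hlt : ∀ i ∈ Finset.range (2 * k + 1), ((i : ℕ) : ℝ) < P ∧ ((2 * k - i : ℕ) : ℝ) < P := by
      intro i hi
      have hi' : i ≤ 2 * k := Nat.lt_succ_iff.1 (Finset.mem_range.1 hi)
      exact ⟨lt_of_le_of_lt (by exact_mod_cast hi') hkP',
        lt_of_le_of_lt (by exact_mod_cast Nat.sub_le _ _) hkP'⟩
    simp_rw [e]
    rw [integral_finsetSum]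
    · refine Finset.sum_eq_zero fun i hi => ?_
      rw [integral_const_mul, integral_prod_mul (fun y => K y * (inner ℝ y ξ) ^ (2 * k - i))
        (fun y => K y * (inner ℝ y ξ) ^ i)]
      -- The two exponents `i` and `2k - i` sum to `2k > 0`, so at least one is positive and the
      -- corresponding moment of `K` vanishes.
      rcases Nat.eq_zero_or_pos i with h | h
      · rw [hK.integral_mul_inner_pow (by omega) (hlt i hi).2 ξ, zero_mul, mul_zero]
      · rw [hK.integral_mul_inner_pow h (hlt i hi).1 ξ, mul_zero, mul_zero]
    · intro i hi
      exact ((hK.integrable_mul_inner_pow (hlt i hi).2 ξ).mul_prod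
        (hK.integrable_mul_inner_pow (hlt i hi).1 ξ)).const_mul _

/-! ### Rescaled kernels -/

theorem integral_scaledKernel_mul {κ : E d → ℝ} {h : ℝ} (hh : 0 < h) (φ : E d → ℝ) :
    ∫ u, scaledKernel κ h u * φ u = ∫ v, κ v * φ (h • v) := by
  have e : (fun u => scaledKernel κ h u * φ u) = fun u =>
      1 / h ^ d * (fun v => κ v * φ (h • v)) (h⁻¹ • u) := by
    funext u
    simp only [scaledKernel, smul_smul, mul_inv_cancel₀ hh.ne', one_smul]
    ring
  rw [e, integral_const_mul, Measure.integral_comp_inv_smul volume (fun v => κ v * φ (h • v)) h]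
  simp only [finrank_euclideanSpace, Fintype.card_fin, smul_eq_mul, abs_of_pos (pow_pos hh d)]
  rw [← mul_assoc, one_div_mul_cancel (pow_pos hh d).ne', one_mul]

theorem integrable_scaledKernel {κ : E d → ℝ} (hκ : Integrable κ) {h : ℝ} (hh : 0 < h) :
    Integrable (scaledKernel κ h) :=
  (hκ.comp_smul (inv_ne_zero hh.ne')).const_mul _

/-- This identity turns all the estimators into quadratic statistics with one and the same kernel
family. -/
theorem integral_scaledKernel_mul_scaledKernel (K : E d → ℝ) {h : ℝ} (hh : 0 < h) (a b : E d) :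
    ∫ y, scaledKernel K h (y - a) * scaledKernel K h (y - b) =
      scaledKernel (autocorr K) h (a - b) := by
  rw [← integral_add_right_eq_self _ a]
  simp only [add_sub_cancel_right]
  rw [integral_scaledKernel_mul hh (fun y => scaledKernel K h (y + a - b)), scaledKernel,
    autocorr, ← integral_const_mul]
  refine integral_congr_ae (ae_of_all _ fun y => ?_)
  simp only [scaledKernel, smul_sub, smul_add, smul_smul, inv_mul_cancel₀ hh.ne', one_smul]
  rw [add_sub_assoc]
  ring

theorem CondK.integrable_scaledKernel_mul (hK : CondK d P K) {h : ℝ} (hh : 0 < h) (a b : E d) :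
    Integrable fun y => scaledKernel K h (y - a) * scaledKernel K h (y - b) := by
  obtain ⟨M, hM⟩ := hK.bounded
  have hm := measurable_scaledKernel hK.measurable h
  refine Integrable.mul_bdd (c := M / h ^ d)
    ((integrable_scaledKernel hK.integrable_kernel hh).comp_sub_right a)
    (by fun_prop : Measurable _).aestronglyMeasurable (ae_of_all _ fun y => ?_)
  exact abs_scaledKernel_le hM hh _

theorem CondK.integral_sum_mul_sum (hK : CondK d P K) {h : ℝ} (hh : 0 < h) {n : ℕ}
    (x : Fin n → E d) (a b : Fin n → ℝ) :
    ∫ y, (∑ j, a j * scaledKernel K h (y - x j)) * (∑ k, b k * scaledKernel K h (y - x k)) =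
      ∑ j, ∑ k, a j * b k * scaledKernel (autocorr K) h (x j - x k) := by
  have e : ∀ y, (∑ j, a j * scaledKernel K h (y - x j)) *
      (∑ k, b k * scaledKernel K h (y - x k)) = ∑ j, ∑ k, a j * b k *
        (scaledKernel K h (y - x j) * scaledKernel K h (y - x k)) := fun y => by
    rw [Finset.sum_mul_sum]
    exact Finset.sum_congr rfl fun j _ => Finset.sum_congr rfl fun k _ => by ring
  have hi : ∀ j k, Integrable fun y => a j * b k *
      (scaledKernel K h (y - x j) * scaledKernel K h (y - x k)) := fun j k =>
    (hK.integrable_scaledKernel_mul hh _ _).const_mul _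
  simp_rw [e]
  rw [integral_finsetSum _ fun j _ => integrable_finsetSum _ fun k _ => hi j k]
  refine Finset.sum_congr rfl fun j _ => ?_
  rw [integral_finsetSum _ fun k _ => hi j k]
  refine Finset.sum_congr rfl fun k _ => ?_
  rw [integral_const_mul, integral_scaledKernel_mul_scaledKernel K hh]

theorem EvenKernel.scaledKernel {κ : E d → ℝ} (hκ : EvenKernel P κ) {c : ℝ} (hc : 0 < c) :
    EvenKernel P (scaledKernel κ c) := by
  obtain ⟨M, hM⟩ := hκ.bounded
  refine ⟨measurable_scaledKernel hκ.measurable c, ⟨M / c ^ d, abs_scaledKernel_le hM hc⟩,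
    scaledKernel_neg hκ.even c, integrable_scaledKernel hκ.integrable hc, ?_, ?_, ?_⟩
  · refine ((hκ.integrable_rpow.comp_smul (inv_ne_zero hc.ne')).const_mul
      (1 / c ^ d * c ^ P)).congr (ae_of_all _ fun v => ?_)
    simp only [AvgDensity.scaledKernel]
    rw [norm_smul, Real.norm_of_nonneg (inv_nonneg.2 hc.le), Real.mul_rpow (inv_nonneg.2 hc.le)
      (norm_nonneg _), abs_mul, abs_of_pos (by positivity : 0 < 1 / c ^ d), Real.inv_rpow hc.le]
    have := (Real.rpow_pos_of_pos hc P).ne'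
    field_simp
  · have := integral_scaledKernel_mul (κ := κ) hc fun _ => 1
    simp only [mul_one] at this
    rw [this, hκ.integral_one]
  · intro k hk hkP ξ
    rw [integral_scaledKernel_mul hc fun v => (inner ℝ v ξ) ^ (2 * k)]
    have e : ∀ v, κ v * (inner ℝ (c • v) ξ) ^ (2 * k) =
        c ^ (2 * k) * (κ v * (inner ℝ v ξ) ^ (2 * k)) := fun v => by
      rw [real_inner_smul_left, mul_pow]; ring
    simp_rw [e]
    rw [integral_const_mul, hκ.moment_zero k hk hkP ξ, mul_zero]

/-- For the generalized jackknife: combining bandwidths `h` and `c h` amounts to one bandwidth `h`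
with a new kernel. The coefficients may be negative, so only mass one matters. -/
theorem EvenKernel.affine_combination {κ κ' : E d → ℝ} (hκ : EvenKernel P κ)
    (hκ' : EvenKernel P κ') {a b : ℝ} (hab : a + b = 1) :
    EvenKernel P fun u => a * κ u + b * κ' u := by
  have hm := hκ.measurable
  have hm' := hκ'.measurable
  obtain ⟨M, hM⟩ := hκ.bounded
  obtain ⟨M', hM'⟩ := hκ'.bounded
  refine ⟨by fun_prop, ⟨|a| * M + |b| * M', fun u => ?_⟩, fun u => by rw [hκ.even, hκ'.even],
    (hκ.integrable.const_mul a).add (hκ'.integrable.const_mul b), ?_, ?_, ?_⟩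
  · refine (abs_add_le _ _).trans ?_
    rw [abs_mul, abs_mul]
    have := hM u
    have := hM' u
    gcongr
  · refine ((hκ.integrable_rpow.const_mul |a|).add (hκ'.integrable_rpow.const_mul |b|)).mono'
      (by fun_prop : Measurable _).aestronglyMeasurable (ae_of_all _ fun u => ?_)
    have h0 := Real.rpow_nonneg (norm_nonneg u) P
    rw [Real.norm_of_nonneg (by positivity)]
    refine (mul_le_mul_of_nonneg_right (abs_add_le _ _) h0).trans (le_of_eq ?_)
    rw [abs_mul, abs_mul, Pi.add_apply]
    ring
  · rw [integral_add (hκ.integrable.const_mul a) (hκ'.integrable.const_mul b), integral_const_mul,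
      integral_const_mul, hκ.integral_one, hκ'.integral_one, mul_one, mul_one, hab]
  · intro k hk hkP ξ
    have e : ∀ v, (a * κ v + b * κ' v) * (inner ℝ v ξ) ^ (2 * k) =
        a * (κ v * (inner ℝ v ξ) ^ (2 * k)) + b * (κ' v * (inner ℝ v ξ) ^ (2 * k)) :=
      fun v => by ring
    simp_rw [e]
    have hkP' : ((2 * k : ℕ) : ℝ) ≤ P := by exact_mod_cast hkP.le
    rw [integral_add ((hκ.integrable_mul_inner_pow hkP' ξ).const_mul a)
      ((hκ'.integrable_mul_inner_pow hkP' ξ).const_mul b), integral_const_mul,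
      integral_const_mul, hκ.moment_zero k hk hkP ξ, hκ'.moment_zero k hk hkP ξ]
    simp

theorem scaledKernel_scaledKernel (κ : E d → ℝ) {c h : ℝ} (u : E d) :
    scaledKernel (scaledKernel κ c) h u = scaledKernel κ (c * h) u := by
  simp only [scaledKernel, smul_smul, mul_inv, mul_pow, one_div]
  ring

end AvgDensity

end

noncomputable section

namespace AvgDensity

/-! ### Bootstrap consistency for quadratic statistics with a rescaled kernel -/

variable {d : ℕ}

theorem tendsto_bandwidth_zero {r : ℝ} (hr : 0 < r) {h : ℕ → ℝ} (h_pos : ∀ n, 0 < h n)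
    (hup : Tendsto (fun n : ℕ => (n : ℝ) * h n ^ r) atTop (𝓝 0)) : Tendsto h atTop (𝓝 0) := by
  have h1 : Tendsto (fun n => h n ^ r) atTop (𝓝 0) := by
    refine squeeze_zero' (Eventually.of_forall fun n => Real.rpow_nonneg (h_pos n).le r) ?_ hup
    filter_upwards [eventually_ge_atTop 1] with n hn
    have hn' : (1 : ℝ) ≤ n := by exact_mod_cast hn
    exact le_mul_of_one_le_left (Real.rpow_nonneg (h_pos n).le r) hn'
  have h2 := h1.rpow_const (p := r⁻¹) (Or.inr (inv_nonneg.2 hr.le))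
  rw [Real.zero_rpow (inv_ne_zero hr.ne')] at h2
  refine h2.congr fun n => ?_
  rw [← Real.rpow_mul (h_pos n).le, mul_inv_cancel₀ hr.ne', Real.rpow_one]

theorem tendsto_one_div_bandwidth {h : ℕ → ℝ}
    (hlow : Tendsto (fun n : ℕ => (n : ℝ) * h n ^ d) atTop atTop) :
    Tendsto (fun n : ℕ => 1 / h n ^ d / n) atTop (𝓝 0) := by
  refine hlow.inv_tendsto_atTop.congr fun n => ?_
  rw [Pi.inv_apply, mul_inv, div_div, one_div, mul_inv, mul_comm]

theorem tendsto_sqrt_mul_rpow {S : ℝ} {h : ℕ → ℝ} (h_pos : ∀ n, 0 < h n)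
    (hup : Tendsto (fun n : ℕ => (n : ℝ) * h n ^ (4 * S)) atTop (𝓝 0)) :
    Tendsto (fun n : ℕ => √(n : ℝ) * h n ^ (2 * S)) atTop (𝓝 0) := by
  have h1 := (Real.continuous_sqrt.tendsto 0).comp hup
  rw [Real.sqrt_zero] at h1
  refine h1.congr fun n => ?_
  rw [Function.comp_apply, Real.sqrt_mul (Nat.cast_nonneg n),
    show 4 * S = 2 * S * (2 : ℕ) by push_cast; ring, Real.rpow_mul (h_pos n).le,
    Real.rpow_natCast, Real.sqrt_sq (Real.rpow_nonneg (h_pos n).le _)]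

theorem influenceSq_densityLaw {f : E d → ℝ} (hf : Measurable f) {M : ℝ} (hM : ∀ x, |f x| ≤ M)
    [IsProbabilityMeasure (densityLaw f)] : influenceSq (densityLaw f) f = sigma0Sq f := by
  have hi : Measurable (influence f) := by unfold influence; fun_prop
  have h0 : ∫ x, influence f x ∂(densityLaw f) = 0 := by
    unfold influence
    rw [integral_const_mul, integral_sub (integrable_of_abs_le hf hM) (integrable_const _)]
    simp [theta0]
  rw [sigma0Sq, variance_eq_integral hi.aemeasurable, h0]
  simp only [sub_zero]
  rfl

/-- The matrices `A n` have total mass one, entries of order `n⁻²`, and off-diagonal row and column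
sums which agree with those of the uniform matrix up to order `n⁻²`. -/
def NearUniform (A : ∀ n, Fin n → Fin n → ℝ) : Prop :=
  ∃ C : ℝ, ∀ᶠ n : ℕ in atTop, (∀ j k, |A n j k| ≤ C / n ^ 2) ∧ ∑ j, ∑ k, A n j k = 1 ∧
    ∀ j, |∑ k, (offDiag (A n) j k + offDiag (A n) k j) - 2 / n| ≤ C / n ^ 2

variable {Ω : Type*} [MeasurableSpace Ω] {μ : Measure Ω} [IsProbabilityMeasure μ]
  {X : ℕ → Ω → E d} {f₀ : E d → ℝ} {s P : ℝ} {κ : E d → ℝ} {h : ℕ → ℝ}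
  {A : ∀ n, Fin n → Fin n → ℝ} {c : ℕ → ℝ} {T : ∀ n, (Fin n → E d) → ℝ}

/-- The moment conditions of the general theorem become rates in the bandwidth: `κ(0)/(n h^d)` and
`kernelSq / n` vanish by `n h^d → ∞`, the smoothing error by `h → 0`, and the bias `√n h^(2S)` by `n
h^(4S) → 0`. The diagonal condition is left to each estimator. -/
theorem bootstrapConsistent_of_kernel (hf : Measurable f₀) (h0 : ∀ x, 0 ≤ f₀ x)
    (hind : iIndepFun X μ) (hlaw : ∀ i, HasLaw (X i) (densityLaw f₀) μ) (hσ : 0 < sigma0Sq f₀)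
    (hD : CondD d s f₀) (hκ : EvenKernel P κ) (hP : (d : ℝ) / 2 < P) (h_pos : ∀ n, 0 < h n)
    (hup : Tendsto (fun n : ℕ => (n : ℝ) * h n ^ (4 * min (P / 2) s)) atTop (𝓝 0))
    (hlow : Tendsto (fun n : ℕ => (n : ℝ) * h n ^ d) atTop atTop) (hA : NearUniform A)
    (hdiag : Tendsto (fun n : ℕ => √(n : ℝ) *
      (((1 - ∑ j, A n j j) / n - ∑ j, A n j j) * (1 / h n ^ d))) atTop (𝓝 0))
    (hc : Tendsto (fun n : ℕ => √(n : ℝ) * c n) atTop (𝓝 0))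
    (hT : ∀ᶠ n in atTop, ∀ y, T n y =
      ∑ j, ∑ k, A n j k * scaledKernel κ (h n) (y j - y k) + c n) :
    BootstrapConsistent μ X (theta0 f₀) T := by
  have hprob : IsProbabilityMeasure (densityLaw f₀) := (hlaw 0).isProbabilityMeasure_iff.1 ‹_›
  obtain ⟨M, hM⟩ := hD.bounded
  obtain ⟨B, hB⟩ := hκ.bounded
  obtain ⟨C, hAC⟩ := hA
  have hM' : ∀ x, |f₀ x| ≤ M := fun x => by rw [abs_of_nonneg (h0 x)]; exact hM x
  have h1 := integrable_of_isProbabilityMeasure_densityLaw hf h0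
  have h2 : MemLp f₀ 2 volume := hD.besov.1
  have hs : 0 < s := lt_of_le_of_lt (by positivity) hD.s_gt
  have hP0 : 0 < P := lt_of_le_of_lt (by positivity) hP
  have hS : 0 < min (P / 2) s := lt_min (by positivity) hs
  have hlim : Tendsto h atTop (𝓝 0) := tendsto_bandwidth_zero (by positivity) h_pos hup
  have hnh := tendsto_one_div_bandwidth hlow
  have hzero : ∀ n, scaledKernel κ (h n) 0 = 1 / h n ^ d * κ 0 := fun n => by
    rw [scaledKernel, smul_zero]
  refine bootstrapConsistent_of_quadratic (H := fun n x z => scaledKernel κ (h n) (x - z))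
    (H₀ := fun n => scaledKernel κ (h n) 0) (C₁ := M * ∫ v, |κ v|) hind hlaw hf hM'
    (by rwa [influenceSq_densityLaw hf hM'])
    (fun n => (measurable_scaledKernel hκ.measurable (h n)).comp
      (measurable_fst.sub measurable_snd))
    (fun n => ⟨B / h n ^ d, fun x y => abs_scaledKernel_le hB (h_pos n) _⟩)
    (fun n x y => by rw [← scaledKernel_neg hκ.even, neg_sub])
    (fun n x => by rw [sub_self])
    (fun n x => (abs_integral_le_integral_abs).trans
      (abs_integral_scaledKernel_le hκ hf h0 hM (h_pos n) x)) ?_ ?_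
    (tendsto_integral_smooth_sub_sq hκ hf h0 hM h1 h2 h_pos hlim) ?_
    (hAC.mono fun n hn => hn.1) (hAC.mono fun n hn => hn.2.1) (hAC.mono fun n hn => hn.2.2) ?_
    hc hT
  · have := hnh.mul_const (κ 0)
    rw [zero_mul] at this
    refine this.congr fun n => ?_
    rw [hzero]; ring
  · have := hnh.const_mul (B * (M * ∫ v, |κ v|))
    rw [mul_zero] at this
    refine squeeze_zero (fun n => div_nonneg (kernelSq_nonneg _ _) (Nat.cast_nonneg n))
      (fun n => ?_) this
    refine (div_le_div_of_nonneg_right (integral_integral_scaledKernel_sq_le hκ hf h0 hM hB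
      (h_pos n)) (Nat.cast_nonneg n)).trans (le_of_eq ?_)
    ring
  · obtain ⟨C', hC'⟩ := hκ.exists_bias_bound h1 hD.besov hs hD.two_s_not_nat hP0
    have := (tendsto_sqrt_mul_rpow h_pos hup).const_mul (C' / 2)
    rw [mul_zero] at this
    refine squeeze_zero_norm (fun n => ?_) this
    have e : kernelMean (densityLaw f₀) (fun x z => scaledKernel κ (h n) (x - z)) - theta0 f₀ =
        -((∫ v, κ v * transSq f₀ (h n • v)) / 2) := by
      rw [kernelMean, integral_theta_eq hκ hf h0 hM h1 h2 (h_pos n)]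
      ring
    have hmin : min P (2 * s) = 2 * min (P / 2) s := by
      rw [mul_min_of_nonneg _ _ zero_le_two, mul_div_cancel₀ _ two_ne_zero]
    have hb := hC' (h n) (h_pos n)
    rw [hmin] at hb
    rw [e, Real.norm_eq_abs, abs_mul, abs_of_nonneg (Real.sqrt_nonneg _), abs_neg, abs_div,
      abs_two]
    calc √(n : ℝ) * (|∫ v, κ v * transSq f₀ (h n • v)| / 2)
        ≤ √(n : ℝ) * (C' * h n ^ (2 * min (P / 2) s) / 2) := by gcongr
      _ = _ := by ring
  · have := hdiag.mul_const (κ 0)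
    rw [zero_mul] at this
    refine this.congr fun n => ?_
    rw [hzero]; ring

/-! ### The diagonal condition -/

/-- The sequence is the reciprocal of `√(n h^(2d))`. -/
theorem tendsto_sqrt_mul_one_div_of_condBPlus
    (hlow : Tendsto (fun n : ℕ => (n : ℝ) * h n ^ (2 * d)) atTop atTop)
    (h_pos : ∀ n, 0 < h n) :
    Tendsto (fun n : ℕ => √(n : ℝ) * (1 / n * (1 / h n ^ d))) atTop (𝓝 0) := by
  have h1 := (Real.tendsto_sqrt_atTop.comp hlow).inv_tendsto_atTop
  refine h1.congr fun n => ?_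
  rw [Pi.inv_apply, Function.comp_apply, Real.sqrt_mul (Nat.cast_nonneg n), mul_comm 2 d,
    pow_mul, Real.sqrt_sq (pow_nonneg (h_pos n).le d), mul_inv, ← mul_assoc,
    mul_one_div (√(n : ℝ)) (n : ℝ), Real.sqrt_div_self', one_div, one_div]

theorem CondBPlus.tendsto_mul_pow {S : ℝ} (hS : 0 < S) (h_pos : ∀ n, 0 < h n)
    (hB : CondBPlus d S h) : Tendsto (fun n : ℕ => (n : ℝ) * h n ^ d) atTop atTop := by
  have hlim : Tendsto h atTop (𝓝 0) := tendsto_bandwidth_zero (by positivity) h_pos hB.upper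
  refine tendsto_atTop_mono' _ ?_ hB.lower
  filter_upwards [hlim.eventually (ge_mem_nhds zero_lt_one)] with n hn
  have hp := pow_nonneg (h_pos n).le d
  have : h n ^ (2 * d) ≤ h n ^ d := by
    rw [two_mul, pow_add]
    exact mul_le_of_le_one_left hp (pow_le_one₀ (h_pos n).le hn)
  gcongr

/-- Entries of order `n⁻²` force a trace of order `1/n`, so the mismatch is always `O(1/n)`, which
is what the stronger bandwidth condition can absorb. -/
theorem NearUniform.tendsto_diag (hA : NearUniform A)
    (hlow : Tendsto (fun n : ℕ => (n : ℝ) * h n ^ (2 * d)) atTop atTop)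
    (h_pos : ∀ n, 0 < h n) :
    Tendsto (fun n : ℕ => √(n : ℝ) *
      (((1 - ∑ j, A n j j) / n - ∑ j, A n j j) * (1 / h n ^ d))) atTop (𝓝 0) := by
  obtain ⟨C, hC⟩ := hA
  have h1 := (tendsto_sqrt_mul_one_div_of_condBPlus hlow h_pos).const_mul (1 + 2 * C)
  rw [mul_zero] at h1
  refine squeeze_zero_norm' ?_ h1
  filter_upwards [hC, eventually_gt_atTop 0] with n hn hn0
  have hn' : (0 : ℝ) < n := by exact_mod_cast hn0
  have hn1 : (1 : ℝ) ≤ n := by exact_mod_cast hn0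
  have htr := abs_sum_diag_le hn0 hn.1
  set t := ∑ j, A n j j
  have hh := pow_pos (h_pos n) d
  have hC0 : 0 ≤ C := by
    have := (abs_nonneg _).trans htr
    rwa [le_div_iff₀ hn', zero_mul] at this
  have htr' : |t| ≤ C := htr.trans (div_le_self hC0 hn1)
  have hb : |(1 - t) / n - t| ≤ (1 + 2 * C) / n := by
    refine (abs_sub _ _).trans ?_
    rw [abs_div, abs_of_pos hn']
    have : |1 - t| ≤ 1 + C := (abs_sub _ _).trans (by rw [abs_one]; linarith)
    calc |1 - t| / n + |t| ≤ (1 + C) / n + C / n := by gcongr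
      _ = _ := by ring
  rw [Real.norm_eq_abs, abs_mul, abs_of_nonneg (Real.sqrt_nonneg _), abs_mul,
    abs_of_pos (by positivity : 0 < 1 / h n ^ d)]
  calc √(n : ℝ) * (|(1 - t) / n - t| * (1 / h n ^ d))
      ≤ √(n : ℝ) * ((1 + 2 * C) / n * (1 / h n ^ d)) := by gcongr
    _ = _ := by ring

/-- The diagonal condition holds without a stronger lower bound on the bandwidth if the diagonal
of `A n` has almost the mass of the diagonal of the uniform matrix. -/
theorem tendsto_diag_of_abs_le
    (hlow : Tendsto (fun n : ℕ => (n : ℝ) * h n ^ d) atTop atTop) (h_pos : ∀ n, 0 < h n) {C : ℝ}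
    (hC : ∀ᶠ n : ℕ in atTop, |(1 - ∑ j, A n j j) / n - ∑ j, A n j j| ≤ C / n ^ 2) :
    Tendsto (fun n : ℕ => √(n : ℝ) *
      (((1 - ∑ j, A n j j) / n - ∑ j, A n j j) * (1 / h n ^ d))) atTop (𝓝 0) := by
  have h1 := ((tendsto_one_div_bandwidth hlow).mul tendsto_sqrt_div_self).const_mul C
  rw [mul_zero, mul_zero] at h1
  refine squeeze_zero_norm' ?_ h1
  filter_upwards [hC] with n hn
  have hh := pow_pos (h_pos n) d
  rw [Real.norm_eq_abs, abs_mul, abs_of_nonneg (Real.sqrt_nonneg _), abs_mul,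
    abs_of_pos (by positivity : 0 < 1 / h n ^ d)]
  calc _ ≤ √(n : ℝ) * (C / n ^ 2 * (1 / h n ^ d)) := by gcongr
    _ = _ := by ring

end AvgDensity

end

noncomputable section

namespace AvgDensity

/-! ### The weights of the estimators -/

variable {n : ℕ}

theorem sum_offDiag_add_offDiag (A : Fin n → Fin n → ℝ) (j : Fin n) :
    ∑ k, (offDiag A j k + offDiag A k j) = ∑ k, A j k + ∑ k, A k j - 2 * A j j := by
  have h1 : ∀ k, offDiag A j k + offDiag A k j =
      A j k + A k j - if j = k then 2 * A j j else 0 := fun k => by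
    by_cases h : j = k
    · subst h
      simp [offDiag, two_mul]
    · simp [offDiag, h, Ne.symm h]
  simp_rw [h1, Finset.sum_sub_distrib, Finset.sum_add_distrib]
  simp

/-! #### Uniform weights -/

theorem nearUniform_uniform : NearUniform fun n _ _ => 1 / (n : ℝ) ^ 2 := by
  refine ⟨2, (eventually_gt_atTop 0).mono fun n hn => ?_⟩
  have hn' : (0 : ℝ) < n := by exact_mod_cast hn
  refine ⟨fun j k => ?_, ?_, fun j => ?_⟩
  · rw [abs_of_pos (by positivity)]
    exact div_le_div_of_nonneg_right one_le_two (by positivity)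
  · simp only [Finset.sum_const, Finset.card_univ, Fintype.card_fin, nsmul_eq_mul]
    field_simp
  · rw [sum_offDiag_add_offDiag]
    simp only [Finset.sum_const, Finset.card_univ, Fintype.card_fin, nsmul_eq_mul]
    have : (n : ℝ) * (1 / n ^ 2) + n * (1 / n ^ 2) - 2 * (1 / n ^ 2) - 2 / n = -(2 / n ^ 2) := by
      field_simp
      ring
    rw [this, abs_neg, abs_of_pos (by positivity)]

/-- The trace is `1/n`, so the mismatch is exactly `-1/n²`. -/
theorem abs_uniform_diag_le (hn : 0 < n) :
    |(1 - ∑ _j : Fin n, 1 / (n : ℝ) ^ 2) / (n : ℝ) - ∑ _j : Fin n, 1 / (n : ℝ) ^ 2| ≤ 1 / (n : ℝ) ^ 2 := by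
  have hn' : (0 : ℝ) < n := by exact_mod_cast hn
  have : (1 - ∑ _j : Fin n, 1 / (n : ℝ) ^ 2) / (n : ℝ) - ∑ _j : Fin n, 1 / (n : ℝ) ^ 2 =
      -(1 / (n : ℝ) ^ 2) := by
    simp only [Finset.sum_const, Finset.card_univ, Fintype.card_fin, nsmul_eq_mul]
    field_simp
    ring
  rw [this, abs_neg, abs_of_pos (by positivity)]

/-! #### Leave-out weights -/

section Block

variable {B : ℕ}

theorem block_le_iff (hn : 0 < n) (i b : ℕ) : block n B i ≤ b ↔ i * B ≤ b * n := by
  have hn' : (0 : ℚ) < n := by exact_mod_cast hn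
  rw [block, Nat.ceil_le, div_le_iff₀ hn']
  exact_mod_cast Iff.rfl

/-- Observation `k + 1` lies in the first `b` blocks exactly when `(k + 1) B ≤ b n`, so there are
`⌊b n / B⌋` such observations. -/
theorem card_block_le (hn : 0 < n) (hB : 0 < B) {b : ℕ} (hb : b ≤ B) :
    (Finset.univ.filter fun k : Fin n => block n B (k + 1) ≤ b).card = b * n / B := by
  have e : (Finset.univ.filter fun k : Fin n => block n B (k + 1) ≤ b) =
      Finset.univ.filter fun k : Fin n => (k : ℕ) < b * n / B := by
    refine Finset.filter_congr fun k _ => ?_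
    rw [block_le_iff hn, Nat.lt_iff_add_one_le, Nat.le_div_iff_mul_le hB]
  rw [e, Fin.card_filter_val_lt, min_eq_right]
  exact Nat.div_le_of_le_mul (Nat.mul_le_mul_right n hb)

theorem block_pos (hn : 0 < n) (hB : 0 < B) (i : ℕ) : 0 < block n B (i + 1) := by
  by_contra h
  have := (block_le_iff hn (i + 1) 0).1 (not_lt.1 h)
  have h2 : 0 < (i + 1) * B := by positivity
  omega

theorem block_le (hn : 0 < n) (i : Fin n) : block n B (i + 1) ≤ B := by
  rw [block_le_iff hn, mul_comm]
  exact Nat.mul_le_mul_left B i.2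

/-- A block size is a difference of two consecutive floors, whose arguments differ by `n / B`. -/
theorem abs_card_block_sub_le (hn : 0 < n) (hB : 0 < B) (i : Fin n) :
    |((Finset.univ.filter fun k : Fin n => block n B (k + 1) = block n B (i + 1)).card : ℝ) -
      n / B| ≤ 1 := by
  set b := block n B (i + 1) with hb
  have hb0 : 0 < b := block_pos hn hB i
  have hbB : b ≤ B := block_le hn i
  have hB' : (0 : ℝ) < B := by exact_mod_cast hB
  have hcard : (Finset.univ.filter fun k : Fin n => block n B (k + 1) = b).card +
      (b - 1) * n / B = b * n / B := by
    rw [← card_block_le hn hB hbB, ← card_block_le hn hB (b := b - 1) (by omega),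
      ← Finset.card_union_of_disjoint]
    · congr 1
      ext k
      simp only [Finset.mem_union, Finset.mem_filter, Finset.mem_univ, true_and]
      omega
    · rw [Finset.disjoint_filter]
      intro k _ h1 h2
      omega
  have hcard' : ((Finset.univ.filter fun k : Fin n => block n B (k + 1) = b).card : ℝ) =
      (b * n / B : ℕ) - ((b - 1) * n / B : ℕ) := by
    rw [← hcard]; push_cast; ring
  have u1 : ((b * n / B : ℕ) : ℝ) ≤ (b * n : ℕ) / B := Nat.cast_div_le
  have u2 : (((b - 1) * n / B : ℕ) : ℝ) ≤ ((b - 1) * n : ℕ) / B := Nat.cast_div_le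
  have l1 : ((b * n : ℕ) : ℝ) / B < (b * n / B : ℕ) + 1 := by
    rw [div_lt_iff₀ hB']
    exact_mod_cast Nat.lt_div_mul_add hB |>.trans_eq (by ring)
  have l2 : (((b - 1) * n : ℕ) : ℝ) / B < ((b - 1) * n / B : ℕ) + 1 := by
    rw [div_lt_iff₀ hB']
    exact_mod_cast Nat.lt_div_mul_add hB |>.trans_eq (by ring)
  have e : ((b * n : ℕ) : ℝ) / B - ((b - 1) * n : ℕ) / B = n / B := by
    push_cast [Nat.cast_sub hb0]
    ring
  rw [hcard', abs_le]
  constructor <;> linarith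

theorem diffBlock_comm (i j : Fin n) : diffBlock B i j = diffBlock B j i := by
  simp only [diffBlock, ne_comm]

theorem diffBlock_nonneg (i j : Fin n) : 0 ≤ diffBlock B i j := by
  rw [diffBlock]; split_ifs <;> norm_num

theorem diffBlock_le_one (i j : Fin n) : diffBlock B i j ≤ 1 := by
  rw [diffBlock]; split_ifs <;> norm_num

theorem abs_sum_diffBlock_sub_le (hn : 0 < n) (hB : 0 < B) (i : Fin n) :
    |∑ k, diffBlock B i k - (n - n / B)| ≤ 1 := by
  have e : ∑ k, diffBlock B i k = n -
      ((Finset.univ.filter fun k : Fin n => block n B (k + 1) = block n B (i + 1)).card : ℝ) := by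
    have : ∀ k, diffBlock B i k =
        1 - if block n B (k + 1) = block n B (i + 1) then (1 : ℝ) else 0 := fun k => by
      rw [diffBlock]
      by_cases h : block n B (k + 1) = block n B (i + 1)
      · simp [h]
      · simp [h, Ne.symm h]
    simp_rw [this, Finset.sum_sub_distrib, Finset.sum_boole]
    simp
  rw [e, abs_sub_comm]
  refine le_trans (le_of_eq ?_) (abs_card_block_sub_le hn hB i)
  congr 1
  ring

/-- With at least two blocks the sum is at least `n - n/2 - 1`, and this exceeds `n/4` from `n = 4`
on. -/
theorem le_sum_diffBlock (hn : 4 ≤ n) (hB : 2 ≤ B) (i : Fin n) :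
    (n : ℝ) / 4 ≤ ∑ k, diffBlock B i k := by
  have h := (abs_le.1 (abs_sum_diffBlock_sub_le (B := B) (by omega) (by omega) i)).1
  have hn' : (4 : ℝ) ≤ n := by exact_mod_cast hn
  have hB' : (2 : ℝ) ≤ B := by exact_mod_cast hB
  have : (n : ℝ) / B ≤ n / 2 := by gcongr
  linarith

theorem weight_nonneg (i j : Fin n) : 0 ≤ weight B i j :=
  div_nonneg (diffBlock_nonneg i j) (Finset.sum_nonneg fun k _ => diffBlock_nonneg i k)

theorem weight_le (hn : 4 ≤ n) (hB : 2 ≤ B) (i j : Fin n) : weight B i j ≤ 4 / n := by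
  have hn' : (0 : ℝ) < n := by exact_mod_cast (by omega : 0 < n)
  have h := le_sum_diffBlock hn hB i
  calc weight B i j ≤ 1 / (n / 4) :=
        div_le_div₀ zero_le_one (diffBlock_le_one i j) (by positivity) h
    _ = 4 / n := by field_simp

theorem sum_weight (hn : 4 ≤ n) (hB : 2 ≤ B) (i : Fin n) : ∑ k, weight B i k = 1 := by
  have hn' : (0 : ℝ) < n := by exact_mod_cast (by omega : 0 < n)
  have h := le_sum_diffBlock hn hB i
  simp only [weight]
  rw [← Finset.sum_div, div_self]
  have : (0 : ℝ) < n / 4 := by positivity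
  linarith

/-- The indicator is symmetric, so with a common normalization the column sums would equal the row
sums, which are one. The normalizations of two rows differ by at most 2 and are at least `n/4`, so
each term is off by at most `2 / (n/4)² = 32/n²`. -/
theorem abs_sum_weight_sub_one_le (hn : 4 ≤ n) (hB : 2 ≤ B) (j : Fin n) :
    |∑ i, weight B i j - 1| ≤ 32 / n := by
  have hn' : (0 : ℝ) < n := by exact_mod_cast (by omega : 0 < n)
  have hS := fun i : Fin n => le_sum_diffBlock hn hB i
  have hS0 : ∀ i : Fin n, 0 < ∑ k, diffBlock B i k := fun i =>
    lt_of_lt_of_le (by positivity) (hS i)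
  have e : ∑ i, weight B i j - 1 = ∑ i, diffBlock B i j *
      (1 / ∑ k, diffBlock B i k - 1 / ∑ k, diffBlock B j k) := by
    have h1 : ∑ i, diffBlock B i j * (1 / ∑ k, diffBlock B j k) = 1 := by
      rw [← Finset.sum_mul]
      simp_rw [fun i => diffBlock_comm (B := B) i j]
      rw [mul_one_div, div_self (hS0 j).ne']
    simp_rw [mul_sub]
    rw [Finset.sum_sub_distrib, h1]
    simp only [weight, mul_one_div]
  rw [e]
  have hb : ∀ i, |diffBlock B i j * (1 / ∑ k, diffBlock B i k - 1 / ∑ k, diffBlock B j k)| ≤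
      32 / n ^ 2 := fun i => by
    have h1 := abs_le.1 (abs_sum_diffBlock_sub_le (B := B) (by omega) (by omega) i)
    have h2 := abs_le.1 (abs_sum_diffBlock_sub_le (B := B) (by omega) (by omega) j)
    have h3 : |∑ k, diffBlock B j k - ∑ k, diffBlock B i k| ≤ 2 := by
      rw [abs_le]; constructor <;> linarith [h1.1, h1.2, h2.1, h2.2]
    rw [abs_mul, abs_of_nonneg (diffBlock_nonneg i j),
      div_sub_div _ _ (hS0 i).ne' (hS0 j).ne', one_mul, mul_one, abs_div,
      abs_of_pos (mul_pos (hS0 i) (hS0 j))]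
    calc _ ≤ 1 * (2 / ((n : ℝ) / 4 * (n / 4))) := by
          refine mul_le_mul (diffBlock_le_one i j) ?_
            (div_nonneg (abs_nonneg _) (mul_pos (hS0 i) (hS0 j)).le) zero_le_one
          have := (hS0 i).le
          have := hS i
          have := hS j
          gcongr
      _ = 32 / n ^ 2 := by field_simp; norm_num
  refine (Finset.abs_sum_le_sum_abs _ _).trans ((Finset.sum_le_sum fun i _ => hb i).trans ?_)
  simp only [Finset.sum_const, Finset.card_univ, Fintype.card_fin, nsmul_eq_mul]
  exact le_of_eq (by field_simp)

end Block

/-- The coefficients of the leave-out estimator as a quadratic statistic. -/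
def leaveOutMatrix (B : ℕ → ℕ) (n : ℕ) (j k : Fin n) : ℝ :=
  1 / (n : ℝ) * ∑ i, weight (B n) i j * weight (B n) i k

theorem nearUniform_leaveOutMatrix {B : ℕ → ℕ} (hB : ∀ n, 2 ≤ n → 2 ≤ B n) :
    NearUniform (leaveOutMatrix B) := by
  -- The constant is `2 · 32` from the column sums of the weights plus `2 · 16` from the removed
  -- diagonal entry.
  refine ⟨96, (eventually_ge_atTop 4).mono fun n hn => ?_⟩
  have hn' : (0 : ℝ) < n := by exact_mod_cast (by omega : 0 < n)
  have hBn := hB n (by omega)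
  have hw := fun i j : Fin n => weight_le hn hBn i j
  have hsum : ∀ j, ∑ k, leaveOutMatrix B n j k = 1 / n * ∑ i, weight (B n) i j := fun j => by
    simp only [leaveOutMatrix]
    rw [← Finset.mul_sum, Finset.sum_comm]
    simp_rw [← Finset.mul_sum, sum_weight hn hBn, mul_one]
  have hsym : ∀ j k, leaveOutMatrix B n k j = leaveOutMatrix B n j k := fun j k => by
    simp only [leaveOutMatrix, mul_comm (weight (B n) _ k)]
  have hpos : ∀ j k, 0 ≤ leaveOutMatrix B n j k := fun j k =>
    mul_nonneg (by positivity) (Finset.sum_nonneg fun i _ =>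
      mul_nonneg (weight_nonneg i j) (weight_nonneg i k))
  have hle : ∀ j k, leaveOutMatrix B n j k ≤ 16 / n ^ 2 := fun j k => by
    calc leaveOutMatrix B n j k ≤ 1 / n * ∑ _i : Fin n, 4 / (n : ℝ) * (4 / n) := by
          refine mul_le_mul_of_nonneg_left (Finset.sum_le_sum fun i _ => ?_) (by positivity)
          exact mul_le_mul (hw i j) (hw i k) (weight_nonneg i k) (by positivity)
      _ = 16 / n ^ 2 := by
          simp only [Finset.sum_const, Finset.card_univ, Fintype.card_fin, nsmul_eq_mul]
          field_simp
          norm_num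
  refine ⟨fun j k => ?_, ?_, fun j => ?_⟩
  · rw [abs_of_nonneg (hpos j k)]
    refine (hle j k).trans ?_
    gcongr
    norm_num
  · simp_rw [hsum]
    rw [← Finset.mul_sum, Finset.sum_comm]
    simp_rw [sum_weight hn hBn]
    simp [hn'.ne']
  · rw [sum_offDiag_add_offDiag]
    simp_rw [fun k => hsym j k]
    rw [hsum]
    have e : 1 / (n : ℝ) * ∑ i, weight (B n) i j + 1 / n * ∑ i, weight (B n) i j -
        2 * leaveOutMatrix B n j j - 2 / n =
        2 / n * (∑ i, weight (B n) i j - 1) - 2 * leaveOutMatrix B n j j := by ring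
    rw [e]
    refine (abs_sub _ _).trans ?_
    rw [abs_mul, abs_mul, abs_two, abs_of_nonneg (hpos j j),
      abs_of_pos (by positivity : (0 : ℝ) < 2 / n)]
    calc _ ≤ 2 / (n : ℝ) * (32 / n) + 2 * (16 / n ^ 2) := by
          have := abs_sum_weight_sub_one_le hn hBn j
          have := hle j j
          gcongr
      _ = 96 / n ^ 2 := by field_simp; norm_num

theorem diffBlock_card (hn : 0 < n) (i j : Fin n) :
    diffBlock n i j = if i = j then 0 else 1 := by
  have hb : ∀ i, block n n i = i := fun i => by
    have : (n : ℚ) ≠ 0 := by exact_mod_cast hn.ne'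
    rw [block, mul_div_cancel_right₀ _ this, Nat.ceil_natCast]
  simp [diffBlock, hb, Fin.ext_iff]

/-- With singleton blocks the trace is `1/(n-1)`. This agrees with `1/n` to second order, and the
mismatch is exactly `-2/(n(n-1))`. The trace is not zero because the leave-out density estimate is
squared. -/
theorem abs_leaveOneOut_diag_le (hn : 4 ≤ n) :
    |(1 - ∑ j, leaveOutMatrix id n j j) / n - ∑ j, leaveOutMatrix id n j j| ≤ 4 / n ^ 2 := by
  have hn' : (4 : ℝ) ≤ n := by exact_mod_cast hn
  have hn1 : (0 : ℝ) < n - 1 := by linarith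
  have hd : ∀ i j : Fin n, diffBlock n i j = 1 - if i = j then (1 : ℝ) else 0 := fun i j => by
    rw [diffBlock_card (by omega)]; split_ifs <;> norm_num
  have hS : ∀ i : Fin n, ∑ k, diffBlock n i k = n - 1 := fun i => by
    simp_rw [hd, Finset.sum_sub_distrib]
    simp
  have htr : ∑ j, leaveOutMatrix id n j j = 1 / (n - 1) := by
    have hA : ∀ j, leaveOutMatrix id n j j = 1 / (n * (n - 1)) := fun j => by
      have h1 : ∀ i : Fin n, weight n i j * weight n i j =
          diffBlock n j i * (1 / ((n : ℝ) - 1) ^ 2) := fun i => by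
        rw [weight, hS, diffBlock_comm i j]
        have : diffBlock n j i * diffBlock n j i = diffBlock n j i := by
          rw [diffBlock_card (by omega)]; split_ifs <;> norm_num
        rw [div_mul_div_comm, this]
        ring
      simp only [leaveOutMatrix, id]
      simp_rw [h1]
      rw [← Finset.sum_mul, hS]
      field_simp
    simp_rw [hA]
    simp only [Finset.sum_const, Finset.card_univ, Fintype.card_fin, nsmul_eq_mul]
    field_simp
  rw [htr]
  have e : (1 - 1 / ((n : ℝ) - 1)) / n - 1 / (n - 1) = -(2 / (n * (n - 1))) := by
    field_simp
    ring
  rw [e, abs_neg, abs_of_pos (by positivity), div_le_div_iff₀ (by positivity) (by positivity)]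
  nlinarith

/-! #### Cross-fit weights -/

/-- The weights of the first half of the sample. -/
def firstHalf (n : ℕ) (k : Fin n) : ℝ :=
  if (k : ℕ) + 1 ≤ n / 2 then 1 / ((n / 2 : ℕ) : ℝ) else 0

/-- The weights of the second half of the sample. -/
def secondHalf (n : ℕ) (j : Fin n) : ℝ :=
  if n / 2 < (j : ℕ) + 1 then 1 / ((n - n / 2 : ℕ) : ℝ) else 0

/-- An index lies in only one half, so the diagonal vanishes and its row plus column sum is `1/m` or
`1/(n-m)` with `m = ⌊n/2⌋`. Each is `2/n + O(n⁻²)`, because the halves differ in size by at most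
one. The zero trace leaves a mismatch of exactly `1/n`. -/
theorem nearUniform_crossFit : NearUniform fun n j k => secondHalf n j * firstHalf n k := by
  refine ⟨8, (eventually_ge_atTop 2).mono fun n hn => ?_⟩
  set m := n / 2 with hm
  have hm0 : 0 < m := by omega
  have hnm : 0 < n - m := by omega
  have hn' : (0 : ℝ) < n := by exact_mod_cast (by omega : 0 < n)
  have hm' : (0 : ℝ) < m := by exact_mod_cast hm0
  have hnm' : (0 : ℝ) < (n - m : ℕ) := by exact_mod_cast hnm
  have hm4 : (n : ℝ) / 4 ≤ m := by
    have : (n : ℝ) ≤ 4 * m := by exact_mod_cast (by omega : n ≤ 4 * m)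
    linarith
  have hnm2 : (n : ℝ) / 2 ≤ (n - m : ℕ) := by
    have : (n : ℝ) ≤ 2 * (n - m : ℕ) := by exact_mod_cast (by omega : n ≤ 2 * (n - m))
    linarith
  have hadd : ((n - m : ℕ) : ℝ) = n - m := by rw [Nat.cast_sub (by omega)]
  have hmle : (n : ℝ) - 1 ≤ 2 * m ∧ (2 * m : ℝ) ≤ n := by
    constructor
    · have : (n : ℝ) ≤ 2 * m + 1 := by exact_mod_cast (by omega : n ≤ 2 * m + 1)
      linarith
    · exact_mod_cast (by omega : 2 * m ≤ n)
  have hc : (Finset.univ.filter fun k : Fin n => (k : ℕ) + 1 ≤ m).card = m := by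
    simp_rw [Nat.add_one_le_iff]
    rw [Fin.card_filter_val_lt]
    omega
  have hc2 : (Finset.univ.filter fun k : Fin n => m < (k : ℕ) + 1).card = n - m := by
    have := Finset.card_filter_add_card_filter_not (s := (Finset.univ : Finset (Fin n)))
      (fun k : Fin n => (k : ℕ) + 1 ≤ m)
    rw [hc, Finset.card_univ, Fintype.card_fin] at this
    simp only [not_le] at this
    omega
  have h1 : ∑ k, firstHalf n k = 1 := by
    simp only [firstHalf, ← hm]
    rw [← Finset.sum_filter, Finset.sum_const, hc, nsmul_eq_mul, mul_one_div, div_self hm'.ne']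
  have h2 : ∑ k, secondHalf n k = 1 := by
    simp only [secondHalf, ← hm]
    rw [← Finset.sum_filter, Finset.sum_const, hc2, nsmul_eq_mul, mul_one_div, div_self hnm'.ne']
  have h1n : ∀ k, 0 ≤ firstHalf n k := fun k => by
    rw [firstHalf]; split_ifs <;> positivity
  have h2n : ∀ k, 0 ≤ secondHalf n k := fun k => by
    rw [secondHalf]; split_ifs <;> positivity
  have h1b : ∀ k, firstHalf n k ≤ 4 / n := fun k => by
    have : 1 / (m : ℝ) ≤ 4 / n := by
      rw [div_le_div_iff₀ hm' hn']; linarith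
    rw [firstHalf]; split_ifs
    · exact this
    · positivity
  have h2b : ∀ k, secondHalf n k ≤ 2 / n := fun k => by
    have : 1 / ((n - m : ℕ) : ℝ) ≤ 2 / n := by
      rw [div_le_div_iff₀ hnm' hn']; linarith
    rw [secondHalf]; split_ifs
    · exact this
    · positivity
  refine ⟨fun j k => ?_, ?_, fun j => ?_⟩
  · rw [abs_of_nonneg (mul_nonneg (h2n j) (h1n k))]
    calc _ ≤ 2 / (n : ℝ) * (4 / n) := mul_le_mul (h2b j) (h1b k) (h1n k) (by positivity)
      _ = 8 / n ^ 2 := by field_simp; norm_num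
  · rw [← Finset.sum_mul_sum, h1, h2, one_mul]
  · rw [sum_offDiag_add_offDiag, ← Finset.mul_sum, ← Finset.sum_mul, h1, h2, mul_one, one_mul]
    have hcase : secondHalf n j + firstHalf n j - 2 * (secondHalf n j * firstHalf n j) =
        1 / ((n : ℝ) - m) ∨
        secondHalf n j + firstHalf n j - 2 * (secondHalf n j * firstHalf n j) = 1 / (m : ℝ) := by
      rw [firstHalf, secondHalf, ← hm]
      by_cases h : (j : ℕ) + 1 ≤ m
      · right
        simp [h, not_lt.2 h]
      · left
        rw [if_neg h, if_pos (not_le.1 h), hadd]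
        simp
    rw [hadd] at hnm' hnm2
    rcases hcase with h | h
    · rw [h, div_sub_div _ _ hnm'.ne' hn'.ne', abs_div,
        abs_of_pos (mul_pos hnm' hn'), div_le_div_iff₀ (mul_pos hnm' hn') (by positivity)]
      have : |1 * (n : ℝ) - (n - m) * 2| ≤ 1 := by
        rw [abs_le]; constructor <;> linarith [hmle.1, hmle.2]
      calc _ ≤ 1 * (n : ℝ) ^ 2 := by gcongr
        _ ≤ 8 * ((n - m) * n) := by nlinarith
    · rw [h, div_sub_div _ _ hm'.ne' hn'.ne', abs_div,
        abs_of_pos (mul_pos hm' hn'), div_le_div_iff₀ (mul_pos hm' hn') (by positivity)]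
      have : |1 * (n : ℝ) - m * 2| ≤ 1 := by
        rw [abs_le]; constructor <;> linarith [hmle.1, hmle.2]
      calc _ ≤ 1 * (n : ℝ) ^ 2 := by gcongr
        _ ≤ 8 * (m * n) := by nlinarith

/-! #### The estimators as quadratic statistics -/

variable {d : ℕ} {P : ℝ} {K : E d → ℝ}

theorem CondK.isd_eq (hK : CondK d P K) {h : ℝ} (hh : 0 < h) (x : Fin n → E d) :
    isd K h x = ∑ j, ∑ k, 1 / (n : ℝ) ^ 2 * scaledKernel (autocorr K) h (x j - x k) := by
  have e : ∀ y, kde K h x y ^ 2 = (∑ j, 1 / (n : ℝ) * scaledKernel K h (y - x j)) *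
      ∑ k, 1 / (n : ℝ) * scaledKernel K h (y - x k) := fun y => by
    rw [kde, sq, Finset.mul_sum]
  simp_rw [isd, e]
  rw [hK.integral_sum_mul_sum hh x (fun _ => 1 / (n : ℝ)) (fun _ => 1 / (n : ℝ))]
  refine Finset.sum_congr rfl fun j _ => Finset.sum_congr rfl fun k _ => ?_
  ring

theorem CondK.isdLO_eq (hK : CondK d P K) {h : ℝ} (hh : 0 < h) (B : ℕ → ℕ) (x : Fin n → E d) :
    isdLO (B n) K h x =
      ∑ j, ∑ k, leaveOutMatrix B n j k * scaledKernel (autocorr K) h (x j - x k) := by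
  have e : ∀ i, ∫ y, kdeLO (B n) K h x i y ^ 2 = ∑ j, ∑ k, weight (B n) i j * weight (B n) i k *
      scaledKernel (autocorr K) h (x j - x k) := fun i => by
    rw [← hK.integral_sum_mul_sum hh x (weight (B n) i) (weight (B n) i)]
    simp only [kdeLO, sq]
  simp_rw [isdLO, e]
  rw [Finset.sum_comm, Finset.mul_sum]
  refine Finset.sum_congr rfl fun j _ => ?_
  rw [Finset.sum_comm, Finset.mul_sum]
  refine Finset.sum_congr rfl fun k _ => ?_
  rw [leaveOutMatrix, ← Finset.sum_mul, mul_assoc]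

theorem CondK.isdDCF_eq (hK : CondK d P K) {h : ℝ} (hh : 0 < h) (hn : 2 ≤ n) (x : Fin n → E d) :
    isdDCF K h x = ∑ j, ∑ k, secondHalf n j * firstHalf n k *
      scaledKernel (autocorr K) h (x j - x k) := by
  rw [← hK.integral_sum_mul_sum hh x (secondHalf n) (firstHalf n), isdDCF]
  -- For `n ≥ 2` observation 1 is in the first half and observation `n` in the second, so their
  -- cross-fit estimates average over the second and the first half respectively.
  have h1 : (1 : ℕ) ≤ n / 2 := by omega
  have h2 : ¬ n ≤ n / 2 := by omega
  simp only [kdeCF, if_pos h1, if_neg h2, Finset.mul_sum, secondHalf, firstHalf, ite_mul, zero_mul,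
    mul_ite, mul_zero]

end AvgDensity

end

theorem theorem4 {Ω : Type*} [MeasurableSpace Ω] (μ : Measure Ω) [IsProbabilityMeasure μ]
    (d : ℕ) (hd : 0 < d)
    -- the density and the i.i.d. data
    (f₀ : AvgDensity.E d → ℝ) (hf_meas : Measurable f₀) (hf_nonneg : ∀ x, 0 ≤ f₀ x)
    (X : ℕ → Ω → AvgDensity.E d) (hX_indep : iIndepFun X μ)
    (hX_law : ∀ i, HasLaw (X i) (AvgDensity.densityLaw f₀) μ)
    -- the limiting variance is not degenerate
    (hσ : 0 < AvgDensity.sigma0Sq f₀)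
    -- the conditions on the density and the kernel
    (s : ℝ) (hD : AvgDensity.CondD d s f₀)
    (K : AvgDensity.E d → ℝ) (P : ℝ) (hK : AvgDensity.CondK d P K)
    -- the bandwidth
    (h : ℕ → ℝ) (h_pos : ∀ n, 0 < h n) :
    (AvgDensity.CondB d (min (P / 2) s) h →
      AvgDensity.BootstrapConsistent μ X (AvgDensity.theta0 f₀)
          (fun n => AvgDensity.isd K (h n)) ∧
      (∀ c : ℝ, 0 < c → c ≠ 1 →
        AvgDensity.BootstrapConsistent μ X (AvgDensity.theta0 f₀)
          (fun n => AvgDensity.isdGJ K c (h n))) ∧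
      AvgDensity.BootstrapConsistent μ X (AvgDensity.theta0 f₀)
          (fun n => AvgDensity.isdLO n K (h n))) ∧
    (AvgDensity.CondBPlus d (min (P / 2) s) h →
      AvgDensity.BootstrapConsistent μ X (AvgDensity.theta0 f₀)
          (fun n => AvgDensity.isdBC K (h n)) ∧
      (∀ B : ℕ → ℕ, (∀ n, 2 ≤ n → 2 ≤ B n ∧ B n ≤ n) →
        AvgDensity.BootstrapConsistent μ X (AvgDensity.theta0 f₀)
          (fun n => AvgDensity.isdLO (B n) K (h n))) ∧
      AvgDensity.BootstrapConsistent μ X (AvgDensity.theta0 f₀)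
          (fun n => AvgDensity.isdDCF K (h n))) := by
  have hκ := hK.evenKernel_autocorr
  have hP := hK.P_gt
  have hS : 0 < min (P / 2) s :=
    lt_min (half_pos hK.P_pos) (lt_of_le_of_lt (by positivity) hD.s_gt)
  have hzero : Tendsto (fun n : ℕ => √(n : ℝ) * (0 : ℝ)) atTop (𝓝 0) := by simp
  have huniform : ∀ᶠ n : ℕ in atTop, |(1 - ∑ _j : Fin n, 1 / (n : ℝ) ^ 2) / (n : ℝ) -
      ∑ _j : Fin n, 1 / (n : ℝ) ^ 2| ≤ 1 / (n : ℝ) ^ 2 :=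
    (eventually_gt_atTop 0).mono fun n hn => AvgDensity.abs_uniform_diag_le hn
  refine ⟨fun hB => ⟨?_, fun c hc hc1 => ?_, ?_⟩, fun hB => ?_⟩
  · refine AvgDensity.bootstrapConsistent_of_kernel hf_meas hf_nonneg hX_indep hX_law hσ hD hκ hP
      h_pos hB.upper hB.lower AvgDensity.nearUniform_uniform
      (AvgDensity.tendsto_diag_of_abs_le (A := fun n _ _ => 1 / (n : ℝ) ^ 2) hB.lower h_pos
        huniform) hzero
      (Eventually.of_forall fun n y => ?_)
    rw [hK.isd_eq (h_pos n), add_zero]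
  -- Positivity of `d` is essential here: `c ≠ 1` gives `c ^ d ≠ 1` only for `d > 0`.
  · have hc1' : 1 - c ^ d ≠ 0 := sub_ne_zero.2 fun h1 =>
      hc1 ((pow_eq_one_iff_of_nonneg hc.le hd.ne').1 h1.symm)
    have hκ' := hκ.affine_combination (hκ.scaledKernel hc)
      (show 1 / (1 - c ^ d) + -(c ^ d / (1 - c ^ d)) = 1 by
        rw [← sub_eq_add_neg, ← sub_div, div_self hc1'])
    refine AvgDensity.bootstrapConsistent_of_kernel hf_meas hf_nonneg hX_indep hX_law hσ hD hκ' hP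
      h_pos hB.upper hB.lower AvgDensity.nearUniform_uniform
      (AvgDensity.tendsto_diag_of_abs_le (A := fun n _ _ => 1 / (n : ℝ) ^ 2) hB.lower h_pos
        huniform) hzero
      (Eventually.of_forall fun n y => ?_)
    rw [AvgDensity.isdGJ, hK.isd_eq (h_pos n), hK.isd_eq (mul_pos hc (h_pos n)), add_zero,
      Finset.mul_sum, Finset.mul_sum, ← Finset.sum_sub_distrib]
    refine Finset.sum_congr rfl fun j _ => ?_
    rw [Finset.mul_sum, Finset.mul_sum, ← Finset.sum_sub_distrib]
    refine Finset.sum_congr rfl fun k _ => ?_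
    -- Rescaling by `c h` is rescaling by `c`, then by `h`, so both terms share the bandwidth `h`.
    rw [← AvgDensity.scaledKernel_scaledKernel]
    simp only [AvgDensity.scaledKernel]
    ring
  · refine AvgDensity.bootstrapConsistent_of_kernel hf_meas hf_nonneg hX_indep hX_law hσ hD hκ hP
      h_pos hB.upper hB.lower (AvgDensity.nearUniform_leaveOutMatrix (B := id) fun n hn => hn)
      (AvgDensity.tendsto_diag_of_abs_le (A := AvgDensity.leaveOutMatrix id) hB.lower h_pos
        ((eventually_ge_atTop 4).mono fun n hn =>
        AvgDensity.abs_leaveOneOut_diag_le hn)) hzero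
      (Eventually.of_forall fun n y => ?_)
    rw [add_zero]
    exact hK.isdLO_eq (h_pos n) id y
  · have hlow := hB.tendsto_mul_pow hS h_pos
    refine ⟨?_, fun B hBn => ?_, ?_⟩
    -- The bias correction is an additive constant. The uniform weights need only the weaker
    -- bandwidth condition for the diagonal; the stronger one makes the correction itself negligible
    -- after scaling by `√n`.
    · refine AvgDensity.bootstrapConsistent_of_kernel
        (c := fun n => -((∫ u, K u ^ 2) / ((n : ℝ) * h n ^ d))) hf_meas hf_nonneg hX_indep hX_law
        hσ hD hκ hP h_pos hB.upper hlow AvgDensity.nearUniform_uniform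
        (AvgDensity.tendsto_diag_of_abs_le (A := fun n _ _ => 1 / (n : ℝ) ^ 2) hlow h_pos
          huniform) ?_
        (Eventually.of_forall fun n y => ?_)
      · have := (AvgDensity.tendsto_sqrt_mul_one_div_of_condBPlus hB.lower h_pos).mul_const
          (-∫ u, K u ^ 2)
        rw [zero_mul] at this
        refine this.congr fun n => ?_
        rw [one_div_mul_one_div]
        ring
      · rw [AvgDensity.isdBC, hK.isd_eq (h_pos n), sub_eq_add_neg]
    · have hA := AvgDensity.nearUniform_leaveOutMatrix (B := B) fun n hn => (hBn n hn).1
      refine AvgDensity.bootstrapConsistent_of_kernel hf_meas hf_nonneg hX_indep hX_law hσ hD hκ hP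
        h_pos hB.upper hlow hA (hA.tendsto_diag hB.lower h_pos) hzero
        (Eventually.of_forall fun n y => ?_)
      rw [add_zero]
      exact hK.isdLO_eq (h_pos n) B y
    · have hA := AvgDensity.nearUniform_crossFit
      refine AvgDensity.bootstrapConsistent_of_kernel hf_meas hf_nonneg hX_indep hX_law hσ hD hκ hP
        h_pos hB.upper hlow hA (hA.tendsto_diag hB.lower h_pos) hzero
        ((eventually_ge_atTop 2).mono fun n hn y => ?_)
      rw [add_zero]
      exact hK.isdDCF_eq (h_pos n) hn y
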